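/- Let $k$ be a perfect field of characteristic $p>0$, $W=W(k)$ its ring of Witt vectors with Frobenius $\sigma$, and $$A=W[F,V]/(FV-p,\ VF-p,\ Fa-a^{\sigma}F,\ Va-a^{\sigma^{-1}}V\ \ \forall a\in W).$$ A finite group scheme $\mathrm{Spec}\,R$ over $k$ is infinitesimal if $R$ is local; $\mathcal{A}$ denotes the category of finite commutative infinitesimal group schemes over $k$ whose Cartier dual is also infinitesimal. For a finite commutative $G=\mathrm{Spec}\,R$ write $a^*:R\to R\otimes_k R$ for the comultiplication, $0^*:R\to k$ for the counit, $V^*:R\to R$ for the comorphism of the Verschiebung $V_{G/k}$ (identifying the coordinate ring of $G^{(p)}$ with $R$ as a ring), and $p^{i*}x=(V^{i*}x)^{p^i}$. Let $\phi_n(x_0,y_0,\dots,x_n,y_n)$ be the $n$-th Witt vector addition polynomial, let $W_n=\mathrm{Spec}\,k[x_0,\dots,x_n]$ be the additive group scheme of Witt vectors of length $n+1$, and $W_{n,m}=W_n[F^{m+1}]$. If $V_{G/k}^{n+1}=0$, a Dieudonné element of $G$ is an $x\in\ker(0^*)$ with $$a^*(x)=\phi_n(V^{n*}x\otimes 1,\,1\otimes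 V^{n*}x,\dots,x\otimes 1,\,1\otimes x);$$ the set $D(G)\subset R$ of these is independent of the choice of $n$. **(i)** Let $G=\mathrm{Spec}\,R$ be a finite commutative infinitesimal group scheme over $k$ with $V_{G/k}^{n+1}=0$. Then $f\mapsto f^*(x_n)$ is a bijection from the $k$-group scheme homomorphisms $G\to W_n$ to $D(G)$, and every such $f$ satisfies $f^*(x_i)=V^{(n-i)*}f^*(x_n)$ for $0\le i\le n$. **(ii)** For $G,n$ as in (i), $D(G)$ is an $A$-module with sum $x\dotplus y=\phi_n(V^{n*}x,V^{n*}y,\dots,x,y)$, zero element $0$, negative of $x$ equal to $(-1_G)^*x$ (which is $-x$ when $p$ is odd), $Fx=x^p$, $Vx=V^*x$, and with $c=(c_0,c_1,\dots)\in W$ acting through $W_n(k)$ by $$c\,\dot\times_n\, x=c_0^{p^n}x\dotplus c_1^{p^{n-1}}p^*x\dotplus\cdots\dotplus c_n\,p^{n*}x .$$ For $c\in k$ and $x\in D(G)$ one has $cx\in D(G)$ and $cx=\tau(c^{p^{-n}})\,\dot\times_n\,x$, where $\tau$ is the Teichmüller lift. As a $W$-module, $D(G)$ has finite length. **(iii)**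 Let $f:G=\mathrm{Spec}\,R\to G'=\mathrm{Spec}\,R'$ be a morphism in $\mathcal{A}$. Then $f^*:R'\to R$ maps $D(G')$ into $D(G)$, and it is $A$-linear for the module structures of (ii) formed with the same $n$, whenever $V_{G/k}^{n+1}=0$ and $V_{G'/k}^{n+1}=0$. Every $G\in\mathcal{A}$ has $V_{G/k}^{n+1}=0$ for some $n$; letting $\sigma^n(c)$ act on $D(G)$ by $c\,\dot\times_n$ (with $\dotplus$, $F$, $V$ as in (ii)) gives an $A$-module structure, of finite length over $W$, that does not depend on $n$, and with it $G\mapsto D(G)$, $f\mapsto f^*$ is a contravariant functor from $\mathcal{A}$ to $A$-modules. If $f$ is an epimorphism in $\mathcal{A}$, then $\ker f\in\mathcal{A}$ and $$0\to D(G')\xrightarrow{\ f^*\ }D(G)\to D(\ker f)$$ is exact. **(iv)** For $G$ as in (i), let $\alpha(G)=\{x\in R: a^*(x)=x\otimes1+1\otimes x\}$. Then $\alpha(G)\subset D(G)$, and $D(G)=\alpha(G)$ if $V_{G/k}=0$. If $G$ is isomorphic to some $\alpha_p^s$, then $D(G)\cong(A/A(F,V))^{\oplus r}$ as $A$-modules,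 where $r=\dim_k\mathrm{Hom}_k(\alpha_p,G)$ (for each of the module structures above). **(v)** Let $G=\mathrm{Spec}\,R\in\mathcal{A}$ and let $x\in D(G)$ satisfy $V^{(n+1)*}x=0$. Then there is a unique $k$-group scheme homomorphism $f:G\to W_n$ with $f^*(x_n)=x$. If moreover $x^{p^{m+1}}=0$, there is a unique $k$-group scheme homomorphism $f:G\to W_{n,m}$ with $f^*(x_n)=x$. -/

import Mathlib

open CategoryTheory TensorProduct

universe u

noncomputable section

namespace Dieudonne

/-! ### Witt polynomials -/

section Witt

variable (p : ℕ) [Fact p.Prime]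

/-- `φ_n(u₀, v₀, …, u_n, v_n)`: the `n`-th polynomial of Witt vector addition, evaluated at two
sequences of elements of a commutative ring. Only the entries with index at most `n` matter. -/
def wittPhi {B : Type*} [CommRing B] (n : ℕ) (u v : ℕ → B) : B :=
  WittVector.peval (WittVector.wittAdd p n) ![u, v]

variable {p}

theorem wittPhi_eq_coeff {B : Type*} [CommRing B] (n : ℕ) (u v : ℕ → B) :
    wittPhi p n u v = (WittVector.mk p u + WittVector.mk p v).coeff n := by
  rw [WittVector.add_coeff]; rfl

theorem peval_congr {B : Type*} [CommRing B] {N n : ℕ} {f : MvPolynomial (Fin N × ℕ) ℤ}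
    (hf : f.vars ⊆ Finset.univ ×ˢ Finset.range (n + 1)) {u v : Fin N → ℕ → B}
    (h : ∀ a, ∀ j ≤ n, u a j = v a j) : WittVector.peval f u = WittVector.peval f v := by
  unfold WittVector.peval
  rw [MvPolynomial.aeval_def, MvPolynomial.aeval_def]
  refine MvPolynomial.eval₂Hom_congr' rfl ?_ rfl
  rintro ⟨a, j⟩ hj _
  have := hf hj
  simp only [Finset.mem_product, Finset.mem_univ, Finset.mem_range, true_and] at this
  exact h a j (by omega)

theorem wittPhi_congr {B : Type*} [CommRing B] {n : ℕ} {u u' v v' : ℕ → B}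
    (hu : ∀ j ≤ n, u j = u' j) (hv : ∀ j ≤ n, v j = v' j) :
    wittPhi p n u v = wittPhi p n u' v' := by
  refine peval_congr (WittVector.wittAdd_vars p n) ?_
  intro a j hj
  fin_cases a
  · exact hu j hj
  · exact hv j hj

theorem map_peval {B C G : Type*} [CommRing B] [CommRing C] [FunLike G B C]
    [RingHomClass G B C] {N : ℕ} (g : G)
    (f : MvPolynomial (Fin N × ℕ) ℤ) (u : Fin N → ℕ → B) :
    g (WittVector.peval f u) = WittVector.peval f (fun a j => g (u a j)) := by
  change (g : B →+* C) _ = _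
  unfold WittVector.peval
  simp only [MvPolynomial.aeval_def]
  rw [MvPolynomial.hom_eval₂]
  congr 1
  exact RingHom.ext_int _ _

theorem map_wittPhi {B C G : Type*} [CommRing B] [CommRing C] [FunLike G B C]
    [RingHomClass G B C] (g : G) (n : ℕ) (u v : ℕ → B) : g (wittPhi p n u v) = wittPhi p n (fun j => g (u j)) (fun j => g (v j)) := by
  unfold wittPhi
  rw [map_peval]
  congr 1
  funext a j
  fin_cases a <;> rfl

end Witt

/-! ### The truncated Witt scheme -/

section WittScheme

/-- The coordinate ring `k[x₀, …, x_n]` of the truncated Witt scheme `W_n` over `k`. -/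
def WittHopf (_p n : ℕ) (k : Type u) [CommRing k] : Type u := MvPolynomial (Fin (n + 1)) k

namespace WittHopf

variable (p n : ℕ) (k : Type u) [CommRing k]

instance : CommRing (WittHopf p n k) := inferInstanceAs (CommRing (MvPolynomial (Fin (n + 1)) k))

instance : Algebra k (WittHopf p n k) :=
  inferInstanceAs (Algebra k (MvPolynomial (Fin (n + 1)) k))

/-- The coordinate `x_j` of `W_n` (with the convention `x_j = 0` for `j > n`). -/
def x (j : ℕ) : WittHopf p n k :=
  if h : j < n + 1 then (MvPolynomial.X ⟨j, h⟩ : MvPolynomial (Fin (n + 1)) k) else 0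

variable {k}

/-- The algebra map `k[x₀, …, x_n] → B` with prescribed values on the coordinates. -/
def lift {B : Type*} [CommRing B] [Algebra k B] (b : ℕ → B) : WittHopf p n k →ₐ[k] B :=
  (MvPolynomial.aeval fun i : Fin (n + 1) => b i : MvPolynomial (Fin (n + 1)) k →ₐ[k] B)

variable {p n}

theorem lift_x {B : Type*} [CommRing B] [Algebra k B] (b : ℕ → B) {j : ℕ} (hj : j ≤ n) :
    lift p n b (x p n k j) = b j := by
  have h : j < n + 1 := by omega
  have hx : x p n k j = (MvPolynomial.X ⟨j, h⟩ : MvPolynomial (Fin (n + 1)) k) := dif_pos h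
  rw [hx]
  exact MvPolynomial.aeval_X _ _

theorem hom_ext {B : Type*} [CommRing B] [Algebra k B] {f g : WittHopf p n k →ₐ[k] B}
    (h : ∀ j ≤ n, f (x p n k j) = g (x p n k j)) : f = g := by
  refine MvPolynomial.algHom_ext (A := B) (f := f) (g := g) fun i => ?_
  have hx : x p n k i = (MvPolynomial.X i : MvPolynomial (Fin (n + 1)) k) := dif_pos i.2
  have := h i (by omega)
  rwa [hx] at this

variable (p n k)

/-- `x_i ↦ 0`. -/
def counitHom : WittHopf p n k →ₐ[k] k := lift p n fun _ => 0

variable {p n k} in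
theorem counitHom_x {i : ℕ} (hi : i ≤ n) : counitHom p n k (x p n k i) = 0 := lift_x _ hi

variable [Fact p.Prime]

/-- `x_i ↦ φ_i(x₀ ⊗ 1, 1 ⊗ x₀, …, x_i ⊗ 1, 1 ⊗ x_i)`. -/
def comulHom : WittHopf p n k →ₐ[k] WittHopf p n k ⊗[k] WittHopf p n k :=
  lift p n fun i => wittPhi p i (fun j => x p n k j ⊗ₜ[k] 1) (fun j => 1 ⊗ₜ[k] x p n k j)

/-- The inverse of `W_n`, given by the polynomials of Witt vector negation. -/
def antipodeHom : WittHopf p n k →ₐ[k] WittHopf p n k :=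
  lift p n fun i => WittVector.peval (WittVector.wittNeg p i) ![x p n k]

variable {p n k}

theorem comulHom_x {i : ℕ} (hi : i ≤ n) : comulHom p n k (x p n k i) =
    wittPhi p i (fun j => x p n k j ⊗ₜ[k] 1) (fun j => 1 ⊗ₜ[k] x p n k j) := lift_x _ hi

instance : Bialgebra k (WittHopf p n k) := by
  refine Bialgebra.ofAlgHom (comulHom p n k) (counitHom p n k) ?_ ?_ ?_
  · refine hom_ext fun i hi => ?_
    simp only [AlgHom.comp_apply, comulHom_x hi]
    set X := WittVector.mk p (fun j => x p n k j ⊗ₜ[k] ((1 : WittHopf p n k) ⊗ₜ[k]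
      (1 : WittHopf p n k))) with hX
    set Y := WittVector.mk p (fun j => (1 : WittHopf p n k) ⊗ₜ[k] (x p n k j ⊗ₜ[k]
      (1 : WittHopf p n k))) with hY
    set Z := WittVector.mk p (fun j => (1 : WittHopf p n k) ⊗ₜ[k] ((1 : WittHopf p n k) ⊗ₜ[k]
      x p n k j)) with hZ
    rw [map_wittPhi, map_wittPhi, map_wittPhi]
    have hl : ∀ j ≤ i, (Algebra.TensorProduct.assoc k k k (WittHopf p n k) (WittHopf p n k)
        (WittHopf p n k)).toAlgHom ((Algebra.TensorProduct.map (comulHom p n k)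
        (AlgHom.id k (WittHopf p n k))) (x p n k j ⊗ₜ[k] 1)) = (X + Y).coeff j := by
      intro j hj
      rw [Algebra.TensorProduct.map_tmul, comulHom_x (hj.trans hi)]
      have := map_wittPhi (p := p) ((Algebra.TensorProduct.assoc k k k (WittHopf p n k)
        (WittHopf p n k) (WittHopf p n k)).toAlgHom.comp
        (Algebra.TensorProduct.includeLeft (R := k) (S := k) (A := WittHopf p n k ⊗[k]
          WittHopf p n k) (B := WittHopf p n k))) j
          (fun j => x p n k j ⊗ₜ[k] 1) (fun j => 1 ⊗ₜ[k] x p n k j)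
      rw [wittPhi_eq_coeff (B := WittHopf p n k ⊗[k] (WittHopf p n k ⊗[k] WittHopf p n k))] at this
      exact this
    have hr : ∀ j ≤ i, (Algebra.TensorProduct.map (AlgHom.id k (WittHopf p n k))
        (comulHom p n k)) (1 ⊗ₜ[k] x p n k j) = (Y + Z).coeff j := by
      intro j hj
      rw [Algebra.TensorProduct.map_tmul, comulHom_x (hj.trans hi)]
      have := map_wittPhi (p := p) (Algebra.TensorProduct.includeRight (R := k)
        (B := WittHopf p n k ⊗[k] WittHopf p n k) (A := WittHopf p n k)) j
          (fun j => x p n k j ⊗ₜ[k] 1) (fun j => 1 ⊗ₜ[k] x p n k j)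
      rw [wittPhi_eq_coeff (B := WittHopf p n k ⊗[k] (WittHopf p n k ⊗[k] WittHopf p n k))] at this
      exact this
    trans ((X + Y) + Z).coeff i
    · rw [WittVector.add_coeff]
      refine wittPhi_congr (fun j hj => hl j hj) (fun j hj => ?_)
      simp [hZ, Algebra.TensorProduct.one_def]
    · rw [add_assoc, WittVector.add_coeff]
      refine (wittPhi_congr (fun j hj => ?_) (fun j hj => hr j hj)).symm
      simp [hX, Algebra.TensorProduct.one_def]
  · refine hom_ext fun i hi => ?_
    simp only [AlgHom.comp_apply, comulHom_x hi]
    rw [map_wittPhi]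
    trans (0 + WittVector.mk p (fun j => (1 : k) ⊗ₜ[k] x p n k j)).coeff i
    · rw [WittVector.add_coeff]
      refine wittPhi_congr (fun j hj => ?_) (fun j hj => ?_)
      · simp [counitHom_x (hj.trans hi)]
      · simp
    · simp
  · refine hom_ext fun i hi => ?_
    simp only [AlgHom.comp_apply, comulHom_x hi]
    rw [map_wittPhi]
    trans (WittVector.mk p (fun j => x p n k j ⊗ₜ[k] (1 : k)) + 0).coeff i
    · rw [WittVector.add_coeff]
      refine wittPhi_congr (fun j hj => ?_) (fun j hj => ?_)
      · simp
      · simp [counitHom_x (hj.trans hi)]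
    · simp

theorem antipodeHom_x {i : ℕ} (hi : i ≤ n) : antipodeHom p n k (x p n k i) =
    (-WittVector.mk p (x p n k)).coeff i := by
  rw [WittVector.neg_coeff]
  exact lift_x _ hi

/-- `W_n` is a group scheme over `k`. -/
instance : HopfAlgebra k (WittHopf p n k) := by
  refine HopfAlgebra.ofAlgHom (antipodeHom p n k) ?_ ?_
  · refine hom_ext fun i hi => ?_
    trans (Algebra.TensorProduct.lift (antipodeHom p n k) (.id k _) fun _ _ => Commute.all _ _)
      (wittPhi p i (fun j => x p n k j ⊗ₜ[k] 1) (fun j => 1 ⊗ₜ[k] x p n k j))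
    · exact congrArg _ (comulHom_x hi)
    trans algebraMap k _ (counitHom p n k (x p n k i))
    swap
    · rfl
    rw [counitHom_x hi, map_zero]
    rw [map_wittPhi]
    trans (-WittVector.mk p (x p n k) + WittVector.mk p (x p n k)).coeff i
    · rw [WittVector.add_coeff]
      refine wittPhi_congr (fun j hj => ?_) (fun j hj => ?_)
      · refine (Algebra.TensorProduct.lift_tmul _ _ _ _ _).trans ?_
        rw [map_one, mul_one, antipodeHom_x (hj.trans hi)]
      · refine (Algebra.TensorProduct.lift_tmul _ _ _ _ _).trans ?_
        rw [map_one, one_mul]; rfl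
    · simp
  · refine hom_ext fun i hi => ?_
    trans (Algebra.TensorProduct.lift (.id k _) (antipodeHom p n k) fun _ _ => Commute.all _ _)
      (wittPhi p i (fun j => x p n k j ⊗ₜ[k] 1) (fun j => 1 ⊗ₜ[k] x p n k j))
    · exact congrArg _ (comulHom_x hi)
    trans algebraMap k _ (counitHom p n k (x p n k i))
    swap
    · rfl
    rw [counitHom_x hi, map_zero]
    rw [map_wittPhi]
    trans (WittVector.mk p (x p n k) + -WittVector.mk p (x p n k)).coeff i
    · rw [WittVector.add_coeff]
      refine wittPhi_congr (fun j hj => ?_) (fun j hj => ?_)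
      · refine (Algebra.TensorProduct.lift_tmul _ _ _ _ _).trans ?_
        rw [map_one, mul_one]; rfl
      · refine (Algebra.TensorProduct.lift_tmul _ _ _ _ _).trans ?_
        rw [map_one, one_mul, antipodeHom_x (hj.trans hi)]
    · simp

end WittHopf

end WittScheme


/-! ### Frobenius kernels -/

section Frobenius

variable (p : ℕ) [Fact p.Prime] (k : Type u) [Field k] [CharP k p]

variable {p k} in
theorem add_pow_char_pow_algebra {B : Type*} [CommRing B] [Algebra k B] (N : ℕ) (a b : B) :
    (a + b) ^ p ^ N = a ^ p ^ N + b ^ p ^ N := by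
  have h0 : (p : B) = 0 := by
    rw [← map_natCast (algebraMap k B), CharP.cast_eq_zero, map_zero]
  rw [(Commute.all a b).add_pow_prime_pow_eq (Fact.out : p.Prime), h0]
  ring

/-- The ideal of `R` generated by the `p^N`-th powers of the elements of the augmentation ideal.
It defines the closed subgroup scheme `G[F^N]`, the kernel of the `N`-fold relative Frobenius
of `G = Spec R`. -/
def frobKernelIdeal (R : Type u) [CommRing R] [HopfAlgebra k R] (N : ℕ) : Ideal R :=
  Ideal.span {y | ∃ x : R, Coalgebra.counit (R := k) x = 0 ∧ y = x ^ p ^ N}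

instance (R : Type u) [CommRing R] [HopfAlgebra k R] (N : ℕ) :
    (frobKernelIdeal p k R N).IsHopfIdeal k := by
  set I := frobKernelIdeal p k R N with hI
  set π : R →ₐ[k] R ⧸ I := Ideal.Quotient.mkₐ k I
  have hmem : ∀ x : R, Coalgebra.counit (R := k) x = 0 → x ^ p ^ N ∈ I :=
    fun x hx => Ideal.subset_span ⟨x, hx, rfl⟩
  have hq : p ^ N ≠ 0 := pow_ne_zero _ (Fact.out : p.Prime).ne_zero
  have hπ : ∀ a : R, (π a) ^ p ^ N =
      algebraMap k _ ((Bialgebra.counitAlgHom k R a) ^ p ^ N) := by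
    intro a
    have h1 : a = (a - algebraMap k R (Coalgebra.counit a)) +
      algebraMap k R (Coalgebra.counit a) := by ring
    have h2 : π (a - algebraMap k R (Coalgebra.counit a)) ^ p ^ N = 0 := by
      rw [← map_pow]
      exact Ideal.Quotient.eq_zero_iff_mem.2 (hmem _ (by simp))
    conv_lhs => rw [h1]
    rw [map_add, add_pow_char_pow_algebra (k := k), h2, zero_add, AlgHom.commutes, map_pow]
    rfl
  have hcounit : ∀ x ∈ I, Bialgebra.counitAlgHom k R x = 0 := by
    have : I ≤ RingHom.ker (Bialgebra.counitAlgHom k R) := by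
      refine Ideal.span_le.2 ?_
      rintro _ ⟨x, hx, rfl⟩
      change Bialgebra.counitAlgHom k R (x ^ p ^ N) = 0
      rw [map_pow]
      change (Coalgebra.counit (R := k) x) ^ p ^ N = 0
      rw [hx, zero_pow hq]
    exact fun x hx => this hx
  have htens : ∀ t : R ⊗[k] R, (Algebra.TensorProduct.map π π t) ^ p ^ N =
      algebraMap k _ ((Algebra.TensorProduct.lmul' k (S := k)
        (Algebra.TensorProduct.map (Bialgebra.counitAlgHom k R)
          (Bialgebra.counitAlgHom k R) t)) ^ p ^ N) := by
    intro t
    induction t using TensorProduct.induction_on with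
    | zero => simp [zero_pow hq]
    | tmul a b =>
      simp only [Algebra.TensorProduct.map_tmul, Algebra.TensorProduct.tmul_pow, hπ,
        Algebra.TensorProduct.lmul'_apply_tmul, mul_pow, map_mul]
      simp only [Algebra.algebraMap_eq_smul_one, TensorProduct.smul_tmul_smul, mul_smul,
        Algebra.TensorProduct.one_def, smul_mul_smul_comm]
      rw [Algebra.TensorProduct.tmul_mul_tmul, mul_one]
    | add s t hs ht =>
      rw [map_add, add_pow_char_pow_algebra (k := k), hs, ht, ← map_add,
        ← add_pow_char_pow_algebra (k := k), map_add, map_add]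
  have hcomul : ∀ x ∈ I, Algebra.TensorProduct.map π π (Bialgebra.comulAlgHom k R x) = 0 := by
    have : I ≤ RingHom.ker ((Algebra.TensorProduct.map π π).comp (Bialgebra.comulAlgHom k R)) := by
      refine Ideal.span_le.2 ?_
      rintro _ ⟨x, hx, rfl⟩
      change ((Algebra.TensorProduct.map π π).comp (Bialgebra.comulAlgHom k R)) (x ^ p ^ N) = 0
      rw [map_pow, AlgHom.comp_apply, htens]
      have : (Algebra.TensorProduct.lmul' k (S := k)
          (Algebra.TensorProduct.map (Bialgebra.counitAlgHom k R)
          (Bialgebra.counitAlgHom k R) (Bialgebra.comulAlgHom k R x))) =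
          Coalgebra.counit (R := k) x := by
        have e : ∀ t : R ⊗[k] R, Algebra.TensorProduct.map (Bialgebra.counitAlgHom k R)
          (Bialgebra.counitAlgHom k R) t =
          LinearMap.lTensor k (Coalgebra.counit (R := k) (A := R))
            (LinearMap.rTensor R (Coalgebra.counit (R := k) (A := R)) t) := by
          intro t
          induction t using TensorProduct.induction_on with
          | zero => simp
          | tmul a b => simp
          | add s t hs ht => simp only [map_add, hs, ht]
        rw [e]
        have := Coalgebra.rTensor_counit_comul (R := k) x
        rw [Bialgebra.comulAlgHom_apply, this]
        simp
      rw [this, hx, zero_pow hq, map_zero]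
    exact fun x hx => this hx
  have hco : (I.restrictScalars k).IsCoideal :=
    ⟨fun x hx => hcounit x hx, fun x hx => hcomul x hx⟩
  refine { toIsCoideal := hco, antipode_mem := ?_ }
  · intro x hx
    have : I ≤ Ideal.comap (HopfAlgebra.antipodeAlgHom k R) I := by
      refine Ideal.span_le.2 ?_
      rintro _ ⟨x, hx, rfl⟩
      change HopfAlgebra.antipodeAlgHom k R (x ^ p ^ N) ∈ I
      rw [map_pow]
      refine hmem _ ?_
      exact (HopfAlgebra.counit_antipode x).trans hx
    exact this hx

end Frobenius


/-! ### The additive groups -/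

/-- The coordinate ring `k[t₁, …, t_r]` of the additive group scheme `G_a^r` over `k`. -/
def AddHopf (r : ℕ) (k : Type u) [CommRing k] : Type u := MvPolynomial (Fin r) k

namespace AddHopf

variable (r : ℕ) (k : Type u) [CommRing k]

instance : CommRing (AddHopf r k) := inferInstanceAs (CommRing (MvPolynomial (Fin r) k))

instance : Algebra k (AddHopf r k) := inferInstanceAs (Algebra k (MvPolynomial (Fin r) k))

/-- The coordinates of `G_a^r`. -/
def t (i : Fin r) : AddHopf r k := (MvPolynomial.X i : MvPolynomial (Fin r) k)

variable {r k}

/-- The algebra map `k[t₁, …, t_r] → B` with prescribed values on the coordinates. -/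
def lift {B : Type*} [CommRing B] [Algebra k B] (b : Fin r → B) : AddHopf r k →ₐ[k] B :=
  (MvPolynomial.aeval b : MvPolynomial (Fin r) k →ₐ[k] B)

@[simp]
theorem lift_t {B : Type*} [CommRing B] [Algebra k B] (b : Fin r → B) (i : Fin r) :
    lift b (t r k i) = b i := MvPolynomial.aeval_X _ _

theorem hom_ext {B : Type*} [CommRing B] [Algebra k B] {f g : AddHopf r k →ₐ[k] B}
    (h : ∀ i, f (t r k i) = g (t r k i)) : f = g :=
  MvPolynomial.algHom_ext (A := B) (f := f) (g := g) h

variable (r k)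

/-- `t_i ↦ t_i ⊗ 1 + 1 ⊗ t_i`. -/
def comulHom : AddHopf r k →ₐ[k] AddHopf r k ⊗[k] AddHopf r k :=
  lift fun i => t r k i ⊗ₜ[k] 1 + 1 ⊗ₜ[k] t r k i

/-- `t_i ↦ 0`. -/
def counitHom : AddHopf r k →ₐ[k] k := lift fun _ => 0

/-- `t_i ↦ -t_i`. -/
def antipodeHom : AddHopf r k →ₐ[k] AddHopf r k := lift fun i => -t r k i

instance : Bialgebra k (AddHopf r k) := by
  refine Bialgebra.ofAlgHom (comulHom r k) (counitHom r k) ?_ ?_ ?_ <;>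
  · refine hom_ext fun i => ?_
    simp [comulHom, counitHom, Algebra.TensorProduct.one_def, TensorProduct.add_tmul,
      TensorProduct.tmul_add, add_assoc]

/-- `G_a^r` is a group scheme over `k`. -/
instance : HopfAlgebra k (AddHopf r k) := by
  have hc : ∀ i, Bialgebra.comulAlgHom k (AddHopf r k) (t r k i) =
      t r k i ⊗ₜ[k] 1 + 1 ⊗ₜ[k] t r k i := fun i => lift_t _ i
  have he : ∀ i, Bialgebra.counitAlgHom k (AddHopf r k) (t r k i) = 0 := fun i => lift_t _ i
  have hs : ∀ i, antipodeHom r k (t r k i) = -t r k i := fun i => lift_t _ i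
  refine HopfAlgebra.ofAlgHom (antipodeHom r k) ?_ ?_
  · refine hom_ext fun i => ?_
    rw [AlgHom.comp_apply, hc, map_add, AlgHom.comp_apply, he, map_zero]
    refine (congrArg₂ (· + ·) (Algebra.TensorProduct.lift_tmul _ _ _ _ _)
      (Algebra.TensorProduct.lift_tmul _ _ _ _ _)).trans ?_
    rw [hs, map_one, map_one, mul_one, one_mul]
    exact neg_add_cancel _
  · refine hom_ext fun i => ?_
    rw [AlgHom.comp_apply, hc, map_add, AlgHom.comp_apply, he, map_zero]
    refine (congrArg₂ (· + ·) (Algebra.TensorProduct.lift_tmul _ _ _ _ _)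
      (Algebra.TensorProduct.lift_tmul _ _ _ _ _)).trans ?_
    rw [hs, map_one, map_one, mul_one, one_mul]
    exact add_neg_cancel _

end AddHopf

section Objects

variable (p : ℕ) [Fact p.Prime] (k : Type u) [Field k] [CharP k p]

/-- The coordinate ring of `W_{n,m} = W_n[F^{m+1}]` over `k`. -/
abbrev TruncWittHopf (n m : ℕ) : Type u :=
  WittHopf p n k ⧸ frobKernelIdeal p k (WittHopf p n k) (m + 1)

/-- The coordinate `x_j` on `W_{n,m}`. -/
def TruncWittHopf.x (n m j : ℕ) : TruncWittHopf p k n m :=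
  Ideal.Quotient.mk _ (WittHopf.x p n k j)

/-- The coordinate ring of `α_p^r = (G_a^r)[F]` over `k`. -/
abbrev AlphaHopf (r : ℕ) : Type u :=
  AddHopf r k ⧸ frobKernelIdeal p k (AddHopf r k) 1

/-- The standard coordinate on `α_p`. -/
def alphaCoord : AlphaHopf p k 1 := Ideal.Quotient.mk _ (AddHopf.t 1 k 0)

end Objects

/-! ### The Verschiebung -/

section Verschiebung

variable (p : ℕ) [Fact p.Prime] (k : Type u) [Field k] [CharP k p] [PerfectRing k p]
variable {R : Type u} [CommRing R] [HopfAlgebra k R] [Coalgebra.IsCocomm k R]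

/-- For `x ∈ R`, the `k`-linear form `λ ↦ (λ^p)(x)^{1/p}` on the dual `R^D = Hom_k(R, k)`, where
`λ^p` is the `p`-th power in the algebra `R^D` (the coordinate ring of the Cartier dual). -/
def dualFrobeniusForm (x : R) : Module.Dual k (Module.Dual k R) where
  toFun l := (frobeniusEquiv k p).symm (((WithConv.toConv l) ^ p).ofConv x)
  map_add' l l' := by
    have h := add_pow_char_pow_algebra (p := p) (k := k) 1 (WithConv.toConv l)
      (WithConv.toConv l')
    rw [pow_one] at h
    rw [WithConv.toConv_add, h, WithConv.ofConv_add, LinearMap.add_apply, map_add]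
  map_smul' c l := by
    rw [WithConv.toConv_smul, smul_pow, WithConv.ofConv_smul, LinearMap.smul_apply, smul_eq_mul,
      map_mul]
    congr 1
    rw [RingEquiv.symm_apply_eq]
    rfl

variable [Module.Finite k R]

/-- The comorphism `V^* : R → R` of the Verschiebung `V_{G/k} : G^{(p)} → G` of a finite commutative
group scheme `G = Spec R`, where the coordinate ring of `G^{(p)}` is identified with `R` as a ring
(`k` is perfect). The Verschiebung is the Cartier dual of the Frobenius of the Cartier dual of
`G`, that is, `λ(V^* x)^p = (λ^p)(x)` for all `λ ∈ R^D`. -/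
def verschiebung (x : R) : R :=
  (Module.evalEquiv k R).symm (dualFrobeniusForm p k x)

theorem apply_verschiebung (l : R →ₗ[k] k) (x : R) :
    l (verschiebung p k x) ^ p = ((WithConv.toConv l) ^ p).ofConv x := by
  have h : l (verschiebung p k x) = dualFrobeniusForm p k x l := by
    unfold verschiebung
    exact Module.apply_evalEquiv_symm_apply k R l (dualFrobeniusForm p k x)
  rw [h]
  exact frobenius_apply_frobeniusEquiv_symm k p _

variable (R) in
/-- `V_{G/k}^N = 0`, for `G = Spec R`: the augmentation ideal is killed by `V^{N*}`. -/
def VerschiebungPowZero (N : ℕ) : Prop :=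
  ∀ x : R, Coalgebra.counit (R := k) x = 0 → (verschiebung p k)^[N] x = 0

/-! ### Dieudonné elements -/

/-- `x ∈ ker(0_G^*)` satisfies
`a_G^*(x) = φ_n(V^{n*}x ⊗ 1, 1 ⊗ V^{n*}x, …, x ⊗ 1, 1 ⊗ x)`. -/
def IsDieudonneElement (n : ℕ) (x : R) : Prop :=
  Coalgebra.counit (R := k) x = 0 ∧
    Coalgebra.comul (R := k) x =
      wittPhi p n (fun i => ((verschiebung p k)^[n - i] x) ⊗ₜ[k] (1 : R))
        (fun i => (1 : R) ⊗ₜ[k] ((verschiebung p k)^[n - i] x))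

variable (R) in
/-- The set `D(G) ⊆ R` of Dieudonné elements of `G = Spec R`: those `x` that satisfy the defining
equation for some `n` with `V_{G/k}^{n+1} = 0`. (The condition does not depend on the choice of
such an `n`; this is part of the theorem.) -/
def dieudonneElements : Set R :=
  {x | ∃ n, VerschiebungPowZero p k R (n + 1) ∧ IsDieudonneElement p k n x}

/-- `x ∔ y = φ_n(V^{n*}x, V^{n*}y, …, x, y)`. -/
def dotAdd (n : ℕ) (x y : R) : R :=
  wittPhi p n (fun i => (verschiebung p k)^[n - i] x) (fun i => (verschiebung p k)^[n - i] y)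

/-- The partial sums of
`c₀^{p^n} x ∔ c₁^{p^{n-1}} p^* x ∔ ⋯ ∔ c_n p^{n*} x`, where `p^* x = (V^* x)^p`. -/
def dotSMulAux (n : ℕ) (c : WittVector p k) (x : R) : ℕ → R
  | 0 => (c.coeff 0) ^ p ^ n • x
  | i + 1 => dotAdd p k n (dotSMulAux n c x i)
      ((c.coeff (i + 1)) ^ p ^ (n - (i + 1)) • ((verschiebung p k)^[i + 1] x) ^ p ^ (i + 1))

/-- `c ×̇ x = c₀^{p^n} x ∔ c₁^{p^{n-1}} p^* x ∔ ⋯ ∔ c_n p^{n*} x`; it depends only on the image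
`(c₀, …, c_n)` of `c` in `W_n(k)`. -/
def dotSMul (n : ℕ) (c : WittVector p k) (x : R) : R := dotSMulAux p k n c x n

end Verschiebung

/-! ### The Dieudonné ring -/

section DieudonneRing

variable (p : ℕ) [Fact p.Prime] (k : Type u) [Field k] [CharP k p] [PerfectRing k p]

/-- Generators of the Dieudonné ring: `F`, `V` and the elements of `W(k)`. -/
inductive DieudonneGen : Type u
  | F : DieudonneGen
  | V : DieudonneGen
  | w : WittVector p k → DieudonneGen

open FreeAlgebra in
/-- Relations of the Dieudonné ring: `W(k)` is mapped homomorphically, `FV = VF = p`,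
`F a = σ(a) F` and `V a = σ⁻¹(a) V`. -/
inductive DieudonneRel : FreeAlgebra ℤ (DieudonneGen p k) → FreeAlgebra ℤ (DieudonneGen p k) → Prop
  | add (a b : WittVector p k) :
      DieudonneRel (ι ℤ (.w (a + b))) (ι ℤ (.w a) + ι ℤ (.w b))
  | mul (a b : WittVector p k) :
      DieudonneRel (ι ℤ (.w (a * b))) (ι ℤ (.w a) * ι ℤ (.w b))
  | one : DieudonneRel (ι ℤ (.w 1)) 1
  | FV : DieudonneRel (ι ℤ .F * ι ℤ .V) (p : FreeAlgebra ℤ (DieudonneGen p k))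
  | VF : DieudonneRel (ι ℤ .V * ι ℤ .F) (p : FreeAlgebra ℤ (DieudonneGen p k))
  | Fw (a : WittVector p k) :
      DieudonneRel (ι ℤ .F * ι ℤ (.w a)) (ι ℤ (.w (WittVector.frobeniusEquiv p k a)) * ι ℤ .F)
  | Vw (a : WittVector p k) :
      DieudonneRel (ι ℤ .V * ι ℤ (.w a))
        (ι ℤ (.w ((WittVector.frobeniusEquiv p k).symm a)) * ι ℤ .V)

/-- The Dieudonné ring `A = W[F, V]/(FV - p, VF - p, Fa - σ(a)F, Va - σ⁻¹(a)V)`, `W = W(k)`. -/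
def DieudonneRing : Type u := RingQuot (DieudonneRel p k)

namespace DieudonneRing

instance : Ring (DieudonneRing p k) := inferInstanceAs (Ring (RingQuot (DieudonneRel p k)))

/-- The quotient map from the free ring. -/
def mk : FreeAlgebra ℤ (DieudonneGen p k) →+* DieudonneRing p k :=
  RingQuot.mkRingHom (DieudonneRel p k)

variable {p k} in
theorem mk_rel {a b : FreeAlgebra ℤ (DieudonneGen p k)} (h : DieudonneRel p k a b) :
    mk p k a = mk p k b := RingQuot.mkRingHom_rel h

/-- The element `F` of `A`. -/
def F : DieudonneRing p k := mk p k (FreeAlgebra.ι ℤ .F)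

/-- The element `V` of `A`. -/
def V : DieudonneRing p k := mk p k (FreeAlgebra.ι ℤ .V)

/-- The structure map `W(k) → A`. -/
def ofWitt : WittVector p k →+* DieudonneRing p k where
  toFun a := mk p k (FreeAlgebra.ι ℤ (.w a))
  map_one' := (mk_rel .one).trans (map_one _)
  map_mul' a b := (mk_rel (.mul a b)).trans (map_mul _ _ _)
  map_zero' := by
    have h := (mk_rel (.add (0 : WittVector p k) 0)).trans (map_add _ _ _)
    rw [add_zero] at h
    exact left_eq_add.1 h
  map_add' a b := (mk_rel (.add a b)).trans (map_add _ _ _)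

/-- The left `A`-module `A/A(F, V)`. -/
abbrev ModFV : Type u :=
  DieudonneRing p k ⧸ (Submodule.span (DieudonneRing p k) {F p k, V p k} :
    Submodule (DieudonneRing p k) (DieudonneRing p k))

end DieudonneRing

/-- The `A`-module `M` has finite length as a `W(k)`-module. -/
def IsFiniteLengthOverWitt (M : Type u) [AddCommGroup M] [Module (DieudonneRing p k) M] : Prop :=
  letI : Module (WittVector p k) M := Module.compHom M (DieudonneRing.ofWitt p k)
  IsFiniteLength (WittVector p k) M

/-- The `A`-module `M`, identified with the set `D(G)` through `e`, has the following operations,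
computed at level `n` (where `V_{G/k}^{n+1} = 0`): the sum is `∔`, the zero element is `0`, the
negative is given by the inverse of `G` (so it is `-x` when `p` is odd), `F x = x^p`, `V x = V^* x`,
and `σ^j(c)` acts as `c ×̇ x`, for every `c ∈ W(k)`. For `j = 0` this is the action of `W(k)` through
`W_n(k)` by `×̇`; for `j = n` it is the normalisation of that action that does not depend
on `n`. -/
structure IsDieudonneModule (R : Type u) [CommRing R] [HopfAlgebra k R] [Coalgebra.IsCocomm k R]
    [Module.Finite k R] (j n : ℕ) {M : Type u} [AddCommGroup M] [Module (DieudonneRing p k) M]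
    (e : M ≃ dieudonneElements p k R) : Prop where
  add (x y : M) : (e (x + y) : R) = dotAdd p k n (e x : R) (e y : R)
  zero : (e 0 : R) = 0
  neg (x : M) : (e (-x) : R) = HopfAlgebra.antipode k (e x : R)
  neg_of_odd (hp : p ≠ 2) (x : M) : (e (-x) : R) = -(e x : R)
  smul (c : WittVector p k) (x : M) :
    (e (DieudonneRing.ofWitt p k ((WittVector.frobeniusEquiv p k)^[j] c) • x) : R) =
      dotSMul p k n c (e x : R)
  F_smul (x : M) : (e (DieudonneRing.F p k • x) : R) = (e x : R) ^ p
  V_smul (x : M) : (e (DieudonneRing.V p k • x) : R) = verschiebung p k (e x : R)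

end DieudonneRing

/-! ### The α-module, α-groups and the a-number -/

section Alpha

variable (p : ℕ) [Fact p.Prime] (k : Type u) [Field k] [CharP k p]
variable (R : Type u) [CommRing R] [HopfAlgebra k R]

/-- `α(G) = {x ∈ R | a^*(x) = x ⊗ 1 + 1 ⊗ x}`. -/
def alphaModule : Set R := {x | Coalgebra.comul (R := k) x = x ⊗ₜ[k] 1 + 1 ⊗ₜ[k] x}

/-- `G = Spec R` is an α-group: it is isomorphic to some `α_p^r`. -/
def IsAlphaGroup : Prop := ∃ r, Nonempty (R ≃ₐc[k] AlphaHopf p k r)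

/-- The `k`-vector space `Hom_k(α_p, G)`: a homomorphism `f : α_p → G` is identified with the linear
coefficient `δ` of `f^* : R → k[t]/(t^p)`, `f^*(x) = ε(x) + δ(x) t + O(t²)`, which determines it;
addition of homomorphisms is addition of the `δ`, and the scalars act on `δ` as they do on
`α_p`. These `δ` form a subspace, so that taking the span adds nothing. -/
def alphaHom : Submodule k (R →ₗ[k] k) :=
  Submodule.span k {δ | ∃ f : R →ₐc[k] AlphaHopf p k 1, ∀ x : R,
    f x - (algebraMap k _ (Coalgebra.counit (R := k) x) + δ x • alphaCoord p k) ∈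
      Ideal.span {alphaCoord p k ^ 2}}

/-- The a-number `a(G) = dim_k Hom_k(α_p, G)`. -/
def aNumber : ℕ := Module.finrank k (alphaHom p k R)

end Alpha

/-! ### The category of finite commutative infinitesimal group schemes with infinitesimal dual -/

/-- A finite commutative group scheme `G = Spec R` over `k` such that `G` and its Cartier dual are
infinitesimal: `R` and the dual algebra `R^D = Hom_k(R, k)` are local rings. -/
structure AbInfInf (k : Type u) [Field k] where
  /-- The coordinate ring. -/
  R : Type u
  [commRing : CommRing R]
  [hopfAlgebra : HopfAlgebra k R]
  [isCocomm : Coalgebra.IsCocomm k R]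
  [finite : Module.Finite k R]
  [isLocalRing : IsLocalRing R]
  [isLocalRing_dual : IsLocalRing (WithConv (R →ₗ[k] k))]

namespace AbInfInf

attribute [instance] commRing hopfAlgebra isCocomm finite isLocalRing isLocalRing_dual

variable {k : Type u} [Field k]

/-- A morphism `G → G'` of group schemes is a homomorphism `R' → R` of Hopf algebras. -/
instance : Category (AbInfInf k) where
  Hom G G' := G'.R →ₐc[k] G.R
  id G := BialgHom.id k G.R
  comp f g := BialgHom.comp f g

/-- The comorphism `f^* : R' → R` of `f : G → G'`. -/
def pullback {G G' : AbInfInf k} (f : G ⟶ G') : G'.R →ₐc[k] G.R := f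

/-- `i : H → G` is the kernel of `f : G → G'`: it is the closed subgroup scheme
`G ×_{G'} Spec k` of `G`, whose ideal is generated by the image of the augmentation ideal
of `G'`. -/
def IsKernel {H G G' : AbInfInf k} (i : H ⟶ G) (f : G ⟶ G') : Prop :=
  Function.Surjective (pullback i) ∧
    RingHom.ker (pullback i : G.R →ₐ[k] H.R) =
      Ideal.map (pullback f : G'.R →ₐ[k] G.R) (RingHom.ker (Bialgebra.counitAlgHom k G'.R))

end AbInfInf

end Dieudonne

end

/-!
Dieudonné elements are turned into Witt vectors. Let `G = Spec R` with `V^{n+1} = 0`. An element `x`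
of the augmentation ideal determines the Witt vector `(V^{n*}x, …, V^*x, x, …)` over `R`, cut off
after the entry `n`, and the defining equation of `D(G)` says that this Witt vector is primitive in
length `n + 1`: its image under `a^*` is the sum of its images under the two inclusions
`R → R ⊗ R`. Such Witt vectors form a subgroup of `W(R)`, and they are the homomorphisms `G → W_n`.
Conversely every homomorphism `f : G → W_n` has this form, because `f^*` commutes with the
Verschiebung (`WittHopf.map_x_eq_iterate_verschiebung`); the Verschiebung of `W_n` shifts the
coordinates, as follows from `p = FV` on Witt vectors over the reduced ring `k[x_0, …, x_n]`
(`WittHopf.verschiebung_map_x`). The group law `∔`, the operators `F` and `V` and the action of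
`W(k)` on `D(G)` are the operations of `W(R)` on these Witt vectors, so that the relations of the
Dieudonné ring are identities of Witt vectors (`LevelModule.isDieudonneModule`). Finite length holds
because `D(G)` embeds into the Witt vectors of length `n + 1` over the finite-dimensional algebra
`R` (`LevelModule.isFiniteLength`). Replacing `n` by `n + d` shifts the Witt vector, and
`V^d(x) · c = V^d(x · F^d c)` gives the normalisation that makes the action of `W(k)` independent
of `n` (`dotSMul_level`).

For the exact sequence, the Verschiebung of `G` is nilpotent exactly if the dual algebra is local
(`exists_verschiebungPowZero`, `isLocalRing_dual_of_verschiebungPowZero`). The comorphism of an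
epimorphism `f : G → G'` is injective: homomorphisms to `α_p` show that it is injective on primitive
elements, these are dual to the cotangent space of the local algebra dual to `R'`, and a subalgebra
that surjects onto the cotangent space of a finite-dimensional local algebra is everything
(`injective_of_injective_on_alphaModule`). If `x ∈ D(G)` restricts to zero on the kernel `H` of `f`,
then `x` is invariant under translation by `H`, hence comes from `R'` by a Nakayama argument
(`mem_range_of_coaction_eq`), and it comes from `D(G')` as `f^*` is injective.

If `G` is an α-group, then `V = 0`, `F = 0` on `D(G)`, and `D(G)` consists of the primitive
elements. The invariant derivations `∂/∂t_i` show that the primitive elements of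
`k[t_1, …, t_r]/(t_i^p)` are the linear forms; dually `Hom(α_p, G)` has dimension `r` (`aNumber_eq`).
The module `A/A(F, V)` is `W(k)/p = k`, which gives the isomorphism
(`nonempty_linearEquiv_of_isAlphaGroup`).
-/

noncomputable section

namespace Dieudonne

/-! ### Convolution powers and the Verschiebung -/

section VerschiebungBasics

open Coalgebra

/-- Convolution powers commute with precomposition by a coalgebra homomorphism. -/
theorem convPow_comp_coalgHom {k C C' A : Type*} [CommRing k] [AddCommGroup C] [Module k C]
    [Coalgebra k C] [AddCommGroup C'] [Module k C'] [Coalgebra k C'] [CommRing A] [Algebra k A]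
    (g : C →ₗc[k] C') (l : C' →ₗ[k] A) (r : ℕ) :
    (WithConv.toConv (l ∘ₗ g.toLinearMap)) ^ r =
      WithConv.toConv (((WithConv.toConv l) ^ r).ofConv ∘ₗ g.toLinearMap) := by
  induction r with
  | zero =>
    ext x
    simp
  | succ r ih =>
    rw [pow_succ, ih, pow_succ, LinearMap.convMul_comp_coalgHom_distrib]

/-- Convolution powers commute with postcomposition by an algebra homomorphism. -/
theorem algHom_comp_convPow {k C A B : Type*} [CommRing k] [AddCommGroup C] [Module k C]
    [Coalgebra k C] [CommRing A] [Algebra k A] [CommRing B] [Algebra k B]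
    (h : A →ₐ[k] B) (l : C →ₗ[k] A) (r : ℕ) :
    (WithConv.toConv (h.toLinearMap ∘ₗ l)) ^ r =
      WithConv.toConv (h.toLinearMap ∘ₗ ((WithConv.toConv l) ^ r).ofConv) := by
  induction r with
  | zero =>
    ext x
    simp
  | succ r ih =>
    rw [pow_succ, ih, pow_succ, LinearMap.algHom_comp_convMul_distrib]

theorem one_convPow {k R : Type*} [CommRing k] [CommRing R] [Bialgebra k R] (l : R →ₗ[k] k)
    (r : ℕ) : ((WithConv.toConv l) ^ r).ofConv 1 = l 1 ^ r := by
  induction r with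
  | zero => simp [LinearMap.convOne_def]
  | succ r ih =>
    rw [pow_succ, pow_succ, ← ih]
    change LinearMap.mul' k k (TensorProduct.map _ _ (comul (R := k) (1 : R))) = _
    rw [Bialgebra.comul_one, Algebra.TensorProduct.one_def]
    simp

theorem convPow_map {k R R' : Type*} [CommRing k] [CommRing R] [Bialgebra k R]
    [CommRing R'] [Bialgebra k R'] (l : R →ₗ[k] k) (m : R' →ₗ[k] k) (r : ℕ) :
    (WithConv.toConv (TensorProduct.map l m)) ^ r =
    WithConv.toConv (TensorProduct.map (((WithConv.toConv l) ^ r).ofConv)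
      (((WithConv.toConv m) ^ r).ofConv)) := by
  induction r with
  | zero =>
    ext x y
    change algebraMap k (k ⊗[k] k) (counit (R := k) (x ⊗ₜ[k] y)) =
      (counit (R := k) x) ⊗ₜ[k] (counit (R := k) y)
    have h : ∀ a b : k, algebraMap k (k ⊗[k] k) (a * b) = a ⊗ₜ[k] b := fun a b => by
      rw [map_mul, Algebra.TensorProduct.algebraMap_apply, Algebra.TensorProduct.algebraMap_apply',
        Algebra.TensorProduct.tmul_mul_tmul, one_mul, mul_one]
      rfl
    rw [TensorProduct.counit_tmul, smul_eq_mul, mul_comm, h]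
  | succ r ih =>
    rw [pow_succ, ih]
    exact TensorProduct.map_convMul_map.trans (by rw [pow_succ, pow_succ])

variable {p : ℕ} [Fact p.Prime] {k : Type u} [Field k] [CharP k p] [PerfectRing k p]
variable {R : Type u} [CommRing R] [HopfAlgebra k R] [Coalgebra.IsCocomm k R] [Module.Finite k R]
variable {R' : Type u} [CommRing R'] [HopfAlgebra k R'] [Coalgebra.IsCocomm k R']
  [Module.Finite k R']

theorem verschiebung_unique {x y : R}
    (h : ∀ l : R →ₗ[k] k, l y ^ p = ((WithConv.toConv l) ^ p).ofConv x) :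
    verschiebung p k x = y := by
  rw [← sub_eq_zero]
  refine (Module.forall_dual_apply_eq_zero_iff k _).1 fun l => ?_
  rw [map_sub, sub_eq_zero]
  apply frobenius_inj k p
  rw [frobenius_def, frobenius_def, apply_verschiebung, h]

theorem verschiebung_add (x y : R) :
    verschiebung p k (x + y) = verschiebung p k x + verschiebung p k y := by
  refine verschiebung_unique fun l => ?_
  have h := add_pow_char_pow_algebra (p := p) (k := k) 1 (l (verschiebung p k x))
    (l (verschiebung p k y))
  rw [pow_one] at h
  rw [map_add, h, apply_verschiebung, apply_verschiebung, map_add]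

theorem verschiebung_smul (c : k) (x : R) :
    verschiebung p k (c ^ p • x) = c • verschiebung p k x := by
  refine verschiebung_unique fun l => ?_
  rw [map_smul, smul_eq_mul, mul_pow, apply_verschiebung, map_smul, smul_eq_mul]

/-- The Verschiebung commutes with coalgebra homomorphisms. -/
theorem map_verschiebung (g : R →ₗc[k] R') (x : R) :
    g (verschiebung p k x) = verschiebung p k (g x) := by
  refine (verschiebung_unique fun l => ?_).symm
  have h := apply_verschiebung p k (l ∘ₗ g.toLinearMap) x
  rw [convPow_comp_coalgHom] at h
  exact h

/-- The Verschiebung of a product of group schemes is the product of the Verschiebungen. -/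
theorem verschiebung_tmul (x : R) (y : R') :
    verschiebung p k (x ⊗ₜ[k] y) = verschiebung p k x ⊗ₜ[k] verschiebung p k y := by
  refine verschiebung_unique fun L => ?_
  obtain ⟨t, rfl⟩ := (TensorProduct.dualDistribEquiv k R R').surjective L
  change TensorProduct.dualDistrib k R R' t _ ^ p =
    ((WithConv.toConv (TensorProduct.dualDistrib k R R' t)) ^ p).ofConv _
  induction t using TensorProduct.induction_on with
  | zero =>
    rw [map_zero, WithConv.toConv_zero, zero_pow (Fact.out : p.Prime).ne_zero]
    exact zero_pow (Fact.out : p.Prime).ne_zero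
  | tmul l m =>
    have e : TensorProduct.dualDistrib k R R' (l ⊗ₜ m) =
        (Algebra.TensorProduct.lmul' k (S := k)).toLinearMap ∘ₗ TensorProduct.map l m := by
      ext; simp
    rw [e, algHom_comp_convPow, convPow_map]
    simp [mul_pow, apply_verschiebung]
  | add s t hs ht =>
    have h := add_pow_char_pow_algebra (p := p) (k := k) 1
      (TensorProduct.dualDistrib k R R' s (verschiebung p k x ⊗ₜ[k] verschiebung p k y))
      (TensorProduct.dualDistrib k R R' t (verschiebung p k x ⊗ₜ[k] verschiebung p k y))
    have h' := add_pow_char_pow_algebra (p := p) (k := k) 1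
      (WithConv.toConv (TensorProduct.dualDistrib k R R' s))
      (WithConv.toConv (TensorProduct.dualDistrib k R R' t))
    rw [pow_one] at h h'
    rw [map_add, WithConv.toConv_add, h', LinearMap.add_apply, h, hs, ht]
    rfl

theorem verschiebung_mul (x y : R) :
    verschiebung p k (x * y) = verschiebung p k x * verschiebung p k y := by
  have h := map_verschiebung (p := p) (Bialgebra.mulCoalgHom k R) (x ⊗ₜ[k] y)
  rw [verschiebung_tmul] at h
  simpa using h.symm

theorem verschiebung_one : verschiebung p k (1 : R) = 1 :=
  verschiebung_unique (k := k) fun l => (one_convPow l p).symm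

variable (p k R) in
/-- The comorphism of the Verschiebung as a ring endomorphism. -/
def verschiebungHom : R →+* R where
  toFun := verschiebung p k
  map_one' := verschiebung_one
  map_mul' := verschiebung_mul
  map_zero' := by
    have h := verschiebung_add (p := p) (k := k) (0 : R) 0
    rw [add_zero] at h
    exact left_eq_add.1 h
  map_add' := verschiebung_add

@[simp]
theorem verschiebungHom_apply (x : R) : verschiebungHom p k R x = verschiebung p k x := rfl

@[simp]
theorem verschiebung_zero : verschiebung p k (0 : R) = 0 := map_zero (verschiebungHom p k R)

theorem verschiebung_pow (x : R) (r : ℕ) :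
    verschiebung p k (x ^ r) = verschiebung p k x ^ r := map_pow (verschiebungHom p k R) x r

theorem iterate_verschiebung_zero (j : ℕ) : (verschiebung p k)^[j] (0 : R) = 0 :=
  Function.iterate_fixed verschiebung_zero j

theorem iterate_verschiebung_pow (j : ℕ) (x : R) (r : ℕ) :
    (verschiebung p k)^[j] (x ^ r) = ((verschiebung p k)^[j] x) ^ r := by
  induction j generalizing x with
  | zero => rfl
  | succ j ih => rw [Function.iterate_succ_apply, verschiebung_pow, ih]; rfl

theorem iterate_verschiebung_smul (j : ℕ) (c : k) (x : R) :
    (verschiebung p k)^[j] (c ^ p ^ j • x) = c • (verschiebung p k)^[j] x := by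
  induction j generalizing x with
  | zero => simp
  | succ j ih =>
    rw [Function.iterate_succ_apply, pow_succ, pow_mul, verschiebung_smul, ih]; rfl

theorem iterate_verschiebung_eq_zero_of_le {i j : ℕ} (hij : i ≤ j) {x : R}
    (hx : (verschiebung p k)^[i] x = 0) : (verschiebung p k)^[j] x = 0 := by
  obtain ⟨d, rfl⟩ := Nat.exists_eq_add_of_le' hij
  rw [Function.iterate_add_apply, hx, iterate_verschiebung_zero]

theorem counit_verschiebung (x : R) :
    counit (R := k) (verschiebung p k x) ^ p = counit (R := k) x := by
  have h := apply_verschiebung p k (counit (R := k) (A := R)) x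
  have h1 : WithConv.toConv (counit (R := k) (A := R)) = 1 := rfl
  rw [h1, one_pow] at h
  exact h

theorem counit_verschiebung_eq_zero {x : R} (hx : counit (R := k) x = 0) :
    counit (R := k) (verschiebung p k x) = 0 := by
  have h := counit_verschiebung (p := p) (k := k) x
  rw [hx] at h
  exact eq_zero_of_pow_eq_zero h

theorem counit_iterate_verschiebung_eq_zero {x : R} (hx : counit (R := k) x = 0) (j : ℕ) :
    counit (R := k) ((verschiebung p k)^[j] x) = 0 := by
  induction j with
  | zero => exact hx
  | succ j ih => rw [Function.iterate_succ_apply']; exact counit_verschiebung_eq_zero ih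

theorem comul_verschiebung (x : R) :
    comul (R := k) (verschiebung p k x) = verschiebungHom p k (R ⊗[k] R) (comul (R := k) x) :=
  map_verschiebung (comulCoalgHom k R) x

theorem map_iterate_verschiebung (g : R →ₗc[k] R') (j : ℕ) (x : R) :
    g ((verschiebung p k)^[j] x) = (verschiebung p k)^[j] (g x) := by
  induction j generalizing x with
  | zero => rfl
  | succ j ih => rw [Function.iterate_succ_apply, ih, map_verschiebung]; rfl

/-- `λ(V^{N*} x)^{p^N} = (λ^{p^N})(x)`. -/
theorem apply_iterate_verschiebung (l : R →ₗ[k] k) (N : ℕ) (x : R) :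
    l ((verschiebung p k)^[N] x) ^ p ^ N = ((WithConv.toConv l) ^ p ^ N).ofConv x := by
  induction N generalizing x with
  | zero => simp
  | succ N ih =>
    rw [Function.iterate_succ_apply, pow_succ, pow_mul, ih, pow_mul]
    exact apply_verschiebung p k ((WithConv.toConv l) ^ p ^ N).ofConv x

end VerschiebungBasics

/-! ### The Verschiebung on the Witt schemes -/

section FrobeniusTwist

open Coalgebra

theorem sum_pow_char_algebra {p : ℕ} [Fact p.Prime] {k : Type u} [Field k] [CharP k p]
    {B ι : Type*} [CommRing B] [Algebra k B] (s : Finset ι) (f : ι → B) :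
    (∑ i ∈ s, f i) ^ p = ∑ i ∈ s, f i ^ p := by
  classical
  induction s using Finset.induction_on with
  | empty => simp [(Fact.out : p.Prime).ne_zero]
  | insert i s hi ih =>
    have h := add_pow_char_pow_algebra (p := p) (k := k) 1 (f i) (∑ i ∈ s, f i)
    rw [pow_one] at h
    rw [Finset.sum_insert hi, Finset.sum_insert hi, h, ih]

/-- A value of a convolution power of a linear form depends on finitely many values of the form
only. -/
theorem exists_finite_convPow_congr {k C A : Type*} [CommRing k] [AddCommGroup C] [Module k C]
    [Coalgebra k C] [CommRing A] [Algebra k A] (r : ℕ) (x : C) :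
    ∃ U : Set C, U.Finite ∧ ∀ l l' : C →ₗ[k] A, (∀ u ∈ U, l u = l' u) →
      ((WithConv.toConv l) ^ r).ofConv x = ((WithConv.toConv l') ^ r).ofConv x := by
  induction r generalizing x with
  | zero => exact ⟨∅, Set.finite_empty, fun _ _ _ => rfl⟩
  | succ r ih =>
    choose U hU hU' using ih
    let 𝓡 := Coalgebra.Repr.arbitrary k x
    refine ⟨⋃ i ∈ 𝓡.index, (U (𝓡.left i) ∪ {𝓡.right i}),
      𝓡.index.finite_toSet.biUnion fun i _ => (hU _).union (Set.finite_singleton _),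
      fun l l' h => ?_⟩
    rw [pow_succ, pow_succ]
    refine (𝓡.convMul_apply _ _).trans ((Finset.sum_congr rfl fun i hi => ?_).trans
      (𝓡.convMul_apply _ _).symm)
    have hi' : ∀ u ∈ U (𝓡.left i) ∪ {𝓡.right i}, l u = l' u := fun u hu =>
      h u (Set.mem_biUnion hi hu)
    exact congrArg₂ (· * ·) (hU' _ l l' fun u hu => hi' u (Or.inl hu)) (hi' _ (Or.inr rfl))

variable {p : ℕ} [Fact p.Prime] {k : Type u} [Field k] [CharP k p] [PerfectRing k p]

theorem convPow_apply_of_congr {C B ι : Type*} [AddCommGroup C] [Module k C] [Coalgebra k C]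
    [IsCocomm k C] [CommRing B] [Algebra k B] (b : Module.Basis ι k C) (x : C) (T : Finset ι)
    (h : ∀ l l' : C →ₗ[k] B, (∀ m ∈ T, l (b m) = l' (b m)) →
      ((WithConv.toConv l) ^ p).ofConv x = ((WithConv.toConv l') ^ p).ofConv x)
    (l : C →ₗ[k] B) :
    ((WithConv.toConv l) ^ p).ofConv x = l (∑ m ∈ T, (frobeniusEquiv k p).symm
      (((WithConv.toConv (b.coord m)) ^ p).ofConv x) • b m) ^ p := by
  classical
  rw [h l (∑ m ∈ T, l (b m) • ((Algebra.linearMap k B) ∘ₗ b.coord m))]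
  · rw [map_sum, sum_pow_char_algebra (k := k)]
    have e : WithConv.toConv (∑ m ∈ T, l (b m) • ((Algebra.linearMap k B) ∘ₗ b.coord m)) =
        ∑ m ∈ T, l (b m) • WithConv.toConv ((Algebra.linearMap k B) ∘ₗ b.coord m) := by
      ext; simp
    rw [e, sum_pow_char_algebra (k := k)]
    have e2 : ∀ (g : _ → WithConv (C →ₗ[k] B)), (∑ m ∈ T, g m).ofConv x =
        ∑ m ∈ T, (g m).ofConv x := by
      intro g; simp
    rw [e2]
    refine Finset.sum_congr rfl fun m _ => ?_
    rw [smul_pow]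
    have e3 := algHom_comp_convPow (Algebra.ofId k B) (b.coord m) p
    change (WithConv.toConv ((Algebra.linearMap k B) ∘ₗ b.coord m)) ^ p = _ at e3
    rw [e3, map_smul, smul_pow]
    have e4 := frobenius_apply_frobeniusEquiv_symm k p
      (((WithConv.toConv (b.coord m)) ^ p).ofConv x)
    rw [frobenius_def] at e4
    rw [e4]
    refine Eq.trans ?_ (Algebra.smul_def _ _).symm
    rw [mul_comm]
    rfl
  · intro m hm
    rw [LinearMap.sum_apply, Finset.sum_eq_single m]
    · simp
    · intro m' _ hm'
      simp [hm'.symm]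
    · exact fun hm' => absurd hm hm'

/-- The value of the Verschiebung at an element of a cocommutative coalgebra that need not be
finite-dimensional: it computes the `p`-th powers, for convolution, of linear maps to `A` and
to `k`. -/
theorem exists_verschiebung {C A : Type*} [AddCommGroup C] [Module k C] [Coalgebra k C]
    [IsCocomm k C] [CommRing A] [Algebra k A] (x : C) :
    ∃ y : C, (∀ l : C →ₗ[k] k, ((WithConv.toConv l) ^ p).ofConv x = l y ^ p) ∧
      (∀ l : C →ₗ[k] A, ((WithConv.toConv l) ^ p).ofConv x = l y ^ p) := by
  classical
  obtain ⟨U₁, hU₁, h₁⟩ := exists_finite_convPow_congr (k := k) (A := k) p x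
  obtain ⟨U₂, hU₂, h₂⟩ := exists_finite_convPow_congr (k := k) (A := A) p x
  let b := Module.Basis.ofVectorSpace k C
  let T : Finset _ := (hU₁.union hU₂).toFinset.biUnion fun u => (b.repr u).support
  have hT : ∀ u ∈ U₁ ∪ U₂, u ∈ Submodule.span k (b '' T) := by
    intro u hu
    have hu' : (b.repr u).support ⊆ T := Finset.subset_biUnion_of_mem
      (fun u => (b.repr u).support) (by simpa using hu)
    exact Submodule.span_mono (Set.image_mono (Finset.coe_subset.2 hu'))
      (b.mem_span_repr_support u)
  refine ⟨_, convPow_apply_of_congr b x T fun l l' h => h₁ l l' fun u hu => ?_,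
    convPow_apply_of_congr b x T fun l l' h => h₂ l l' fun u hu => ?_⟩
  · refine LinearMap.eqOn_span (f := l) (g := l') ?_ (hT u (Or.inl hu))
    rintro _ ⟨m, hm, rfl⟩
    exact h m hm
  · refine LinearMap.eqOn_span (f := l) (g := l') ?_ (hT u (Or.inr hu))
    rintro _ ⟨m, hm, rfl⟩
    exact h m hm

end FrobeniusTwist

section WittHom

namespace WittHopf

variable {p n : ℕ} [Fact p.Prime] {k : Type u}

theorem counit_x [CommRing k] {i : ℕ} (hi : i ≤ n) :
    Coalgebra.counit (R := k) (x p n k i) = 0 := counitHom_x hi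

theorem comul_x [CommRing k] {i : ℕ} (hi : i ≤ n) : Coalgebra.comul (R := k) (x p n k i) =
    wittPhi p i (fun j => x p n k j ⊗ₜ[k] 1) (fun j => 1 ⊗ₜ[k] x p n k j) := comulHom_x hi

instance [CommRing k] : Coalgebra.IsCocomm k (WittHopf p n k) where
  comm_comp_comul := by
    have h : (Algebra.TensorProduct.comm k (WittHopf p n k) (WittHopf p n k)).toAlgHom.comp
        (Bialgebra.comulAlgHom k (WittHopf p n k)) = Bialgebra.comulAlgHom k (WittHopf p n k) := by
      refine hom_ext fun i hi => ?_
      rw [AlgHom.comp_apply]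
      change (Algebra.TensorProduct.comm k (WittHopf p n k) (WittHopf p n k)).toAlgHom
        (comulHom p n k (x p n k i)) = comulHom p n k (x p n k i)
      rw [comulHom_x hi, map_wittPhi, wittPhi_eq_coeff, wittPhi_eq_coeff, add_comm]
      rfl
    exact congrArg AlgHom.toLinearMap h

theorem convMul_x [CommRing k] {B : Type*} [CommRing B] [Algebra k B]
    (f g : WithConv (WittHopf p n k →ₐ[k] B)) {i : ℕ} (hi : i ≤ n) :
    (f * g) (x p n k i) =
      wittPhi p i (fun j => f (x p n k j)) (fun j => g (x p n k j)) := by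
  rw [AlgHom.convMul_apply, comul_x hi, map_wittPhi]
  congr 1 <;> funext j <;> simp

theorem id_convPow_x [CommRing k] (r : ℕ) {i : ℕ} (hi : i ≤ n) :
    ((WithConv.toConv (LinearMap.id : WittHopf p n k →ₗ[k] WittHopf p n k)) ^ r).ofConv
      (x p n k i) = (r • WittVector.mk p (x p n k)).coeff i := by
  have h : ∀ r : ℕ, ∀ i ≤ n, ((WithConv.toConv (AlgHom.id k (WittHopf p n k))) ^ r) (x p n k i) =
      (r • WittVector.mk p (x p n k)).coeff i := by
    intro r
    induction r with
    | zero =>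
      intro i hi
      rw [pow_zero, AlgHom.convOne_apply, counit_x hi]
      simp
    | succ r ih =>
      intro i hi
      rw [pow_succ, convMul_x _ _ hi, succ_nsmul, WittVector.add_coeff]
      exact wittPhi_congr (fun j hj => ih j (hj.trans hi)) fun j hj => rfl
  rw [← h r i hi]
  exact (congrArg (fun g => g.ofConv (x p n k i)) (AlgHom.toLinearMap_convPow
    (WithConv.toConv (AlgHom.id k (WittHopf p n k))) r)).symm

variable [Field k]

instance : IsDomain (WittHopf p n k) := inferInstanceAs (IsDomain (MvPolynomial (Fin (n + 1)) k))

instance [CharP k p] : CharP (WittHopf p n k) p :=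
  inferInstanceAs (CharP (MvPolynomial (Fin (n + 1)) k) p)

variable [CharP k p] [PerfectRing k p]

/-- The Verschiebung of `W_n` is the shift of the coordinates: `λ^p(x_i) = λ(x_{i-1})^p`. The proof
determines the Verschiebung of `x_i` from the multiplication by `p` on `W_n`, the `p`-th power of
the identity for convolution; this suffices because the coordinate ring of `W_n` is reduced. -/
theorem convPow_x (l : WittHopf p n k →ₗ[k] k) {i : ℕ} (hi : i ≤ n) :
    ((WithConv.toConv l) ^ p).ofConv (x p n k i) =
      l ((WittVector.verschiebung (WittVector.mk p (x p n k))).coeff i) ^ p := by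
  obtain ⟨y, hy, hy'⟩ := exists_verschiebung (p := p) (k := k) (A := WittHopf p n k) (x p n k i)
  have h := hy' LinearMap.id
  rw [id_convPow_x p hi, nsmul_eq_mul, mul_comm, ← WittVector.verschiebung_frobenius,
    WittVector.verschiebung_frobenius_comm, WittVector.coeff_frobenius_charP] at h
  rw [hy, frobenius_inj (WittHopf p n k) p h]
  rfl

theorem verschiebung_map_x {R : Type u} [CommRing R] [HopfAlgebra k R] [Coalgebra.IsCocomm k R]
    [Module.Finite k R] (f : WittHopf p n k →ₐc[k] R) {i : ℕ} (hi : i ≤ n) :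
    verschiebung p k (f (x p n k i)) =
      (WittVector.verschiebung (WittVector.mk p fun j => f (x p n k j))).coeff i := by
  refine verschiebung_unique fun l => ?_
  have h := convPow_x (l ∘ₗ (f : WittHopf p n k →ₗc[k] R).toLinearMap) hi
  rw [convPow_comp_coalgHom] at h
  refine Eq.trans ?_ h.symm
  rcases i with _ | i
  · simp
  · simp [WittVector.verschiebung_coeff_succ]

theorem map_x_eq_iterate_verschiebung {R : Type u} [CommRing R] [HopfAlgebra k R]
    [Coalgebra.IsCocomm k R] [Module.Finite k R] (f : WittHopf p n k →ₐc[k] R) {i : ℕ}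
    (hi : i ≤ n) : f (x p n k i) = (verschiebung p k)^[n - i] (f (x p n k n)) := by
  induction hi using Nat.decreasingInduction with
  | self => simp
  | of_succ i hi ih =>
    have h := verschiebung_map_x f (i := i + 1) hi
    rw [WittVector.verschiebung_coeff_succ] at h
    have e : n - i = (n - (i + 1)) + 1 := by omega
    rw [e, Function.iterate_succ_apply', ← ih, h]
    rfl

end WittHopf

end WittHom

/-! ### Dieudonné elements and primitive Witt vectors -/

section Shift

variable {p : ℕ} [Fact p.Prime] {B : Type*} [CommRing B]

theorem mk_eq_iterate_verschiebung (d : ℕ) {u : ℕ → B} (hu : ∀ a < d, u a = 0) :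
    WittVector.mk p u = WittVector.verschiebung^[d] (WittVector.mk p fun a => u (a + d)) := by
  ext a
  rcases lt_or_ge a d with h | h
  · rw [WittVector.iterate_verschiebung_coeff_eq_zero _ h]
    exact hu a h
  · obtain ⟨b, rfl⟩ := Nat.exists_eq_add_of_le' h
    rw [WittVector.iterate_verschiebung_coeff]
    rfl

theorem iterate_wittVerschiebung_add (d : ℕ) (u v : WittVector p B) :
    WittVector.verschiebung^[d] (u + v) =
      WittVector.verschiebung^[d] u + WittVector.verschiebung^[d] v := by
  induction d generalizing u v with
  | zero => rfl
  | succ d ih => rw [Function.iterate_succ_apply, map_add, ih]; rfl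

theorem wittPhi_shift (i d : ℕ) {u v : ℕ → B} (hu : ∀ a < d, u a = 0) (hv : ∀ a < d, v a = 0) :
    wittPhi p (i + d) u v = wittPhi p i (fun a => u (a + d)) (fun a => v (a + d)) := by
  rw [wittPhi_eq_coeff, wittPhi_eq_coeff, mk_eq_iterate_verschiebung d hu,
    mk_eq_iterate_verschiebung d hv, ← iterate_wittVerschiebung_add,
    WittVector.iterate_verschiebung_coeff]

/-- The polynomials `φ_n(f_n, g_n, …, f_0, g_0)` agree for all large `n` if `f` and `g` vanish
eventually. -/
theorem wittPhi_reverse_add (n d : ℕ) {f g : ℕ → B} (hf : ∀ j, n < j → f j = 0)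
    (hg : ∀ j, n < j → g j = 0) :
    wittPhi p (n + d) (fun i => f (n + d - i)) (fun i => g (n + d - i)) =
      wittPhi p n (fun i => f (n - i)) (fun i => g (n - i)) := by
  rw [wittPhi_shift n d (fun a ha => hf _ (by omega)) (fun a ha => hg _ (by omega))]
  congr 1 <;> funext a
  · rw [Nat.add_sub_add_right]
  · rw [Nat.add_sub_add_right]

theorem wittPhi_reverse_eq {n m : ℕ} {f g : ℕ → B} (hf : ∀ j, n < j → f j = 0)
    (hg : ∀ j, n < j → g j = 0) (hf' : ∀ j, m < j → f j = 0) (hg' : ∀ j, m < j → g j = 0) :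
    wittPhi p m (fun i => f (m - i)) (fun i => g (m - i)) =
      wittPhi p n (fun i => f (n - i)) (fun i => g (n - i)) := by
  rcases le_total n m with h | h
  · obtain ⟨d, rfl⟩ := Nat.exists_eq_add_of_le h
    exact wittPhi_reverse_add n d hf hg
  · obtain ⟨d, rfl⟩ := Nat.exists_eq_add_of_le h
    exact (wittPhi_reverse_add m d hf' hg').symm

end Shift

section Primitive

open Coalgebra

variable {p : ℕ} [Fact p.Prime] {k : Type u} [Field k]
variable {R : Type u} [CommRing R] [HopfAlgebra k R]

variable (p k R) in
/-- The Witt vectors over `R` whose first `n + 1` entries are the coordinates of a homomorphism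
`Spec R → W_n`, that is, that the comultiplication sends to `w ⊗ 1 + 1 ⊗ w` in the Witt vectors
of length `n + 1` over `R ⊗ R`. -/
def primitiveWitt (n : ℕ) : AddSubgroup (WittVector p R) :=
  (((WittVector.truncate (n + 1)).toAddMonoidHom.comp
    ((WittVector.map (Bialgebra.comulAlgHom k R).toRingHom).toAddMonoidHom -
      (WittVector.map (Algebra.TensorProduct.includeLeft :
        R →ₐ[k] R ⊗[k] R).toRingHom).toAddMonoidHom -
      (WittVector.map (Algebra.TensorProduct.includeRight :
        R →ₐ[k] R ⊗[k] R).toRingHom).toAddMonoidHom)).ker) ⊓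
  ((WittVector.truncate (n + 1)).toAddMonoidHom.comp
    (WittVector.map (Bialgebra.counitAlgHom k R).toRingHom).toAddMonoidHom).ker

theorem truncate_eq_iff {B : Type*} [CommRing B] {n : ℕ} {u v : WittVector p B} :
    WittVector.truncate (n + 1) u = WittVector.truncate (n + 1) v ↔
      ∀ i ≤ n, u.coeff i = v.coeff i := by
  constructor
  · intro h i hi
    have := congrArg (TruncatedWittVector.coeff (⟨i, by omega⟩ : Fin (n + 1))) h
    rwa [WittVector.coeff_truncate, WittVector.coeff_truncate] at this
  · intro h
    ext i
    rw [WittVector.coeff_truncate, WittVector.coeff_truncate]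
    exact h i (by omega)

theorem mem_primitiveWitt_iff_truncate {n : ℕ} {w : WittVector p R} : w ∈ primitiveWitt p k R n ↔
    WittVector.truncate (n + 1) (WittVector.map (Bialgebra.comulAlgHom k R).toRingHom w) =
      WittVector.truncate (n + 1) (WittVector.map (Algebra.TensorProduct.includeLeft :
        R →ₐ[k] R ⊗[k] R).toRingHom w + WittVector.map (Algebra.TensorProduct.includeRight :
        R →ₐ[k] R ⊗[k] R).toRingHom w) ∧
    WittVector.truncate (n + 1) (WittVector.map (Bialgebra.counitAlgHom k R).toRingHom w) = 0 := by
  unfold primitiveWitt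
  rw [AddSubgroup.mem_inf, AddMonoidHom.mem_ker, AddMonoidHom.mem_ker]
  refine and_congr ?_ Iff.rfl
  conv_rhs => rw [← sub_eq_zero, ← map_sub, ← sub_sub]
  rfl

theorem mem_primitiveWitt_iff {n : ℕ} {w : WittVector p R} : w ∈ primitiveWitt p k R n ↔
    ∀ i ≤ n, comul (R := k) (w.coeff i) = wittPhi p i (fun j => w.coeff j ⊗ₜ[k] (1 : R))
      (fun j => (1 : R) ⊗ₜ[k] w.coeff j) ∧ counit (R := k) (w.coeff i) = 0 := by
  rw [mem_primitiveWitt_iff_truncate, ← map_zero (WittVector.truncate (n + 1)), truncate_eq_iff,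
    truncate_eq_iff, ← forall₂_and]
  refine forall₂_congr fun i _ => and_congr ?_ ?_
  · rw [wittPhi_eq_coeff, WittVector.map_coeff]
    rfl
  · rw [WittVector.map_coeff, WittVector.zero_coeff]
    rfl

/-- The homomorphism `Spec R → W_n` with the given coordinates. -/
def wittHomOfPrimitive {n : ℕ} {w : WittVector p R} (hw : w ∈ primitiveWitt p k R n) :
    WittHopf p n k →ₐc[k] R :=
  BialgHom.ofAlgHom (WittHopf.lift p n w.coeff)
    (by
      refine WittHopf.hom_ext fun i hi => ?_
      rw [AlgHom.comp_apply, WittHopf.lift_x _ hi]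
      exact ((mem_primitiveWitt_iff.1 hw i hi).2).trans (WittHopf.counit_x hi).symm)
    (by
      refine WittHopf.hom_ext fun i hi => ?_
      rw [AlgHom.comp_apply, AlgHom.comp_apply, WittHopf.lift_x _ hi]
      refine Eq.trans ?_ (mem_primitiveWitt_iff.1 hw i hi).1.symm
      change Algebra.TensorProduct.map _ _ (comul (R := k) (WittHopf.x p n k i)) = _
      rw [WittHopf.comul_x hi, map_wittPhi]
      refine wittPhi_congr (fun j hj => ?_) (fun j hj => ?_)
      · rw [Algebra.TensorProduct.map_tmul, WittHopf.lift_x _ (hj.trans hi), map_one]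
      · rw [Algebra.TensorProduct.map_tmul, WittHopf.lift_x _ (hj.trans hi), map_one])

theorem wittHomOfPrimitive_x {n : ℕ} {w : WittVector p R} (hw : w ∈ primitiveWitt p k R n)
    {i : ℕ} (hi : i ≤ n) : wittHomOfPrimitive hw (WittHopf.x p n k i) = w.coeff i :=
  WittHopf.lift_x _ hi

theorem mem_primitiveWitt_of_hom {n : ℕ} (f : WittHopf p n k →ₐc[k] R) :
    WittVector.mk p (fun i => f (WittHopf.x p n k i)) ∈ primitiveWitt p k R n := by
  rw [mem_primitiveWitt_iff]
  intro i hi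
  constructor
  · have h := CoalgHomClass.map_comp_comul_apply f (WittHopf.x p n k i)
    refine h.symm.trans ?_
    rw [WittHopf.comul_x hi]
    exact map_wittPhi (Algebra.TensorProduct.map (f : WittHopf p n k →ₐ[k] R)
      (f : WittHopf p n k →ₐ[k] R)) i _ _ |>.trans (by simp)
  · exact (CoalgHomClass.counit_comp_apply f _).trans (WittHopf.counit_x hi)

end Primitive

section Elements

open Coalgebra

variable {p : ℕ} [Fact p.Prime] {k : Type u} [Field k] [CharP k p] [PerfectRing k p]
variable {R : Type u} [CommRing R] [HopfAlgebra k R] [Coalgebra.IsCocomm k R] [Module.Finite k R]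

theorem VerschiebungPowZero.eq_zero {N : ℕ} (h : VerschiebungPowZero p k R N) {x : R}
    (hx : counit (R := k) x = 0) {j : ℕ} (hj : N ≤ j) : (verschiebung p k)^[j] x = 0 :=
  iterate_verschiebung_eq_zero_of_le hj (h x hx)

/-- The equation that defines Dieudonné elements does not depend on `n`, as long as the
Verschiebung kills the element after `n + 1` steps. -/
theorem IsDieudonneElement.level {n m : ℕ} {x : R} (h : IsDieudonneElement p k n x)
    (hn : (verschiebung p k)^[n + 1] x = 0) (hm : (verschiebung p k)^[m + 1] x = 0) :
    IsDieudonneElement p k m x := by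
  refine ⟨h.1, h.2.trans ?_⟩
  have hn' : ∀ j, n < j → (verschiebung p k)^[j] x = 0 := fun j hj =>
    iterate_verschiebung_eq_zero_of_le hj hn
  have hm' : ∀ j, m < j → (verschiebung p k)^[j] x = 0 := fun j hj =>
    iterate_verschiebung_eq_zero_of_le hj hm
  exact wittPhi_reverse_eq (f := fun j => ((verschiebung p k)^[j] x) ⊗ₜ[k] (1 : R))
    (g := fun j => (1 : R) ⊗ₜ[k] ((verschiebung p k)^[j] x))
    (fun j hj => by rw [hm' j hj, zero_tmul]) (fun j hj => by rw [hm' j hj, tmul_zero])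
    (fun j hj => by rw [hn' j hj, zero_tmul]) (fun j hj => by rw [hn' j hj, tmul_zero])

theorem mem_dieudonneElements_iff {n : ℕ} (hV : VerschiebungPowZero p k R (n + 1)) {x : R} :
    x ∈ dieudonneElements p k R ↔ IsDieudonneElement p k n x := by
  refine ⟨?_, fun h => ⟨n, hV, h⟩⟩
  rintro ⟨m, hm, h⟩
  exact h.level (hm x h.1) (hV x h.1)

theorem dotAdd_level {n m : ℕ} (hn : VerschiebungPowZero p k R (n + 1))
    (hm : VerschiebungPowZero p k R (m + 1)) {x y : R} (hx : counit (R := k) x = 0)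
    (hy : counit (R := k) y = 0) : dotAdd p k n x y = dotAdd p k m x y :=
  wittPhi_reverse_eq (f := fun j => (verschiebung p k)^[j] x)
    (g := fun j => (verschiebung p k)^[j] y)
    (fun _ hj => hm.eq_zero hx hj) (fun _ hj => hm.eq_zero hy hj)
    (fun _ hj => hn.eq_zero hx hj) (fun _ hj => hn.eq_zero hy hj)

variable (p k) in
/-- The Witt vector `(V^{n*} x, V^{(n-1)*} x, …, x, …)`; only the entries with index at most `n`
matter. -/
def wittVec (n : ℕ) (x : R) : WittVector p R :=
  WittVector.mk p fun i => (verschiebung p k)^[n - i] x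

theorem wittVec_coeff (n : ℕ) (x : R) (i : ℕ) :
    (wittVec p k n x).coeff i = (verschiebung p k)^[n - i] x := rfl

@[simp]
theorem wittVec_coeff_self (n : ℕ) (x : R) : (wittVec p k n x).coeff n = x := by
  simp [wittVec_coeff]

theorem dotAdd_eq_coeff (n : ℕ) (x y : R) :
    dotAdd p k n x y = (wittVec p k n x + wittVec p k n y).coeff n := wittPhi_eq_coeff _ _ _

/-- The last coordinate determines a primitive Witt vector of length `n + 1`. -/
theorem coeff_of_mem_primitiveWitt {n : ℕ} {w : WittVector p R} (hw : w ∈ primitiveWitt p k R n)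
    {i : ℕ} (hi : i ≤ n) : w.coeff i = (verschiebung p k)^[n - i] (w.coeff n) := by
  rw [← wittHomOfPrimitive_x hw hi, ← wittHomOfPrimitive_x hw le_rfl,
    WittHopf.map_x_eq_iterate_verschiebung _ hi]

theorem truncate_wittVec_coeff {n : ℕ} {w : WittVector p R} (hw : w ∈ primitiveWitt p k R n) :
    WittVector.truncate (n + 1) (wittVec p k n (w.coeff n)) = WittVector.truncate (n + 1) w :=
  truncate_eq_iff.2 fun _ hi => (coeff_of_mem_primitiveWitt hw hi).symm

theorem isDieudonneElement_coeff {n : ℕ} {w : WittVector p R} (hw : w ∈ primitiveWitt p k R n) :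
    IsDieudonneElement p k n (w.coeff n) := by
  have h := mem_primitiveWitt_iff.1 hw n le_rfl
  refine ⟨h.2, h.1.trans (wittPhi_congr (fun j hj => ?_) (fun j hj => ?_))⟩
  · rw [coeff_of_mem_primitiveWitt hw hj]
  · rw [coeff_of_mem_primitiveWitt hw hj]

theorem IsDieudonneElement.comul_iterate_verschiebung {n : ℕ} {x : R}
    (h : IsDieudonneElement p k n x) (j : ℕ) : comul (R := k) ((verschiebung p k)^[j] x) =
      wittPhi p n (fun i => ((verschiebung p k)^[n - i + j] x) ⊗ₜ[k] (1 : R))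
        (fun i => (1 : R) ⊗ₜ[k] ((verschiebung p k)^[n - i + j] x)) := by
  induction j with
  | zero => exact h.2
  | succ j ih =>
    rw [Function.iterate_succ_apply', comul_verschiebung, ih, map_wittPhi]
    congr 1 <;> funext i
    · rw [verschiebungHom_apply, verschiebung_tmul, verschiebung_one,
        ← Function.iterate_succ_apply' (f := verschiebung p k)]
      rfl
    · rw [verschiebungHom_apply, verschiebung_tmul, verschiebung_one,
        ← Function.iterate_succ_apply' (f := verschiebung p k)]
      rfl

theorem IsDieudonneElement.wittVec_mem {n : ℕ} {x : R} (h : IsDieudonneElement p k n x)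
    (hx : (verschiebung p k)^[n + 1] x = 0) : wittVec p k n x ∈ primitiveWitt p k R n := by
  rw [mem_primitiveWitt_iff]
  intro i hi
  refine ⟨?_, counit_iterate_verschiebung_eq_zero h.1 _⟩
  obtain ⟨j, rfl⟩ := Nat.exists_eq_add_of_le hi
  have e : i + j - i = j := by omega
  have h0 : ∀ a < j, (verschiebung p k)^[i + j - a + j] x = 0 := fun a ha =>
    iterate_verschiebung_eq_zero_of_le (by omega) hx
  rw [wittVec_coeff, e, h.comul_iterate_verschiebung,
    wittPhi_shift i j (fun a ha => by rw [h0 a ha, zero_tmul])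
      (fun a ha => by rw [h0 a ha, tmul_zero])]
  have e' : ∀ a ≤ i, i + j - (a + j) + j = i + j - a := fun a ha => by omega
  refine wittPhi_congr (fun a ha => ?_) (fun a ha => ?_)
  · rw [e' a ha, wittVec_coeff]
  · rw [e' a ha, wittVec_coeff]

/-- Homomorphisms `Spec R → W_n` are classified by the Dieudonné elements that `V^{n+1}` kills. -/
theorem existsUnique_wittHom {n : ℕ} {x : R} (h : IsDieudonneElement p k n x)
    (hx : (verschiebung p k)^[n + 1] x = 0) :
    ∃! f : WittHopf p n k →ₐc[k] R, f (WittHopf.x p n k n) = x := by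
  refine ⟨wittHomOfPrimitive (h.wittVec_mem hx), ?_, fun g hg => ?_⟩
  · exact (wittHomOfPrimitive_x _ le_rfl).trans (wittVec_coeff_self n x)
  · have hfg : (g : WittHopf p n k →ₐ[k] R) =
        (wittHomOfPrimitive (h.wittVec_mem hx) : WittHopf p n k →ₐ[k] R) := by
      refine WittHopf.hom_ext fun i hi => ?_
      refine (WittHopf.map_x_eq_iterate_verschiebung g hi).trans ?_
      rw [hg]
      exact (wittHomOfPrimitive_x (h.wittVec_mem hx) hi).symm
    exact DFunLike.ext _ _ fun a => DFunLike.congr_fun hfg a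

theorem isDieudonneElement_of_wittHom {n : ℕ} (f : WittHopf p n k →ₐc[k] R) :
    IsDieudonneElement p k n (f (WittHopf.x p n k n)) :=
  isDieudonneElement_coeff (mem_primitiveWitt_of_hom f)

end Elements

/-! ### Operations on the set of Dieudonné elements -/

section Closure

open Coalgebra

variable {p : ℕ} [Fact p.Prime] {k : Type u} [Field k]
variable {R : Type u} [CommRing R] [HopfAlgebra k R]

variable (p k R) in
/-- The map `W(k) → W(R)`. -/
def wittAlgebraMap : WittVector p k →+* WittVector p R := WittVector.map (algebraMap k R)

theorem wittAlgebraMap_mul_mem {n : ℕ} {w : WittVector p R} (hw : w ∈ primitiveWitt p k R n)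
    (c : WittVector p k) : wittAlgebraMap p k R c * w ∈ primitiveWitt p k R n := by
  have hc : ∀ {B : Type u} [CommRing B] [Algebra k B] (g : R →ₐ[k] B),
      WittVector.map g.toRingHom (wittAlgebraMap p k R c) = WittVector.map (algebraMap k B) c := by
    intro B _ _ g
    ext i
    simp only [wittAlgebraMap, WittVector.map_coeff]
    exact g.commutes _
  rw [mem_primitiveWitt_iff_truncate] at hw ⊢
  rw [map_mul, map_mul, map_mul, map_mul, map_mul, map_mul, hw.1, hw.2, hc, hc, hc, mul_zero,
    ← mul_add, map_mul]
  exact ⟨rfl, rfl⟩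

theorem charP_of_hopfAlgebra (p : ℕ) (k R : Type u) [Field k] [CommRing R] [HopfAlgebra k R]
    [CharP k p] : CharP R p :=
  have : Nontrivial R := (Bialgebra.counitAlgHom k R).toRingHom.domain_nontrivial
  charP_of_injective_algebraMap (FaithfulSMul.algebraMap_injective k R) p

end Closure

section Group

open Coalgebra

variable {p : ℕ} [Fact p.Prime] {k : Type u} [Field k] [CharP k p] [PerfectRing k p]
variable {R : Type u} [CommRing R] [HopfAlgebra k R] [Coalgebra.IsCocomm k R] [Module.Finite k R]

/-- The set `D(G)` of Dieudonné elements, to be endowed with its module structure at level `n`. The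
parameter `j` says that `σ^j(c)` acts as `c ×̇ x`. -/
@[nolint unusedArguments]
def LevelModule (_j : ℕ) {n : ℕ} (_hV : VerschiebungPowZero p k R (n + 1)) : Type u :=
  dieudonneElements p k R

namespace LevelModule

variable {j n : ℕ} {hV : VerschiebungPowZero p k R (n + 1)}

/-- The underlying element of `R`. -/
def val (x : LevelModule j hV) : R := Subtype.val (p := (· ∈ dieudonneElements p k R)) x

theorem val_injective : Function.Injective (val : LevelModule j hV → R) :=
  Subtype.val_injective

variable (j hV) in
/-- The element of the level module given by a primitive Witt vector. -/
def ofWitt (w : WittVector p R) (hw : w ∈ primitiveWitt p k R n) : LevelModule j hV :=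
  ⟨w.coeff n, (mem_dieudonneElements_iff hV).2 (isDieudonneElement_coeff hw)⟩

theorem isDieudonneElement (x : LevelModule j hV) : IsDieudonneElement p k n x.val :=
  (mem_dieudonneElements_iff hV).1 x.2

theorem counit_val (x : LevelModule j hV) : counit (R := k) x.val = 0 := x.isDieudonneElement.1

theorem wittVec_mem (x : LevelModule j hV) : wittVec p k n x.val ∈ primitiveWitt p k R n :=
  x.isDieudonneElement.wittVec_mem (hV _ x.counit_val)

variable (j hV) in
/-- A Dieudonné element of level `n`, as an element of the level module. -/
def mk (x : R) (h : IsDieudonneElement p k n x) : LevelModule j hV :=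
  ⟨x, (mem_dieudonneElements_iff hV).2 h⟩

@[simp]
theorem val_mk (x : R) (h : IsDieudonneElement p k n x) : (mk j hV x h).val = x := rfl

variable (j hV) in
/-- `D(G)` is the group of primitive Witt vectors of length `n + 1`, that is, of the homomorphisms
`G → W_n`. -/
def equivPrimitive : LevelModule j hV ≃
    (primitiveWitt p k R n).map (WittVector.truncate (n + 1)).toAddMonoidHom where
  toFun x := ⟨WittVector.truncate (n + 1) (wittVec p k n x.val), _, x.wittVec_mem, rfl⟩
  invFun u := ⟨u.1.coeff (Fin.last n), by
    obtain ⟨_, w, hw, rfl⟩ := u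
    exact (ofWitt j hV w hw).2⟩
  left_inv x := val_injective (wittVec_coeff_self n x.val)
  right_inv u := by
    obtain ⟨_, w, hw, rfl⟩ := u
    exact Subtype.ext (truncate_wittVec_coeff hw)

instance : AddCommGroup (LevelModule j hV) := (equivPrimitive j hV).addCommGroup

variable (j hV) in
/-- The embedding of `D(G)` into the Witt vectors of length `n + 1` over `R`. -/
def toTruncated : LevelModule j hV →+ TruncatedWittVector p (n + 1) R :=
  (AddSubgroup.subtype _).comp (AddEquiv.toAddMonoidHom (equivPrimitive j hV).addEquiv)

theorem toTruncated_apply (x : LevelModule j hV) :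
    toTruncated j hV x = WittVector.truncate (n + 1) (wittVec p k n x.val) := rfl

theorem toTruncated_ofWitt (w : WittVector p R) (hw : w ∈ primitiveWitt p k R n) :
    toTruncated j hV (ofWitt j hV w hw) = WittVector.truncate (n + 1) w :=
  truncate_wittVec_coeff hw

theorem toTruncated_injective : Function.Injective (toTruncated j hV) :=
  Subtype.val_injective.comp (equivPrimitive j hV).injective

theorem val_eq_coeff {x : LevelModule j hV} {w : WittVector p R}
    (h : toTruncated j hV x = WittVector.truncate (n + 1) w) : x.val = w.coeff n := by
  rw [toTruncated_apply, truncate_eq_iff] at h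
  rw [← h n le_rfl, wittVec_coeff_self]

theorem val_add (x y : LevelModule j hV) : (x + y).val = dotAdd p k n x.val y.val := by
  rw [dotAdd_eq_coeff]
  refine val_eq_coeff ?_
  rw [map_add, map_add]
  rfl

theorem val_zero : (0 : LevelModule j hV).val = 0 := by
  refine (val_eq_coeff (w := 0) ?_).trans (WittVector.zero_coeff _ _ _)
  rw [map_zero, map_zero]

theorem val_neg (x : LevelModule j hV) : (-x).val = (-wittVec p k n x.val).coeff n := by
  refine val_eq_coeff ?_
  rw [map_neg, map_neg]
  rfl

theorem _root_.Dieudonne.map_iterate_of_comm (φ : R →+* R)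
    (hφ : ∀ x, φ (verschiebung p k x) = verschiebung p k (φ x)) (m : ℕ) (z : R) :
    φ ((verschiebung p k)^[m] z) = (verschiebung p k)^[m] (φ z) := by
  induction m generalizing z with
  | zero => rfl
  | succ m ih => rw [Function.iterate_succ_apply, ih, hφ]; rfl

theorem _root_.Dieudonne.map_dotAdd (n : ℕ) (φ : R →+* R)
    (hφ : ∀ x, φ (verschiebung p k x) = verschiebung p k (φ x)) (x y : R) :
    φ (dotAdd p k n x y) = dotAdd p k n (φ x) (φ y) := by
  unfold dotAdd
  rw [map_wittPhi]
  simp only [map_iterate_of_comm φ hφ]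

variable (p k) in
/-- A ring endomorphism of `R` that is compatible with the Verschiebung, the comultiplication and
the counit, but need not be `k`-linear, preserves Dieudonné elements. -/
theorem _root_.Dieudonne.IsDieudonneElement.map_ringHom {n : ℕ} {x : R}
    (h : IsDieudonneElement p k n x)
    (φ : R →+* R) (hφ : ∀ x, φ (verschiebung p k x) = verschiebung p k (φ x))
    (Φ : R ⊗[k] R →+* R ⊗[k] R) (hΦ : ∀ x y, Φ (x ⊗ₜ y) = φ x ⊗ₜ φ y)
    (hΔ : ∀ x, comul (R := k) (φ x) = Φ (comul (R := k) x))
    (hε : ∀ x, counit (R := k) x = 0 → counit (R := k) (φ x) = 0) :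
    IsDieudonneElement p k n (φ x) := by
  refine ⟨hε x h.1, ?_⟩
  rw [hΔ, h.2, map_wittPhi]
  simp only [hΦ, map_one, map_iterate_of_comm φ hφ]

/-- The endomorphism of `D(G)` induced by a ring endomorphism of `R`. -/
def ringEnd (φ : R →+* R) (hφ : ∀ x, φ (verschiebung p k x) = verschiebung p k (φ x))
    (h : ∀ x, IsDieudonneElement p k n x → IsDieudonneElement p k n (φ x)) :
    AddMonoid.End (LevelModule j hV) where
  toFun x := mk j hV (φ x.val) (h _ x.isDieudonneElement)
  map_zero' := val_injective (by rw [val_mk, val_zero, map_zero])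
  map_add' x y := val_injective (by
    simp only [val_add, val_mk, map_dotAdd n φ hφ])

variable (j hV) in
/-- `F x = x^p`. -/
def frobeniusEnd : AddMonoid.End (LevelModule j hV) :=
  haveI := charP_of_hopfAlgebra p k R
  ringEnd (frobenius R p) (fun x => (verschiebung_pow x p).symm) fun x hx => by
    have := charP_of_hopfAlgebra p k (R ⊗[k] R)
    refine hx.map_ringHom p k (frobenius R p) (fun x => (verschiebung_pow x p).symm)
      (frobenius (R ⊗[k] R) p) (fun x y => ?_) (fun x => ?_) (fun _ hx => ?_)
    · simp [frobenius_def, Algebra.TensorProduct.tmul_pow]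
    · exact map_pow (Bialgebra.comulAlgHom k R) x p
    · refine (map_pow (Bialgebra.counitAlgHom k R) _ p).trans ?_
      rw [Bialgebra.counitAlgHom_apply, hx, zero_pow (Fact.out : p.Prime).ne_zero]

@[simp]
theorem val_frobeniusEnd (x : LevelModule j hV) : (frobeniusEnd j hV x).val = x.val ^ p := rfl

variable (j hV) in
/-- `V x = V^* x`. -/
def verschiebungEnd : AddMonoid.End (LevelModule j hV) :=
  ringEnd (verschiebungHom p k R) (fun _ => rfl) fun _ hx =>
    hx.map_ringHom p k (verschiebungHom p k R) (fun _ => rfl) (verschiebungHom p k (R ⊗[k] R))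
      verschiebung_tmul comul_verschiebung fun _ hx => counit_verschiebung_eq_zero hx

@[simp]
theorem val_verschiebungEnd (x : LevelModule j hV) :
    (verschiebungEnd j hV x).val = verschiebung p k x.val := rfl

theorem val_nsmul_p (x : LevelModule j hV) : (p • x).val = verschiebung p k x.val ^ p := by
  have := charP_of_hopfAlgebra p k R
  have h : toTruncated j hV (p • x) =
      WittVector.truncate (n + 1) (wittVec p k n x.val * (p : WittVector p R)) := by
    rw [map_nsmul, map_mul, map_natCast, nsmul_eq_mul, mul_comm]
    rfl
  rw [val_eq_coeff h, ← WittVector.verschiebung_frobenius,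
    WittVector.verschiebung_frobenius_comm, WittVector.coeff_frobenius_charP]
  congr 1
  rcases n with _ | n
  · rw [WittVector.verschiebung_coeff_zero]
    exact (hV _ x.counit_val).symm
  · rw [WittVector.verschiebung_coeff_succ, wittVec_coeff]
    simp

theorem frobeniusEnd_mul_verschiebungEnd :
    frobeniusEnd j hV * verschiebungEnd j hV = (p : AddMonoid.End (LevelModule j hV)) := by
  refine DFunLike.ext _ _ fun x => val_injective ?_
  rw [AddMonoid.End.natCast_apply, val_nsmul_p]
  rfl

theorem verschiebungEnd_mul_frobeniusEnd :
    verschiebungEnd j hV * frobeniusEnd j hV = (p : AddMonoid.End (LevelModule j hV)) := by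
  refine DFunLike.ext _ _ fun x => val_injective ?_
  rw [AddMonoid.End.natCast_apply, val_nsmul_p]
  exact verschiebung_pow _ p

variable (j hV) in
/-- The action of `c ∈ W(k)` through the ring structure of the Witt vectors over `R`. -/
def scalarEnd (c : WittVector p k) : AddMonoid.End (LevelModule j hV) where
  toFun x := ofWitt j hV (wittAlgebraMap p k R c * wittVec p k n x.val)
    (wittAlgebraMap_mul_mem x.wittVec_mem c)
  map_zero' := toTruncated_injective (by
    rw [toTruncated_ofWitt, map_mul, ← toTruncated_apply, map_zero, mul_zero])
  map_add' x y := toTruncated_injective (by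
    rw [map_add, toTruncated_ofWitt, toTruncated_ofWitt, toTruncated_ofWitt, map_mul, map_mul,
      map_mul, ← toTruncated_apply, ← toTruncated_apply, ← toTruncated_apply, map_add, mul_add])

theorem toTruncated_scalarEnd (c : WittVector p k) (x : LevelModule j hV) :
    toTruncated j hV (scalarEnd j hV c x) =
      WittVector.truncate (n + 1) (wittAlgebraMap p k R c) * toTruncated j hV x :=
  (toTruncated_ofWitt _ (wittAlgebraMap_mul_mem x.wittVec_mem c)).trans (map_mul _ _ _)

theorem val_scalarEnd (c : WittVector p k) (x : LevelModule j hV) :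
    (scalarEnd j hV c x).val = (wittAlgebraMap p k R c * wittVec p k n x.val).coeff n := rfl

variable (j hV) in
/-- The action of `W(k)` as a ring homomorphism. -/
def scalarHom : WittVector p k →+* AddMonoid.End (LevelModule j hV) where
  toFun := scalarEnd j hV
  map_one' := DFunLike.ext _ _ fun x => toTruncated_injective (by
    rw [toTruncated_scalarEnd, map_one, map_one, one_mul]; rfl)
  map_mul' c d := DFunLike.ext _ _ fun x => toTruncated_injective (by
    rw [toTruncated_scalarEnd, map_mul, map_mul, mul_assoc, ← toTruncated_scalarEnd,
      ← toTruncated_scalarEnd]; rfl)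
  map_zero' := DFunLike.ext _ _ fun x => toTruncated_injective (by
    rw [toTruncated_scalarEnd, map_zero, map_zero, zero_mul]
    exact (map_zero (toTruncated j hV)).symm)
  map_add' c d := DFunLike.ext _ _ fun x => toTruncated_injective (by
    rw [toTruncated_scalarEnd, map_add, map_add, add_mul, ← toTruncated_scalarEnd,
      ← toTruncated_scalarEnd]
    exact (map_add (toTruncated j hV) _ _).symm)

theorem frobeniusEnd_mul_scalarHom (c : WittVector p k) :
    frobeniusEnd j hV * scalarHom j hV c =
      scalarHom j hV (WittVector.frobeniusEquiv p k c) * frobeniusEnd j hV := by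
  have := charP_of_hopfAlgebra p k R
  refine DFunLike.ext _ _ fun x => val_injective ?_
  change (wittAlgebraMap p k R c * wittVec p k n x.val).coeff n ^ p =
    (wittAlgebraMap p k R (WittVector.frobeniusEquiv p k c) * wittVec p k n (x.val ^ p)).coeff n
  rw [← WittVector.coeff_frobenius_charP, map_mul]
  congr 2
  · ext i
    simp [wittAlgebraMap, WittVector.coeff_frobenius_charP]
  · ext i
    rw [WittVector.coeff_frobenius_charP, wittVec_coeff, wittVec_coeff, iterate_verschiebung_pow]

theorem verschiebungEnd_mul_scalarHom (c : WittVector p k) :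
    verschiebungEnd j hV * scalarHom j hV c =
      scalarHom j hV ((WittVector.frobeniusEquiv p k).symm c) * verschiebungEnd j hV := by
  obtain ⟨c, rfl⟩ := (WittVector.frobeniusEquiv p k).surjective c
  rw [RingEquiv.symm_apply_apply]
  refine DFunLike.ext _ _ fun x => val_injective ?_
  change verschiebungHom p k R ((wittAlgebraMap p k R (WittVector.frobeniusEquiv p k c) *
    wittVec p k n x.val).coeff n) =
    (wittAlgebraMap p k R c * wittVec p k n (verschiebung p k x.val)).coeff n
  rw [← WittVector.map_coeff (verschiebungHom p k R), map_mul]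
  congr 2
  · ext i
    simp [wittAlgebraMap, WittVector.coeff_frobenius_charP, Algebra.algebraMap_eq_smul_one,
      verschiebung_smul, verschiebung_one]
  · ext i
    rw [WittVector.map_coeff, wittVec_coeff, wittVec_coeff, ← Function.iterate_succ_apply,
      verschiebungHom_apply,
      ← Function.iterate_succ_apply' (f := verschiebung p k)]

end LevelModule

end Group

/-! ### The module structure over the Dieudonné ring -/

section ModuleConstruction

variable {p : ℕ} [Fact p.Prime] {k : Type u} [Field k] [CharP k p] [PerfectRing k p]

namespace DieudonneRing

/-- The universal property of the Dieudonné ring. -/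
def lift {E : Type*} [Ring E] (F V : E) (w : WittVector p k →+* E) (hFV : F * V = p)
    (hVF : V * F = p) (hF : ∀ a, F * w a = w (WittVector.frobeniusEquiv p k a) * F)
    (hV : ∀ a, V * w a = w ((WittVector.frobeniusEquiv p k).symm a) * V) :
    DieudonneRing p k →+* E :=
  RingQuot.lift ⟨(FreeAlgebra.lift ℤ fun
    | .F => F
    | .V => V
    | .w a => w a : FreeAlgebra ℤ (DieudonneGen p k) →ₐ[ℤ] E).toRingHom, by
      rintro _ _ (⟨a, b⟩ | ⟨a, b⟩ | _ | _ | _ | a | a)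
      · simp
      · simp
      · simp
      · simp [hFV]
      · simp [hVF]
      · simp [hF]
      · simp [hV]⟩

section lift

variable {E : Type*} [Ring E] (F' V' : E) (w : WittVector p k →+* E) (hFV : F' * V' = p)
    (hVF : V' * F' = p) (hF : ∀ a, F' * w a = w (WittVector.frobeniusEquiv p k a) * F')
    (hV : ∀ a, V' * w a = w ((WittVector.frobeniusEquiv p k).symm a) * V')

theorem lift_mk (a : FreeAlgebra ℤ (DieudonneGen p k)) :
    lift F' V' w hFV hVF hF hV (mk p k a) = FreeAlgebra.lift ℤ (fun
    | .F => F'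
    | .V => V'
    | .w a => w a) a := by
  unfold lift mk
  exact RingQuot.lift_mkRingHom_apply _ _ _

@[simp]
theorem lift_F : lift F' V' w hFV hVF hF hV (F p k) = F' := by
  refine (lift_mk F' V' w hFV hVF hF hV _).trans ?_
  rw [FreeAlgebra.lift_ι_apply]

@[simp]
theorem lift_V : lift F' V' w hFV hVF hF hV (V p k) = V' := by
  refine (lift_mk F' V' w hFV hVF hF hV _).trans ?_
  rw [FreeAlgebra.lift_ι_apply]

@[simp]
theorem lift_ofWitt (a : WittVector p k) : lift F' V' w hFV hVF hF hV (ofWitt p k a) = w a := by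
  refine (lift_mk F' V' w hFV hVF hF hV _).trans ?_
  rw [FreeAlgebra.lift_ι_apply]

end lift

theorem FV_eq : F p k * V p k = p := (map_mul (mk p k) _ _).symm.trans
  ((mk_rel .FV).trans (map_natCast _ p))

theorem F_mul_ofWitt (a : WittVector p k) :
    F p k * ofWitt p k a = ofWitt p k (WittVector.frobeniusEquiv p k a) * F p k :=
  (map_mul (mk p k) _ _).symm.trans ((mk_rel (.Fw a)).trans (map_mul (mk p k) _ _))

theorem V_mul_ofWitt (a : WittVector p k) :
    V p k * ofWitt p k a = ofWitt p k ((WittVector.frobeniusEquiv p k).symm a) * V p k :=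
  (map_mul (mk p k) _ _).symm.trans ((mk_rel (.Vw a)).trans (map_mul (mk p k) _ _))

/-- The Dieudonné ring is generated by `F`, `V` and `W(k)`. -/
theorem induction {P : DieudonneRing p k → Prop} (hF : P (F p k)) (hV : P (V p k))
    (hw : ∀ a, P (ofWitt p k a)) (hadd : ∀ a b, P a → P b → P (a + b))
    (hmul : ∀ a b, P a → P b → P (a * b)) (a : DieudonneRing p k) : P a := by
  obtain ⟨a, rfl⟩ := RingQuot.mkRingHom_surjective (DieudonneRel p k) a
  change P (mk p k a)
  induction a using FreeAlgebra.induction with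
  | grade0 r =>
    have h : mk p k (algebraMap ℤ _ r) = ofWitt p k (r : WittVector p k) := by
      rw [map_intCast (ofWitt p k)]
      exact map_intCast (mk p k) r
    rw [h]
    exact hw _
  | grade1 x =>
    cases x with
    | F => exact hF
    | V => exact hV
    | w a => exact hw a
  | mul a b ha hb => rw [map_mul]; exact hmul _ _ ha hb
  | add a b ha hb => rw [map_add]; exact hadd _ _ ha hb

/-- An additive map that commutes with `F`, `V` and `W(k)` is linear over the Dieudonné ring. -/
def linearMapOfGenerators {M N : Type*} [AddCommGroup M] [Module (DieudonneRing p k) M]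
    [AddCommGroup N] [Module (DieudonneRing p k) N] (f : M →+ N)
    (hF : ∀ x, f (F p k • x) = F p k • f x) (hV : ∀ x, f (V p k • x) = V p k • f x)
    (hw : ∀ a x, f (ofWitt p k a • x) = ofWitt p k a • f x) : M →ₗ[DieudonneRing p k] N :=
  { f with
    map_smul' := fun a => by
      refine induction (P := fun a => ∀ x, f (a • x) = a • f x) hF hV hw (fun a b ha hb x => ?_)
        (fun a b ha hb x => ?_) a
      · rw [add_smul, add_smul, map_add, ha, hb]
      · rw [mul_smul, mul_smul, ha, hb] }

end DieudonneRing

variable (p k) in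
/-- The `j`-th power of `σ⁻¹` on `W(k)`. -/
def untwist : ℕ → (WittVector p k →+* WittVector p k)
  | 0 => RingHom.id _
  | j + 1 => (untwist j).comp (WittVector.frobeniusEquiv p k).symm.toRingHom

theorem untwist_iterate (j : ℕ) (c : WittVector p k) :
    untwist p k j ((WittVector.frobeniusEquiv p k)^[j] c) = c := by
  induction j with
  | zero => rfl
  | succ j ih =>
    rw [Function.iterate_succ_apply']
    change untwist p k j ((WittVector.frobeniusEquiv p k).symm (WittVector.frobeniusEquiv p k _)) = _
    rw [RingEquiv.symm_apply_apply, ih]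

theorem untwist_frobenius (j : ℕ) (c : WittVector p k) :
    untwist p k j (WittVector.frobeniusEquiv p k c) =
      WittVector.frobeniusEquiv p k (untwist p k j c) := by
  induction j generalizing c with
  | zero => rfl
  | succ j ih =>
    change untwist p k j ((WittVector.frobeniusEquiv p k).symm (WittVector.frobeniusEquiv p k _)) =
      WittVector.frobeniusEquiv p k (untwist p k j ((WittVector.frobeniusEquiv p k).symm c))
    rw [← ih, RingEquiv.symm_apply_apply, RingEquiv.apply_symm_apply]

theorem untwist_frobenius_symm (j : ℕ) (c : WittVector p k) :
    untwist p k j ((WittVector.frobeniusEquiv p k).symm c) =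
      (WittVector.frobeniusEquiv p k).symm (untwist p k j c) := by
  rw [RingEquiv.eq_symm_apply, ← untwist_frobenius, RingEquiv.apply_symm_apply]

variable {R : Type u} [CommRing R] [HopfAlgebra k R] [Coalgebra.IsCocomm k R] [Module.Finite k R]

namespace LevelModule

variable {j n : ℕ} {hV : VerschiebungPowZero p k R (n + 1)}

variable (j hV) in
/-- The action of the Dieudonné ring on `D(G)`. -/
def actionHom : DieudonneRing p k →+* AddMonoid.End (LevelModule j hV) :=
  DieudonneRing.lift (frobeniusEnd j hV) (verschiebungEnd j hV)
    ((scalarHom j hV).comp (untwist p k j)) frobeniusEnd_mul_verschiebungEnd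
    verschiebungEnd_mul_frobeniusEnd
    (fun a => by
      rw [RingHom.comp_apply, RingHom.comp_apply, untwist_frobenius, frobeniusEnd_mul_scalarHom])
    (fun a => by
      rw [RingHom.comp_apply, RingHom.comp_apply, untwist_frobenius_symm,
        verschiebungEnd_mul_scalarHom])

instance : Module (DieudonneRing p k) (LevelModule j hV) := Module.compHom _ (actionHom j hV)

theorem smul_def (a : DieudonneRing p k) (x : LevelModule j hV) : a • x = actionHom j hV a x := rfl

theorem F_smul (x : LevelModule j hV) : (DieudonneRing.F p k • x).val = x.val ^ p := by
  rw [smul_def, actionHom, DieudonneRing.lift_F, val_frobeniusEnd]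

theorem V_smul (x : LevelModule j hV) :
    (DieudonneRing.V p k • x).val = verschiebung p k x.val := by
  rw [smul_def, actionHom, DieudonneRing.lift_V, val_verschiebungEnd]

theorem ofWitt_smul (c : WittVector p k) (x : LevelModule j hV) :
    DieudonneRing.ofWitt p k c • x = scalarEnd j hV (untwist p k j c) x := by
  rw [smul_def, actionHom, DieudonneRing.lift_ofWitt]
  rfl

end LevelModule

end ModuleConstruction

section Formulas

open Coalgebra

/-- The Teichmüller representative of `-1` is `-1` if `p` is odd: this holds in `W(ℤ)`, where the
ghost components are `(-1)^{p^i} = -1`. -/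
theorem teichmuller_neg_one {p : ℕ} [Fact p.Prime] (hp : p ≠ 2) (B : Type*) [CommRing B] :
    WittVector.teichmuller p (-1 : B) = -1 := by
  have hZ : WittVector.teichmuller p (-1 : ℤ) = -1 := by
    refine WittVector.map_injective (Int.castRingHom ℚ) Int.cast_injective ?_
    rw [WittVector.map_teichmuller, map_neg (WittVector.map _), map_one (WittVector.map _),
      map_neg (Int.castRingHom ℚ), map_one (Int.castRingHom ℚ)]
    have : Invertible (p : ℚ) := invertibleOfNonzero (by exact_mod_cast (Fact.out : p.Prime).ne_zero)
    refine (WittVector.ghostMap.bijective_of_invertible p ℚ).1 ?_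
    funext i
    rw [WittVector.ghostMap_apply, WittVector.ghostMap_apply,
      WittVector.ghostComponent_teichmuller, map_neg (WittVector.ghostComponent i), map_one]
    rw [Odd.neg_one_pow ((Nat.Prime.odd_of_ne_two Fact.out hp).pow)]
  have h := congrArg (WittVector.map (Int.castRingHom B)) hZ
  rwa [WittVector.map_teichmuller, map_neg (WittVector.map _), map_one (WittVector.map _),
    map_neg (Int.castRingHom B), map_one (Int.castRingHom B)] at h

/-- Multiplication of a Witt vector by a Teichmüller representative. -/
theorem teichmuller_mul_coeff {p : ℕ} [Fact p.Prime] {B : Type*} [CommRing B] (a : B)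
    (w : WittVector p B) (i : ℕ) :
    (WittVector.teichmuller p a * w).coeff i = a ^ p ^ i * w.coeff i := by
  -- the ghost components agree, and they determine a Witt vector if `p` is invertible
  have hinv : ∀ (C : Type) [CommRing C] [Invertible (p : C)] (a : C) (w : WittVector p C),
      WittVector.teichmuller p a * w = WittVector.mk p fun i => a ^ p ^ i * w.coeff i := by
    intro C _ _ a w
    refine (WittVector.ghostMap.bijective_of_invertible p C).1 ?_
    funext n
    rw [WittVector.ghostMap_apply, WittVector.ghostMap_apply, map_mul,
      WittVector.ghostComponent_teichmuller, WittVector.ghostComponent_apply,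
      WittVector.ghostComponent_apply, wittPolynomial_eq_sum_C_mul_X_pow, map_sum, map_sum,
      Finset.mul_sum]
    refine Finset.sum_congr rfl fun j hj => ?_
    have hj' : j + (n - j) = n := by
      have := Finset.mem_range.1 hj
      omega
    simp only [map_mul, map_pow, MvPolynomial.aeval_X, MvPolynomial.aeval_C]
    rw [WittVector.coeff_mk, mul_pow, ← pow_mul, ← pow_add, hj']
    ring
  -- the identity is polynomial with integer coefficients, so that it holds over every ring
  let P := MvPolynomial (Option ℕ) ℤ
  let Q := MvPolynomial (Option ℕ) ℚ
  have hP : WittVector.teichmuller p (MvPolynomial.X none : P) *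
      WittVector.mk p (fun i => (MvPolynomial.X (some i) : P)) =
      WittVector.mk p fun i => (MvPolynomial.X none : P) ^ p ^ i * MvPolynomial.X (some i) := by
    refine WittVector.map_injective (MvPolynomial.map (Int.castRingHom ℚ) : P →+* Q)
      (MvPolynomial.map_injective _ Int.cast_injective) ?_
    have : Invertible (p : ℚ) := invertibleOfNonzero (by exact_mod_cast (Fact.out : p.Prime).ne_zero)
    have : Invertible (p : Q) :=
      (Invertible.map (MvPolynomial.C : ℚ →+* Q) (p : ℚ)).copy _ (map_natCast _ p).symm
    rw [map_mul, WittVector.map_teichmuller, hinv]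
    ext i
    simp
  let g : P →+* B := (MvPolynomial.aeval (R := ℤ) fun o : Option ℕ => o.elim a w.coeff).toRingHom
  have h := congrArg (fun u => (WittVector.map g u).coeff i) hP
  simp only [map_mul, WittVector.map_teichmuller] at h
  have hg : WittVector.map g (WittVector.mk p (fun i => (MvPolynomial.X (some i) : P))) = w := by
    ext j
    rw [WittVector.map_coeff]
    exact MvPolynomial.aeval_X _ _
  have hg' : g (MvPolynomial.X none) = a := MvPolynomial.aeval_X _ _
  have hg'' : g (MvPolynomial.X (some i)) = w.coeff i := MvPolynomial.aeval_X _ _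
  rw [hg, hg', WittVector.map_coeff] at h
  rw [h, WittVector.coeff_mk, map_mul, map_pow, hg', hg'']

theorem neg_coeff_of_odd {p : ℕ} [Fact p.Prime] (hp : p ≠ 2) {B : Type*} [CommRing B]
    (w : WittVector p B) (i : ℕ) : (-w).coeff i = -w.coeff i := by
  rw [← neg_one_mul, ← teichmuller_neg_one hp, teichmuller_mul_coeff,
    Odd.neg_one_pow ((Nat.Prime.odd_of_ne_two Fact.out hp).pow), neg_one_mul]

theorem init_coeff {p : ℕ} {B : Type*} [CommRing B] (m : ℕ) (c : WittVector p B) (i : ℕ) :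
    (WittVector.init m c).coeff i = if i < m then c.coeff i else 0 := by
  rw [WittVector.init, WittVector.select, WittVector.coeff_mk]
  congr

theorem init_one {p : ℕ} [Fact p.Prime] {B : Type*} [CommRing B] (c : WittVector p B) :
    WittVector.init 1 c = WittVector.teichmuller p (c.coeff 0) := by
  ext i
  rcases i with _ | i
  · simp [init_coeff]
  · rw [WittVector.teichmuller_coeff_pos _ _ _ (Nat.succ_pos i)]
    simp [init_coeff]

theorem init_succ {p : ℕ} [Fact p.Prime] {B : Type*} [CommRing B] (c : WittVector p B) (m : ℕ) :
    WittVector.init (m + 1) c = WittVector.init m c +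
      WittVector.verschiebung^[m] (WittVector.teichmuller p (c.coeff m)) := by
  have h : ∀ i, (WittVector.verschiebung^[m] (WittVector.teichmuller p (c.coeff m))).coeff i =
      if i = m then c.coeff m else 0 := by
    intro i
    rcases lt_trichotomy i m with h | rfl | h
    · rw [WittVector.iterate_verschiebung_coeff_eq_zero _ h, if_neg h.ne]
    · have := WittVector.iterate_verschiebung_coeff (WittVector.teichmuller p (c.coeff i)) i 0
      rw [zero_add, WittVector.teichmuller_coeff_zero] at this
      rw [if_pos rfl, this]
    · obtain ⟨d, rfl⟩ := Nat.exists_eq_add_of_lt h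
      rw [if_neg h.ne', show m + d + 1 = (d + 1) + m by omega,
        WittVector.iterate_verschiebung_coeff,
        WittVector.teichmuller_coeff_pos _ _ _ (Nat.succ_pos d)]
  ext i
  rw [WittVector.coeff_add_of_disjoint]
  · rw [h]
    simp only [init_coeff]
    split_ifs <;> first | omega | simp_all
  · intro i
    rw [h]
    simp only [init_coeff]
    split_ifs <;> first | omega | simp_all

theorem antipode_eq_neg_coeff {p : ℕ} [Fact p.Prime] {k R : Type u} [Field k] [CommRing R]
    [HopfAlgebra k R] {n : ℕ} {w : WittVector p R}
    (hw : w ∈ primitiveWitt p k R n) :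
    HopfAlgebra.antipode k (w.coeff n) = (-w).coeff n := by
  have h : WittVector.truncate (n + 1)
      (WittVector.map (HopfAlgebra.antipodeAlgHom k R).toRingHom w + w) =
      WittVector.truncate (n + 1) 0 := by
    rw [truncate_eq_iff]
    intro i hi
    have h1 := (mem_primitiveWitt_iff.1 hw i hi).1
    have h2 := HopfAlgebra.mul_antipode_rTensor_comul_apply (R := k) (w.coeff i)
    have h3 : ∀ t : R ⊗[k] R, LinearMap.mul' k R ((HopfAlgebra.antipode k).rTensor R t) =
        Algebra.TensorProduct.lift (HopfAlgebra.antipodeAlgHom k R) (.id k _)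
          (fun _ _ => Commute.all _ _) t := by
      intro t
      induction t using TensorProduct.induction_on with
      | zero => simp
      | tmul a b => simp
      | add s t hs ht => rw [map_add, map_add, map_add, hs, ht]
    rw [h3, h1, (mem_primitiveWitt_iff.1 hw i hi).2, map_zero, map_wittPhi] at h2
    rw [WittVector.zero_coeff, ← h2, WittVector.add_coeff]
    refine wittPhi_congr (fun j hj => ?_) (fun j hj => ?_)
    · simp
    · simp
  rw [map_add, map_zero, ← eq_neg_iff_add_eq_zero, ← map_neg] at h
  exact truncate_eq_iff.1 h n le_rfl

variable {p : ℕ} [Fact p.Prime] {k : Type u} [Field k] [CharP k p] [PerfectRing k p]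
variable {R : Type u} [CommRing R] [HopfAlgebra k R] [Coalgebra.IsCocomm k R] [Module.Finite k R]

theorem dotAdd_coeff {n : ℕ} {w w' : WittVector p R} (hw : w ∈ primitiveWitt p k R n)
    (hw' : w' ∈ primitiveWitt p k R n) :
    dotAdd p k n (w.coeff n) (w'.coeff n) = (w + w').coeff n := by
  rw [dotAdd_eq_coeff]
  refine truncate_eq_iff.1 ?_ n le_rfl
  rw [map_add, map_add, truncate_wittVec_coeff hw, truncate_wittVec_coeff hw']

theorem verschiebung_teichmuller_mul_wittVec_coeff {m n : ℕ} (hm : m ≤ n) (c : k) (x : R) :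
    (wittAlgebraMap p k R (WittVector.verschiebung^[m] (WittVector.teichmuller p c)) *
      wittVec p k n x).coeff n =
    c ^ p ^ (n - m) • ((verschiebung p k)^[m] x) ^ p ^ m := by
  have := charP_of_hopfAlgebra p k R
  have e : wittAlgebraMap p k R (WittVector.verschiebung^[m] (WittVector.teichmuller p c)) =
      WittVector.verschiebung^[m] (WittVector.teichmuller p (algebraMap k R c)) := by
    have h : ∀ (m : ℕ) (u : WittVector p k),
        wittAlgebraMap p k R (WittVector.verschiebung^[m] u) =
          WittVector.verschiebung^[m] (wittAlgebraMap p k R u) := by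
      intro m
      induction m with
      | zero => intro u; rfl
      | succ m ih =>
        intro u
        rw [Function.iterate_succ_apply, ih, wittAlgebraMap, WittVector.map_verschiebung]
        rfl
    rw [h, wittAlgebraMap, WittVector.map_teichmuller]
  have hn : n - m + m = n := Nat.sub_add_cancel hm
  have e2 := WittVector.iterate_verschiebung_coeff (WittVector.teichmuller p (algebraMap k R c) *
    WittVector.frobenius^[m] (wittVec p k n x)) m (n - m)
  rw [hn] at e2
  rw [e, WittVector.iterate_verschiebung_mul_left, e2, teichmuller_mul_coeff,
    WittVector.iterate_frobenius_coeff, wittVec_coeff, ← map_pow, Algebra.smul_def,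
    Nat.sub_sub_self hm]

theorem dotSMulAux_eq {n : ℕ} {x : R} (hx : wittVec p k n x ∈ primitiveWitt p k R n)
    (c : WittVector p k) {i : ℕ} (hi : i ≤ n) : dotSMulAux p k n c x i =
      (wittAlgebraMap p k R (WittVector.init (i + 1) c) * wittVec p k n x).coeff n := by
  induction i with
  | zero =>
    have h := verschiebung_teichmuller_mul_wittVec_coeff (Nat.zero_le n) (c.coeff 0) x
    rw [zero_add, init_one]
    refine Eq.trans ?_ h.symm
    simp [dotSMulAux]
  | succ i ih =>
    rw [dotSMulAux, ih (by omega), ← verschiebung_teichmuller_mul_wittVec_coeff hi,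
      dotAdd_coeff (wittAlgebraMap_mul_mem hx _) (wittAlgebraMap_mul_mem hx _), ← add_mul,
      ← map_add, ← init_succ]

/-- The operation `×̇` is the product with Witt vectors. -/
theorem dotSMul_eq {n : ℕ} {x : R} (hx : wittVec p k n x ∈ primitiveWitt p k R n)
    (c : WittVector p k) :
    dotSMul p k n c x = (wittAlgebraMap p k R c * wittVec p k n x).coeff n := by
  refine (dotSMulAux_eq hx c le_rfl).trans ?_
  refine truncate_eq_iff.1 ?_ n le_rfl
  rw [map_mul, map_mul]
  congr 1
  refine truncate_eq_iff.2 fun i hi => ?_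
  have hi' : i < n + 1 := by omega
  simp [wittAlgebraMap, init_coeff, hi']

namespace LevelModule

variable (j : ℕ) {n : ℕ} (hV : VerschiebungPowZero p k R (n + 1))

theorem isDieudonneModule :
    IsDieudonneModule p k R j n (M := LevelModule j hV) (Equiv.refl (dieudonneElements p k R)) where
  add x y := val_add x y
  zero := val_zero (j := j) (hV := hV)
  neg x := by
    refine (val_neg x).trans ?_
    rw [← antipode_eq_neg_coeff x.wittVec_mem, wittVec_coeff_self]
    rfl
  neg_of_odd hp x := by
    refine (val_neg x).trans ?_
    rw [neg_coeff_of_odd hp, wittVec_coeff_self]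
    rfl
  smul c x := by
    refine Eq.trans ?_ (dotSMul_eq x.wittVec_mem c).symm
    change val (DieudonneRing.ofWitt p k ((WittVector.frobeniusEquiv p k)^[j] c) • x) = _
    rw [ofWitt_smul, untwist_iterate]
    rfl
  F_smul x := F_smul x
  V_smul x := V_smul x

end LevelModule

end Formulas

/-! ### Finite length, independence of the level and functoriality -/

section FiniteLength

/-- Finite length descends along an injective additive map that is linear with respect to a
multivalued correspondence of scalars. -/
theorem isFiniteLength_of_injective {S S' M M' : Type*} [Ring S] [Ring S'] [AddCommGroup M]
    [Module S M] [AddCommGroup M'] [Module S' M'] (f : M →+ M') (hf : Function.Injective f)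
    (h : ∀ s' : S', ∃ s : S, ∀ m, f (s • m) = s' • f m) (hM' : IsFiniteLength S' M') :
    IsFiniteLength S M := by
  rw [isFiniteLength_iff_isNoetherian_isArtinian] at hM' ⊢
  obtain ⟨h₁, h₂⟩ := hM'
  let Φ : Submodule S M → Submodule S' M' := fun N =>
    { N.toAddSubgroup.map f with
      smul_mem' := by
        rintro s' _ ⟨m, hm, rfl⟩
        obtain ⟨s, hs⟩ := h s'
        exact ⟨s • m, N.smul_mem s hm, hs m⟩ }
  have hmem : ∀ N m, f m ∈ Φ N ↔ m ∈ N := fun N m =>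
    ⟨fun ⟨m', hm', e⟩ => hf e ▸ hm', fun hm => ⟨m, hm, rfl⟩⟩
  have hΦ : StrictMono Φ := by
    refine Monotone.strictMono_of_injective ?_ ?_
    · rintro N N' hN _ ⟨m, hm, rfl⟩
      exact ⟨m, hN hm, rfl⟩
    · intro N N' hN
      ext m
      rw [← hmem, hN, hmem]
  exact ⟨(isNoetherian_iff' (R := S) (M := M)).2 hΦ.wellFoundedGT, hΦ.wellFoundedLT⟩

variable {p : ℕ} [Fact p.Prime] {k : Type u} [Field k] [CharP k p] [PerfectRing k p]
variable {R : Type u} [CommRing R] [HopfAlgebra k R] [Module.Finite k R]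

variable (p k R) in
/-- The `W(k)`-module of truncated Witt vectors over `R`. -/
abbrev truncatedWittModule (n : ℕ) : Module (WittVector p k) (TruncatedWittVector p n R) :=
  Module.compHom _ ((WittVector.truncate n).comp (wittAlgebraMap p k R))

theorem coeff_add_of_forall_lt {B : Type*} [CommRing B] {n : ℕ} {u v : WittVector p B}
    (hu : ∀ i < n, u.coeff i = 0) (hv : ∀ i < n, v.coeff i = 0) :
    (u + v).coeff n = u.coeff n + v.coeff n := by
  have h := wittPhi_shift (p := p) 0 n hu hv
  rw [zero_add, wittPhi_eq_coeff, wittPhi_eq_coeff, WittVector.add_coeff_zero,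
    WittVector.coeff_mk, WittVector.coeff_mk, zero_add] at h
  exact h

/-- The Witt vectors of length `n` over a finite-dimensional algebra `R` have finite length over
`W(k)`: the kernel of a truncation map from length `n + 1` to length `n` is a Frobenius twist
of `R`. -/
theorem isFiniteLength_truncated (n : ℕ) :
    letI := truncatedWittModule p k R n
    IsFiniteLength (WittVector p k) (TruncatedWittVector p n R) := by
  induction n with
  | zero =>
    let := truncatedWittModule p k R 0
    have : Subsingleton (TruncatedWittVector p 0 R) := ⟨fun a b => TruncatedWittVector.ext
      fun i => i.elim0⟩
    exact .of_subsingleton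
  | succ n ih =>
    let i₁ := truncatedWittModule p k R n
    let i₂ := truncatedWittModule p k R (n + 1)
    let g : TruncatedWittVector p (n + 1) R →ₗ[WittVector p k] TruncatedWittVector p n R :=
      { TruncatedWittVector.truncate (Nat.le_succ n) with
        map_smul' := fun c u => by
          refine (map_mul (TruncatedWittVector.truncate (Nat.le_succ n)) _ _).trans ?_
          change TruncatedWittVector.truncate (Nat.le_succ n)
            (WittVector.truncate (p := p) (n + 1) (wittAlgebraMap p k R c)) * _ =
            WittVector.truncate (p := p) n (wittAlgebraMap p k R c) * _
          rw [TruncatedWittVector.truncate_wittVector_truncate]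
          rfl }
    have hg : ∀ w, g (WittVector.truncate (n + 1) w) = WittVector.truncate n w := fun w =>
      TruncatedWittVector.truncate_wittVector_truncate (Nat.le_succ n) w
    have hker : ∀ w : WittVector p R, WittVector.truncate (n + 1) w ∈ LinearMap.ker g →
        ∀ i < n, w.coeff i = 0 := by
      intro w hw i hi
      rw [LinearMap.mem_ker, hg] at hw
      exact (WittVector.mem_ker_truncate n w).1 hw i hi
    have hK : IsFiniteLength (WittVector p k) (LinearMap.ker g) := by
      refine isFiniteLength_of_injective (S' := k) (M' := R)
        { toFun := fun u => u.1.coeff (Fin.last n)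
          map_zero' := TruncatedWittVector.coeff_zero p (n + 1) R (Fin.last n)
          map_add' := ?_ } ?_ ?_ ?_
      · rintro ⟨u, hu⟩ ⟨v, hv⟩
        obtain ⟨u, rfl⟩ := WittVector.truncate_surjective p (n + 1) R u
        obtain ⟨v, rfl⟩ := WittVector.truncate_surjective p (n + 1) R v
        change (WittVector.truncate (n + 1) u + WittVector.truncate (n + 1) v).coeff _ = _
        rw [← map_add, WittVector.coeff_truncate, WittVector.coeff_truncate,
          WittVector.coeff_truncate]
        exact coeff_add_of_forall_lt (hker u hu) (hker v hv)
      · rintro ⟨u, hu⟩ ⟨v, hv⟩ huv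
        obtain ⟨u, rfl⟩ := WittVector.truncate_surjective p (n + 1) R u
        obtain ⟨v, rfl⟩ := WittVector.truncate_surjective p (n + 1) R v
        change (WittVector.truncate (n + 1) u).coeff _ = (WittVector.truncate (n + 1) v).coeff _
          at huv
        rw [WittVector.coeff_truncate, WittVector.coeff_truncate] at huv
        refine Subtype.ext (truncate_eq_iff.2 fun i hi => ?_)
        rcases hi.lt_or_eq with h | rfl
        · rw [hker u hu i h, hker v hv i h]
        · exact huv
      · intro c
        refine ⟨WittVector.teichmuller p ((iterateFrobeniusEquiv k p n).symm c), ?_⟩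
        rintro ⟨u, hu⟩
        obtain ⟨u, rfl⟩ := WittVector.truncate_surjective p (n + 1) R u
        change (WittVector.truncate (n + 1) (wittAlgebraMap p k R _) *
          WittVector.truncate (n + 1) u).coeff _ = c • (WittVector.truncate (n + 1) u).coeff _
        rw [← map_mul, WittVector.coeff_truncate, WittVector.coeff_truncate, wittAlgebraMap,
          WittVector.map_teichmuller, teichmuller_mul_coeff, Algebra.smul_def, ← map_pow]
        congr 2
        exact (iterateFrobeniusEquiv k p n).apply_symm_apply c
      · rw [isFiniteLength_iff_isNoetherian_isArtinian]
        exact ⟨inferInstance, inferInstance⟩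
    rw [isFiniteLength_iff_isNoetherian_isArtinian] at hK ih ⊢
    obtain ⟨_, _⟩ := hK
    obtain ⟨_, _⟩ := ih
    exact ⟨isNoetherian_of_range_eq_ker (LinearMap.ker g).subtype g (Submodule.range_subtype _),
      isArtinian_of_range_eq_ker (LinearMap.ker g).subtype g (Submodule.range_subtype _)⟩

variable [Coalgebra.IsCocomm k R]

theorem LevelModule.isFiniteLength (j : ℕ) {n : ℕ} (hV : VerschiebungPowZero p k R (n + 1)) :
    IsFiniteLengthOverWitt p k (LevelModule j hV) := by
  let := truncatedWittModule p k R (n + 1)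
  let : Module (WittVector p k) (LevelModule j hV) :=
    Module.compHom (LevelModule j hV) (DieudonneRing.ofWitt p k)
  refine isFiniteLength_of_injective (S' := WittVector p k) (toTruncated j hV)
    toTruncated_injective (fun c => ⟨(WittVector.frobeniusEquiv p k)^[j] c, fun x => ?_⟩)
    (isFiniteLength_truncated (n + 1))
  change toTruncated j hV (DieudonneRing.ofWitt p k ((WittVector.frobeniusEquiv p k)^[j] c) • x) = _
  rw [ofWitt_smul, untwist_iterate, toTruncated_scalarEnd]
  rfl

end FiniteLength

section LevelIndependence

variable {p : ℕ} [Fact p.Prime] {k : Type u} [Field k] [CharP k p] [PerfectRing k p]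
variable {R : Type u} [CommRing R] [HopfAlgebra k R] [Coalgebra.IsCocomm k R] [Module.Finite k R]

theorem VerschiebungPowZero.mono {N M : ℕ} (h : VerschiebungPowZero p k R N) (hNM : N ≤ M) :
    VerschiebungPowZero p k R M := fun _ hx => h.eq_zero hx hNM

theorem wittVec_mem_of_mem {n : ℕ} (hV : VerschiebungPowZero p k R (n + 1)) {x : R}
    (hx : x ∈ dieudonneElements p k R) : wittVec p k n x ∈ primitiveWitt p k R n :=
  ((mem_dieudonneElements_iff hV).1 hx).wittVec_mem (hV _ ((mem_dieudonneElements_iff hV).1 hx).1)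

theorem iterate_frobeniusEquiv_coeff (d : ℕ) (c : WittVector p k) (i : ℕ) :
    ((WittVector.frobeniusEquiv p k)^[d] c).coeff i = c.coeff i ^ p ^ d :=
  WittVector.iterate_frobenius_coeff c d i

theorem dotSMul_add {n : ℕ} (d : ℕ) (hn : VerschiebungPowZero p k R (n + 1)) {x : R}
    (hx : x ∈ dieudonneElements p k R) (c : WittVector p k) :
    dotSMul p k (n + d) c x = dotSMul p k n ((WittVector.frobeniusEquiv p k)^[d] c) x := by
  have := charP_of_hopfAlgebra p k R
  have hx0 := ((mem_dieudonneElements_iff hn).1 hx).1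
  have e : wittVec p k (n + d) x = WittVector.verschiebung^[d] (wittVec p k n x) := by
    refine (mk_eq_iterate_verschiebung d fun a ha => hn.eq_zero hx0 (by omega)).trans ?_
    simp only [Nat.add_sub_add_right]
    rfl
  have e' : WittVector.frobenius^[d] (wittAlgebraMap p k R c) =
      wittAlgebraMap p k R ((WittVector.frobeniusEquiv p k)^[d] c) := by
    ext i
    simp only [wittAlgebraMap, WittVector.iterate_frobenius_coeff, WittVector.map_coeff,
      iterate_frobeniusEquiv_coeff, map_pow]
  rw [dotSMul_eq (wittVec_mem_of_mem (hn.mono (by omega)) hx),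
    dotSMul_eq (wittVec_mem_of_mem hn hx), e, mul_comm, WittVector.iterate_verschiebung_mul_left,
    WittVector.iterate_verschiebung_coeff, e', mul_comm]

/-- After the normalisation by `σ^n`, the action of `W(k)` does not depend on the level `n`. -/
theorem dotSMul_level {n m : ℕ} (hn : VerschiebungPowZero p k R (n + 1))
    (hm : VerschiebungPowZero p k R (m + 1)) {x : R} (hx : x ∈ dieudonneElements p k R)
    {c d : WittVector p k}
    (h : (WittVector.frobeniusEquiv p k)^[n] c = (WittVector.frobeniusEquiv p k)^[m] d) :
    dotSMul p k n c x = dotSMul p k m d x := by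
  rcases le_total n m with hnm | hnm
  · obtain ⟨r, rfl⟩ := Nat.exists_eq_add_of_le hnm
    rw [Function.iterate_add_apply] at h
    rw [dotSMul_add r hn hx, (WittVector.frobeniusEquiv p k).injective.iterate n h]
  · obtain ⟨r, rfl⟩ := Nat.exists_eq_add_of_le hnm
    rw [Function.iterate_add_apply] at h
    rw [dotSMul_add r hm hx, ← (WittVector.frobeniusEquiv p k).injective.iterate m h]

theorem IsDieudonneModule.level {n m : ℕ} (hn : VerschiebungPowZero p k R (n + 1))
    (hm : VerschiebungPowZero p k R (m + 1)) {M : Type u} [AddCommGroup M]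
    [Module (DieudonneRing p k) M] {e : M ≃ dieudonneElements p k R}
    (h : IsDieudonneModule p k R n n e) : IsDieudonneModule p k R m m e where
  add x y := (h.add x y).trans (dotAdd_level hn hm ((mem_dieudonneElements_iff hn).1 (e x).2).1
    ((mem_dieudonneElements_iff hn).1 (e y).2).1)
  zero := h.zero
  neg := h.neg
  neg_of_odd := h.neg_of_odd
  smul c x := by
    obtain ⟨d, hd⟩ := (WittVector.frobeniusEquiv p k).surjective.iterate n
      ((WittVector.frobeniusEquiv p k)^[m] c)
    rw [← hd, h.smul, dotSMul_level hn hm (e x).2 hd]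
  F_smul := h.F_smul
  V_smul := h.V_smul

end LevelIndependence

section Functoriality

variable {p : ℕ} [Fact p.Prime] {k : Type u} [Field k] [CharP k p] [PerfectRing k p]
variable {R : Type u} [CommRing R] [HopfAlgebra k R] [Coalgebra.IsCocomm k R] [Module.Finite k R]
variable {R' : Type u} [CommRing R'] [HopfAlgebra k R'] [Coalgebra.IsCocomm k R']
  [Module.Finite k R']

theorem bialgHom_iterate_verschiebung (g : R' →ₐc[k] R) (j : ℕ) (x : R') :
    g ((verschiebung p k)^[j] x) = (verschiebung p k)^[j] (g x) :=
  map_iterate_verschiebung (g : R' →ₗc[k] R) j x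

theorem IsDieudonneElement.map {n : ℕ} {x : R'} (h : IsDieudonneElement p k n x)
    (g : R' →ₐc[k] R) : IsDieudonneElement p k n (g x) := by
  refine ⟨(CoalgHomClass.counit_comp_apply g x).trans h.1, ?_⟩
  refine (CoalgHomClass.map_comp_comul_apply g x).symm.trans ?_
  rw [h.2]
  refine (map_wittPhi (Algebra.TensorProduct.map (g : R' →ₐ[k] R) (g : R' →ₐ[k] R)) n _ _).trans ?_
  simp [bialgHom_iterate_verschiebung]

theorem map_dotAdd_bialgHom (g : R' →ₐc[k] R) (n : ℕ) (x y : R') :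
    g (dotAdd p k n x y) = dotAdd p k n (g x) (g y) := by
  unfold dotAdd
  rw [map_wittPhi]
  simp only [bialgHom_iterate_verschiebung]

theorem map_dotSMul (g : R' →ₐc[k] R) (n : ℕ) (c : WittVector p k) (x : R') :
    g (dotSMul p k n c x) = dotSMul p k n c (g x) := by
  have h : ∀ i, g (dotSMulAux p k n c x i) = dotSMulAux p k n c (g x) i := by
    intro i
    induction i with
    | zero => exact map_smul g _ _
    | succ i ih =>
      rw [dotSMulAux, dotSMulAux, map_dotAdd_bialgHom, ih, map_smul, map_pow,
        bialgHom_iterate_verschiebung]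
  exact h n

/-- `f^*` is linear over the Dieudonné ring for module structures at a common level. -/
theorem exists_linearMap {j n : ℕ} (hn : VerschiebungPowZero p k R (n + 1))
    (hn' : VerschiebungPowZero p k R' (n + 1)) (g : R' →ₐc[k] R) {M M' : Type u} [AddCommGroup M]
    [Module (DieudonneRing p k) M] [AddCommGroup M'] [Module (DieudonneRing p k) M']
    {e : M ≃ dieudonneElements p k R} {e' : M' ≃ dieudonneElements p k R'}
    (he : IsDieudonneModule p k R j n e) (he' : IsDieudonneModule p k R' j n e') :
    ∃ φ : M' →ₗ[DieudonneRing p k] M, ∀ x, (e (φ x) : R) = g (e' x : R') := by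
  have hg : ∀ x : dieudonneElements p k R', g x ∈ dieudonneElements p k R := fun x =>
    (mem_dieudonneElements_iff hn).2 (((mem_dieudonneElements_iff hn').1 x.2).map g)
  let φ : M' → M := fun x => e.symm ⟨g (e' x), hg _⟩
  have hφ : ∀ x, (e (φ x) : R) = g (e' x : R') := fun x => by simp [φ]
  have hext : ∀ {x y : M}, (e x : R) = e y → x = y := fun h => e.injective (Subtype.ext h)
  refine ⟨DieudonneRing.linearMapOfGenerators
    { toFun := φ
      map_zero' := hext (by rw [hφ, he.zero, he'.zero, map_zero])
      map_add' := fun x y => hext (by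
        rw [hφ, he.add, he'.add, map_dotAdd_bialgHom, hφ, hφ]) }
    (fun x => hext ?_) (fun x => hext ?_) (fun a x => hext ?_), hφ⟩
  · refine (hφ _).trans ?_
    rw [he'.F_smul, map_pow, he.F_smul]
    exact congrArg (· ^ p) (hφ x).symm
  · refine (hφ _).trans ?_
    rw [he'.V_smul, he.V_smul]
    refine (bialgHom_iterate_verschiebung g 1 _).trans ?_
    exact congrArg (verschiebung p k) (hφ x).symm
  · obtain ⟨c, rfl⟩ := (WittVector.frobeniusEquiv p k).surjective.iterate j a
    refine (hφ _).trans ?_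
    rw [he'.smul, he.smul, map_dotSMul]
    exact congrArg (dotSMul p k n c) (hφ x).symm

theorem smul_mem_dieudonneElements {n : ℕ} (hV : VerschiebungPowZero p k R (n + 1)) (c : k)
    (x : LevelModule 0 hV) : c • x.val = (DieudonneRing.ofWitt p k (WittVector.teichmuller p
      ((iterateFrobeniusEquiv k p n).symm c)) • x).val := by
  rw [LevelModule.ofWitt_smul, LevelModule.val_scalarEnd]
  have h := verschiebung_teichmuller_mul_wittVec_coeff (Nat.zero_le n)
    ((iterateFrobeniusEquiv k p n).symm c) x.val
  refine Eq.trans ?_ h.symm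
  have hc : ((iterateFrobeniusEquiv k p n).symm c) ^ p ^ n = c :=
    (iterateFrobeniusEquiv k p n).apply_symm_apply c
  simp [hc]

end Functoriality

/-! ### Infinitesimal duals and nilpotency of the Verschiebung -/

section Local

/-- An augmented algebra with nil augmentation ideal is local. -/
theorem isLocalRing_of_isNilpotent {k A : Type*} [Field k] [CommRing A] [Algebra k A]
    (ε : A →ₐ[k] k) (h : ∀ a, ε a = 0 → IsNilpotent a) : IsLocalRing A := by
  have : IsLocalHom (ε : A →+* k) := ⟨fun a ha => by
    have h₁ : IsNilpotent (a - algebraMap k A (ε a)) := h _ (by simp)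
    have h₂ : IsUnit (algebraMap k A (ε a)) := ha.map _
    rw [← add_sub_cancel (algebraMap k A (ε a)) a]
    exact h₁.isUnit_add_left_of_commute h₂ (Commute.all _ _)⟩
  exact RingHom.domain_isLocalRing (ε : A →+* k)

section Augmented

variable {k A : Type*} [Field k] [CommRing A] [Algebra k A] [IsLocalRing A] (ε : A →ₐ[k] k)

include ε in
theorem mem_maximalIdeal_iff {a : A} : a ∈ IsLocalRing.maximalIdeal A ↔ ε a = 0 := by
  have h : RingHom.ker ε = IsLocalRing.maximalIdeal A :=
    IsLocalRing.eq_maximalIdeal (RingHom.ker_isMaximal_of_surjective ε fun c =>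
      ⟨algebraMap k A c, ε.commutes c⟩)
  rw [← h, RingHom.mem_ker]

theorem isUnit_iff_augmentation_ne_zero {a : A} : IsUnit a ↔ ε a ≠ 0 := by
  rw [Ne, ← mem_maximalIdeal_iff ε, IsLocalRing.mem_maximalIdeal, mem_nonunits_iff, not_not]

theorem exists_maximalIdeal_pow_eq_bot (k A : Type*) [Field k] [CommRing A] [Algebra k A]
    [IsLocalRing A] [Module.Finite k A] : ∃ N, IsLocalRing.maximalIdeal A ^ N = ⊥ := by
  have : IsArtinianRing A := IsArtinianRing.of_finite k A
  have := IsArtinianRing.isNilpotent_jacobson_bot (R := A)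
  rwa [IsLocalRing.jacobson_eq_maximalIdeal _ bot_ne_top] at this

end Augmented

variable {k : Type u} [Field k] {R : Type u} [CommRing R] [HopfAlgebra k R]

variable (k R) in
/-- The augmentation `λ ↦ λ(1)` of the algebra dual to `R`. -/
def dualAugmentation : WithConv (R →ₗ[k] k) →ₐ[k] k :=
  AlgHom.ofLinearMap
    { toFun := fun l => l.ofConv 1
      map_add' := fun _ _ => rfl
      map_smul' := fun _ _ => rfl }
    (by
      change (1 : WithConv (R →ₗ[k] k)).ofConv 1 = 1
      simp [LinearMap.convOne_def])
    (fun l l' => by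
      change (l * l') 1 = l 1 * l' 1
      rw [LinearMap.convMul_apply, Bialgebra.comul_one, Algebra.TensorProduct.one_def]
      simp)

theorem dualAugmentation_apply (l : WithConv (R →ₗ[k] k)) :
    dualAugmentation k R l = l.ofConv 1 := rfl

theorem sub_algebraMap_apply_one (l : WithConv (R →ₗ[k] k)) :
    (l - algebraMap k _ (l.ofConv 1)).ofConv 1 = 0 := by
  rw [← dualAugmentation_apply, map_sub, AlgHom.commutes]
  exact sub_self _

variable [Coalgebra.IsCocomm k R] [Module.Finite k R]

/-- The Verschiebung of a finite group scheme with infinitesimal dual is nilpotent. -/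
theorem exists_verschiebungPowZero (p : ℕ) [Fact p.Prime] [CharP k p] [PerfectRing k p]
    [IsLocalRing (WithConv (R →ₗ[k] k))] : ∃ n, VerschiebungPowZero p k R (n + 1) := by
  have : Module.Finite k (WithConv (R →ₗ[k] k)) :=
    Module.Finite.equiv (WithConv.linearEquiv k (R →ₗ[k] k)).symm
  obtain ⟨N, hN⟩ := exists_maximalIdeal_pow_eq_bot k (WithConv (R →ₗ[k] k))
  refine ⟨N, fun x hx => (Module.forall_dual_apply_eq_zero_iff k _).1 fun l => ?_⟩
  have hle : N ≤ p ^ (N + 1) :=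
    (Nat.le_succ N).trans (Nat.lt_pow_self (Fact.out : p.Prime).one_lt).le
  set l' : WithConv (R →ₗ[k] k) := WithConv.toConv l - algebraMap k _ (l 1) with hl'
  have h0 : l' ^ p ^ (N + 1) = 0 := by
    have hm : l' ∈ IsLocalRing.maximalIdeal (WithConv (R →ₗ[k] k)) := by
      rw [mem_maximalIdeal_iff (dualAugmentation k R), hl', map_sub, AlgHom.commutes]
      exact sub_self _
    have := Ideal.pow_mem_pow hm N
    rw [hN] at this
    exact pow_eq_zero_of_le hle this
  have h1 : WithConv.toConv l = l' + algebraMap k _ (l 1) := by rw [hl', sub_add_cancel]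
  have h2 := apply_iterate_verschiebung (p := p) l (N + 1) x
  rw [h1, add_pow_char_pow_algebra (k := k), h0, zero_add, ← map_pow (algebraMap k _),
    Algebra.algebraMap_eq_smul_one] at h2
  have h3 : ((l 1 ^ p ^ (N + 1)) • (1 : WithConv (R →ₗ[k] k))).ofConv x = 0 := by
    simp [LinearMap.convOne_def, hx]
  rw [h3] at h2
  exact eq_zero_of_pow_eq_zero h2

variable {p : ℕ} [Fact p.Prime] [CharP k p] [PerfectRing k p]

/-- The dual of a finite group scheme with nilpotent Verschiebung is infinitesimal. -/
theorem isLocalRing_dual_of_verschiebungPowZero {N : ℕ} (h : VerschiebungPowZero p k R N) :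
    IsLocalRing (WithConv (R →ₗ[k] k)) := by
  refine isLocalRing_of_isNilpotent (dualAugmentation k R) fun l hl => ⟨p ^ N, ?_⟩
  rw [dualAugmentation_apply] at hl
  refine WithConv.ofConv_injective (LinearMap.ext fun x => ?_)
  refine (apply_iterate_verschiebung (p := p) l.ofConv N x).symm.trans ?_
  set c := Coalgebra.counit (R := k) x
  obtain ⟨d, hd⟩ := (iterateFrobeniusEquiv k p N).surjective c
  have hd : d ^ p ^ N = c := hd
  have hx : (verschiebung p k)^[N] x = d • 1 := by
    have h1 : x = (x - c • 1) + d ^ p ^ N • 1 := by rw [hd, sub_add_cancel]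
    have h2 : (verschiebung p k)^[N] (x - c • 1) = 0 := h _ (by simp [c])
    have h3 : ∀ a b : R, (verschiebung p k)^[N] (a + b) =
        (verschiebung p k)^[N] a + (verschiebung p k)^[N] b :=
      (iterate_map_add (verschiebungHom p k R) N)
    have h4 : (verschiebung p k)^[N] (1 : R) = 1 := iterate_map_one (verschiebungHom p k R) N
    rw [h1, h3, h2, zero_add, iterate_verschiebung_smul, h4]
  rw [hx, map_smul, hl, smul_zero, zero_pow (pow_ne_zero _ (Fact.out : p.Prime).ne_zero)]
  rfl

end Local

section Surjective

variable {k : Type u} [Field k] {R : Type u} [CommRing R] [HopfAlgebra k R]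
  [Coalgebra.IsCocomm k R] {R' : Type u} [CommRing R'] [HopfAlgebra k R']

theorem isCocomm_of_surjective (π : R →ₐc[k] R') (hπ : Function.Surjective π) :
    Coalgebra.IsCocomm k R' := by
  refine ⟨LinearMap.ext fun y => ?_⟩
  obtain ⟨x, rfl⟩ := hπ y
  change TensorProduct.comm k R' R' _ = _
  rw [← CoalgHomClass.map_comp_comul_apply π x, ← TensorProduct.map_comm, Coalgebra.comm_comul]

variable [Coalgebra.IsCocomm k R'] [Module.Finite k R] [Module.Finite k R']
  {p : ℕ} [Fact p.Prime] [CharP k p] [PerfectRing k p]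

theorem VerschiebungPowZero.of_surjective (π : R →ₐc[k] R') (hπ : Function.Surjective π) {N : ℕ}
    (h : VerschiebungPowZero p k R N) : VerschiebungPowZero p k R' N := by
  intro y hy
  obtain ⟨x, rfl⟩ := hπ y
  rw [← bialgHom_iterate_verschiebung, h x, map_zero]
  rw [← hy]
  exact (CoalgHomClass.counit_comp_apply π x).symm

end Surjective

section Primitive

variable {k : Type u} [Field k] {R : Type u} [CommRing R] [HopfAlgebra k R]

theorem counit_eq_zero_of_mem_alphaModule {x : R} (hx : x ∈ alphaModule k R) :
    Coalgebra.counit (R := k) x = 0 := by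
  have h := Coalgebra.rTensor_counit_comul (R := k) x
  rw [show Coalgebra.comul (R := k) x = _ from hx] at h
  simp only [map_add, LinearMap.rTensor_tmul, Bialgebra.counit_one] at h
  have h' := congrArg (Coalgebra.counit (R := k)) (congrArg (TensorProduct.lid k R) h)
  simpa using h'

theorem convPow_apply_of_mem_alphaModule {x : R} (hx : x ∈ alphaModule k R) (l : R →ₗ[k] k)
    (r : ℕ) : ((WithConv.toConv l) ^ (r + 1)).ofConv x = (r + 1) * l 1 ^ r * l x := by
  induction r with
  | zero => simp
  | succ r ih =>
    rw [pow_succ]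
    change ((WithConv.toConv l ^ (r + 1)) * WithConv.toConv l) x = _
    rw [LinearMap.convMul_apply, show Coalgebra.comul (R := k) x = _ from hx]
    have h1 := one_convPow l (r + 1)
    have : ((WithConv.toConv l ^ (r + 1)).ofConv x * l 1 +
      (WithConv.toConv l ^ (r + 1)).ofConv 1 * l x) = (↑(r + 1) + 1) * l 1 ^ (r + 1) * l x := by
      rw [ih, h1]
      push_cast
      ring
    simpa using this

variable [Coalgebra.IsCocomm k R] [Module.Finite k R]
  {p : ℕ} [Fact p.Prime] [CharP k p] [PerfectRing k p]

theorem verschiebung_eq_zero_of_mem_alphaModule {x : R} (hx : x ∈ alphaModule k R) :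
    verschiebung p k x = 0 := by
  refine verschiebung_unique fun l => ?_
  obtain ⟨r, hr⟩ := Nat.exists_eq_succ_of_ne_zero (Fact.out : p.Prime).ne_zero
  have h := convPow_apply_of_mem_alphaModule hx l r
  have h0 : ((r : k) + 1) = 0 := by
    rw [← Nat.cast_succ, ← hr, CharP.cast_eq_zero]
  rw [h0, zero_mul, zero_mul, ← Nat.succ_eq_add_one, ← hr] at h
  rw [h, map_zero, zero_pow (Fact.out : p.Prime).ne_zero]

end Primitive

/-! ### Quotients by Hopf ideals and α-groups -/

section QuotientLift

variable {k : Type u} [Field k] {A B : Type u} [CommRing A] [HopfAlgebra k A] [CommRing B]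
  [HopfAlgebra k B]

/-- The homomorphism of Hopf algebras induced on the quotient by a Hopf ideal. -/
def quotientLift (I : Ideal A) [I.IsHopfIdeal k] (f : A →ₐc[k] B) (h : ∀ a ∈ I, f a = 0) :
    A ⧸ I →ₐc[k] B :=
  BialgHom.ofAlgHom (Ideal.Quotient.liftₐ I (f : A →ₐ[k] B) h)
    (Ideal.Quotient.algHom_ext _ (AlgHom.ext fun a => CoalgHomClass.counit_comp_apply f a))
    (Ideal.Quotient.algHom_ext _ (AlgHom.ext fun a => by
      refine Eq.trans ?_ (CoalgHomClass.map_comp_comul_apply f a)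
      change Algebra.TensorProduct.map (Ideal.Quotient.liftₐ I (f : A →ₐ[k] B) h)
        (Ideal.Quotient.liftₐ I (f : A →ₐ[k] B) h) (Algebra.TensorProduct.map
        (Ideal.Quotient.mkₐ k I) (Ideal.Quotient.mkₐ k I) (Coalgebra.comul a)) = _
      rw [← AlgHom.comp_apply, ← Algebra.TensorProduct.map_comp]
      rfl))

/-- A homomorphism of Hopf algebras kills the ideal of `G[F^N]` if its image does so. -/
theorem map_eq_zero_of_mem_frobKernelIdeal {p : ℕ} [Fact p.Prime] [CharP k p] {N : ℕ}
    (f : A →ₐc[k] B)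
    (h : ∀ a, f a ^ p ^ N = algebraMap k B (Coalgebra.counit (R := k) a) ^ p ^ N) :
    ∀ a ∈ frobKernelIdeal p k A N, f a = 0 := by
  have : frobKernelIdeal p k A N ≤ RingHom.ker (f : A →ₐ[k] B) := by
    refine Ideal.span_le.2 ?_
    rintro _ ⟨x, hx, rfl⟩
    change f (x ^ p ^ N) = 0
    rw [map_pow, h, hx, map_zero, zero_pow (pow_ne_zero _ (Fact.out : p.Prime).ne_zero)]
  exact this

/-- The `p^N`-th power of an algebra homomorphism from a polynomial ring is determined by the
`p^N`-th powers of the images of the variables. -/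
theorem map_pow_eq_of_X_pow_eq_zero {σ B : Type*} [CommRing B] [Algebra k B] {p : ℕ}
    [Fact p.Prime] [CharP k p] {N : ℕ}
    (f : MvPolynomial σ k →ₐ[k] B) (hf : ∀ i, f (MvPolynomial.X i) ^ p ^ N = 0)
    (P : MvPolynomial σ k) :
    f P ^ p ^ N = algebraMap k B (MvPolynomial.aeval (fun _ => (0 : k)) P) ^ p ^ N := by
  induction P using MvPolynomial.induction_on with
  | C a => rw [MvPolynomial.aeval_C, ← MvPolynomial.algebraMap_eq, AlgHom.commutes]; rfl
  | add P Q hP hQ =>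
    rw [map_add, add_pow_char_pow_algebra (k := k), hP, hQ, ← add_pow_char_pow_algebra (k := k),
      ← map_add, ← map_add]
  | mul_X P i _ =>
    rw [map_mul, mul_pow, hf, mul_zero, map_mul, MvPolynomial.aeval_X, mul_zero, map_zero,
      zero_pow (pow_ne_zero _ (Fact.out : p.Prime).ne_zero)]

end QuotientLift

section Alpha

variable {k : Type u} [Field k] {R : Type u} [CommRing R] [HopfAlgebra k R]

/-- Primitive elements of `R` are the homomorphisms from `Spec R` to the additive group. -/
def addHopfLift {r : ℕ} (x : Fin r → R) (hx : ∀ i, x i ∈ alphaModule k R) :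
    AddHopf r k →ₐc[k] R :=
  BialgHom.ofAlgHom (AddHopf.lift x)
    (AddHopf.hom_ext fun i => by
      change Coalgebra.counit (R := k) (AddHopf.lift x (AddHopf.t r k i)) =
        AddHopf.counitHom r k (AddHopf.t r k i)
      rw [AddHopf.lift_t x, counit_eq_zero_of_mem_alphaModule (hx i)]
      exact (AddHopf.lift_t (fun _ => (0 : k)) i).symm)
    (AddHopf.hom_ext fun i => by
      change Algebra.TensorProduct.map (AddHopf.lift x : AddHopf r k →ₐ[k] R)
        (AddHopf.lift x : AddHopf r k →ₐ[k] R) (AddHopf.comulHom r k (AddHopf.t r k i)) =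
        Coalgebra.comul (R := k) (AddHopf.lift x (AddHopf.t r k i))
      rw [AddHopf.lift_t x, show Coalgebra.comul (R := k) (x i) = _ from hx i]
      refine (congrArg _ (AddHopf.lift_t _ i)).trans ?_
      simp)

variable {p : ℕ} [Fact p.Prime] [CharP k p]

/-- Primitive elements of `R` with vanishing `p`-th power are the homomorphisms from `Spec R`
to `α_p`. -/
def alphaLift {r : ℕ} (x : Fin r → R) (hx : ∀ i, x i ∈ alphaModule k R) (hxp : ∀ i, x i ^ p = 0) :
    AlphaHopf p k r →ₐc[k] R :=
  quotientLift _ (addHopfLift x hx) (map_eq_zero_of_mem_frobKernelIdeal _ fun a =>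
    map_pow_eq_of_X_pow_eq_zero (MvPolynomial.aeval x) (fun i => by
      rw [MvPolynomial.aeval_X, pow_one, hxp]) a)

theorem alphaLift_mk {r : ℕ} (x : Fin r → R) (hx : ∀ i, x i ∈ alphaModule k R)
    (hxp : ∀ i, x i ^ p = 0) (i : Fin r) :
    alphaLift x hx hxp (Ideal.Quotient.mk _ (AddHopf.t r k i)) = x i :=
  AddHopf.lift_t x i

theorem alphaLift_alphaCoord (x : Fin 1 → R) (hx : ∀ i, x i ∈ alphaModule k R)
    (hxp : ∀ i, x i ^ p = 0) : alphaLift x hx hxp (alphaCoord p k) = x 0 := alphaLift_mk x hx hxp 0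

variable (k) in
theorem AddHopf.t_mem_alphaModule {r : ℕ} (i : Fin r) : AddHopf.t r k i ∈ alphaModule k _ :=
  AddHopf.lift_t _ i

instance (r : ℕ) : Coalgebra.IsCocomm k (AddHopf r k) := by
  have h : ((Algebra.TensorProduct.comm k (AddHopf r k) (AddHopf r k)).toAlgHom.comp
      (AddHopf.comulHom r k)) = AddHopf.comulHom r k := by
    refine AddHopf.hom_ext fun i => ?_
    rw [AlgHom.comp_apply]
    have : AddHopf.comulHom r k (AddHopf.t r k i) = _ := AddHopf.lift_t _ i
    rw [this, map_add, add_comm]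
    rfl
  exact ⟨LinearMap.ext fun x => DFunLike.congr_fun h x⟩

theorem mem_alphaModule_map {R' : Type u} [CommRing R'] [HopfAlgebra k R'] (f : R →ₐc[k] R') {x : R}
    (hx : x ∈ alphaModule k R) : f x ∈ alphaModule k R' := by
  refine (CoalgHomClass.map_comp_comul_apply f x).symm.trans ?_
  rw [show Coalgebra.comul (R := k) x = _ from hx]
  simp

namespace AlphaHopf

variable (r : ℕ)

/-- The coordinates of `α_p^r`. -/
def t (p : ℕ) [Fact p.Prime] (k : Type u) [Field k] [CharP k p] (r : ℕ) (i : Fin r) :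
    AlphaHopf p k r := Ideal.Quotient.mk _ (AddHopf.t r k i)

theorem t_mem_alphaModule (i : Fin r) : t p k r i ∈ alphaModule k (AlphaHopf p k r) :=
  mem_alphaModule_map (Bialgebra.Quotient.mkBialgHom (frobKernelIdeal p k (AddHopf r k) 1))
    (AddHopf.t_mem_alphaModule k i)

instance : Coalgebra.IsCocomm k (AlphaHopf p k r) :=
  isCocomm_of_surjective (Bialgebra.Quotient.mkBialgHom _) Ideal.Quotient.mk_surjective

theorem pow_eq_zero {x : AlphaHopf p k r} (hx : Coalgebra.counit (R := k) x = 0) : x ^ p = 0 := by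
  obtain ⟨y, rfl⟩ := Ideal.Quotient.mk_surjective x
  rw [← map_pow, Ideal.Quotient.eq_zero_iff_mem]
  exact Ideal.subset_span ⟨y, hx, by rw [pow_one]⟩

instance : Module.Finite k (AlphaHopf p k r) := by
  have : Algebra.FiniteType k (AddHopf r k) :=
    inferInstanceAs (Algebra.FiniteType k (MvPolynomial (Fin r) k))
  have : Algebra.FiniteType k (AlphaHopf p k r) :=
    .of_surjective (Ideal.Quotient.mkₐ k _) Ideal.Quotient.mk_surjective
  have : Algebra.IsIntegral k (AlphaHopf p k r) := ⟨fun x => by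
    have h := pow_eq_zero r (x := x - algebraMap k _ (Coalgebra.counit (R := k) x)) (by simp)
    have h' : IsIntegral k (x - algebraMap k _ (Coalgebra.counit (R := k) x)) :=
      .of_pow (Fact.out : p.Prime).pos (by rw [h]; exact isIntegral_zero)
    rw [← sub_add_cancel x (algebraMap k _ (Coalgebra.counit (R := k) x))]
    exact h'.add isIntegral_algebraMap⟩
  exact Algebra.IsIntegral.finite

instance : IsLocalRing (AlphaHopf p k r) :=
  isLocalRing_of_isNilpotent (Bialgebra.counitAlgHom k _) fun _ hx => ⟨p, pow_eq_zero r hx⟩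

theorem verschiebungPowZero [PerfectRing k p] : VerschiebungPowZero p k (AlphaHopf p k r) 1 := by
  have h : ∀ P : MvPolynomial (Fin r) k, ∃ c : k, verschiebung p k
      (Ideal.Quotient.mk (frobKernelIdeal p k (AddHopf r k) 1) P : AlphaHopf p k r) =
        algebraMap k _ c := by
    intro P
    induction P using MvPolynomial.induction_on with
    | C a =>
      obtain ⟨c, rfl⟩ := (frobeniusEquiv k p).surjective a
      refine ⟨c, ?_⟩
      have := verschiebung_smul (p := p) c (1 : AlphaHopf p k r)
      rw [verschiebung_one, ← Algebra.algebraMap_eq_smul_one, ← Algebra.algebraMap_eq_smul_one]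
        at this
      exact this
    | add P Q hP hQ =>
      obtain ⟨c, hc⟩ := hP
      obtain ⟨d, hd⟩ := hQ
      refine ⟨c + d, ?_⟩
      rw [map_add, ← hc, ← hd, ← verschiebung_add]
      rfl
    | mul_X P i _ =>
      refine ⟨0, ?_⟩
      have := verschiebung_mul (p := p) (k := k)
        (Ideal.Quotient.mk (frobKernelIdeal p k (AddHopf r k) 1) P : AlphaHopf p k r) (t p k r i)
      rw [verschiebung_eq_zero_of_mem_alphaModule (t_mem_alphaModule r i), mul_zero] at this
      rw [map_zero]
      exact this
  intro x hx
  obtain ⟨P, rfl⟩ := Ideal.Quotient.mk_surjective x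
  obtain ⟨c, hc⟩ := h P
  have h0 := counit_verschiebung_eq_zero (p := p) hx
  rw [hc, Bialgebra.counit_algebraMap] at h0
  rw [Function.iterate_one, hc, h0, map_zero]

instance [PerfectRing k p] : IsLocalRing (WithConv (AlphaHopf p k r →ₗ[k] k)) :=
  isLocalRing_dual_of_verschiebungPowZero (verschiebungPowZero (p := p) r)

end AlphaHopf

/-- `α_p` as a finite commutative infinitesimal group scheme with infinitesimal dual. -/
def alphaObj (p : ℕ) [Fact p.Prime] (k : Type u) [Field k] [CharP k p] [PerfectRing k p] :
    AbInfInf k where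
  R := AlphaHopf p k 1

end Alpha

/-! ### Epimorphisms -/

section Epi

variable {k : Type u} [Field k]

theorem pow_mem_alphaModule {R : Type u} [CommRing R] [HopfAlgebra k R] {x : R} {p : ℕ}
    [Fact p.Prime] [CharP k p] (hx : x ∈ alphaModule k R) (N : ℕ) : x ^ p ^ N ∈ alphaModule k R := by
  change Bialgebra.comulAlgHom k R (x ^ p ^ N) = _
  rw [map_pow, Bialgebra.comulAlgHom_apply, show Coalgebra.comul (R := k) x = _ from hx,
    add_pow_char_pow_algebra (k := k)]
  simp [Algebra.TensorProduct.tmul_pow]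

theorem zero_mem_alphaModule {R : Type u} [CommRing R] [HopfAlgebra k R] :
    (0 : R) ∈ alphaModule k R := by
  simp [alphaModule]

/-- The comorphism of an epimorphism is injective on primitive elements: a primitive element with
vanishing `p`-th power is a homomorphism to `α_p`. -/
theorem eq_zero_of_epi_of_mem_alphaModule (p : ℕ) [Fact p.Prime] [CharP k p] [PerfectRing k p]
    {G G' : AbInfInf k} (f : G ⟶ G') [Epi f] {x : G'.R} (hx : x ∈ alphaModule k G'.R)
    (h0 : AbInfInf.pullback f x = 0) : x = 0 := by
  obtain ⟨N, hN⟩ := exists_maximalIdeal_pow_eq_bot k G'.R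
  have hxN : x ^ p ^ N = 0 := by
    have hm : x ∈ IsLocalRing.maximalIdeal G'.R :=
      (mem_maximalIdeal_iff (Bialgebra.counitAlgHom k G'.R)).2
        (counit_eq_zero_of_mem_alphaModule hx)
    have := Ideal.pow_mem_pow hm N
    rw [hN] at this
    exact pow_eq_zero_of_le (Nat.lt_pow_self (Fact.out : p.Prime).one_lt).le this
  clear hN
  induction N generalizing x with
  | zero => simpa using hxN
  | succ N ih =>
    have hxp : x ^ p = 0 := by
      refine ih (x := x ^ p) ?_ ?_ ?_
      · have := pow_mem_alphaModule (p := p) hx 1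
        rwa [pow_one] at this
      · rw [map_pow, h0, zero_pow (Fact.out : p.Prime).ne_zero]
      · rw [← pow_mul, ← pow_succ', hxN]
    let u : AlphaHopf p k 1 →ₐc[k] G'.R := alphaLift (fun _ => x) (fun _ => hx) (fun _ => hxp)
    let u₀ : AlphaHopf p k 1 →ₐc[k] G'.R := alphaLift (fun _ => 0)
      (fun _ => zero_mem_alphaModule) (fun _ => zero_pow (Fact.out : p.Prime).ne_zero)
    let g : G' ⟶ alphaObj p k := u
    let g₀ : G' ⟶ alphaObj p k := u₀
    have hext : (AbInfInf.pullback f : G'.R →ₐ[k] G.R).comp (u : AlphaHopf p k 1 →ₐ[k] G'.R) =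
        (AbInfInf.pullback f : G'.R →ₐ[k] G.R).comp (u₀ : AlphaHopf p k 1 →ₐ[k] G'.R) := by
      refine Ideal.Quotient.algHom_ext _ (AddHopf.hom_ext fun i => ?_)
      change AbInfInf.pullback f (u (Ideal.Quotient.mk _ (AddHopf.t 1 k i))) =
        AbInfInf.pullback f (u₀ (Ideal.Quotient.mk _ (AddHopf.t 1 k i)))
      rw [alphaLift_mk, alphaLift_mk, h0, map_zero]
    have hcomp : f ≫ g = f ≫ g₀ :=
      DFunLike.ext (F := AlphaHopf p k 1 →ₐc[k] G.R) _ _ fun a => DFunLike.congr_fun hext a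
    have hg : g = g₀ := (cancel_epi f).1 hcomp
    have h1 : u (alphaCoord p k) = u₀ (alphaCoord p k) :=
      DFunLike.congr_fun (F := AlphaHopf p k 1 →ₐc[k] G'.R) hg _
    rwa [alphaLift_alphaCoord, alphaLift_alphaCoord] at h1

/-- A subalgebra of an algebra `k ⊕ M` with nilpotent ideal `M` is everything if it
surjects onto `M / M²`. -/
theorem subalgebra_eq_top_of_cotangent {S : Type*} [CommRing S] [Algebra k S] (T : Subalgebra k S)
    (M : Ideal S) (hk : ∀ s, ∃ c : k, s - algebraMap k S c ∈ M) {N : ℕ} (hN : M ^ N = ⊥)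
    (h : ∀ s, ∃ t ∈ T, s - t ∈ M ^ 2) : T = ⊤ := by
  have hstep : ∀ j, ∀ a ∈ M ^ (j + 1), ∃ t ∈ T, a - t ∈ M ^ (j + 2) := by
    intro j
    induction j with
    | zero => exact fun a _ => h a
    | succ j ih =>
      intro a ha
      rw [pow_succ (n := j + 1)] at ha
      induction ha using Submodule.mul_induction_on' with
      | mem_mul_mem a ha b hb =>
        obtain ⟨s, hs, hs'⟩ := ih a ha
        obtain ⟨t, ht, ht'⟩ := h b
        have hsM : s ∈ M ^ (j + 1) := by
          have := sub_mem ha (Ideal.pow_le_pow_right (Nat.le_succ (j + 1)) hs')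
          rwa [sub_sub_cancel] at this
        refine ⟨s * t, T.mul_mem hs ht, ?_⟩
        have e : a * b - s * t = s * (b - t) + (a - s) * b := by ring
        rw [e]
        refine add_mem ?_ ?_
        · have := Ideal.mul_mem_mul hsM ht'
          rwa [← pow_add] at this
        · have := Ideal.mul_mem_mul hs' hb
          rwa [← pow_succ] at this
      | add a _ b _ ha hb =>
        obtain ⟨s, hs, hs'⟩ := ha
        obtain ⟨t, ht, ht'⟩ := hb
        refine ⟨s + t, T.add_mem hs ht, ?_⟩
        rw [add_sub_add_comm]
        exact add_mem hs' ht'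
  have hall : ∀ j s, ∃ t ∈ T, s - t ∈ M ^ (j + 1) := by
    intro j s
    induction j with
    | zero =>
      obtain ⟨c, hc⟩ := hk s
      exact ⟨_, T.algebraMap_mem c, by rwa [zero_add, pow_one]⟩
    | succ j ih =>
      obtain ⟨t, ht, ht'⟩ := ih
      obtain ⟨t', h1, h2⟩ := hstep j _ ht'
      exact ⟨t + t', T.add_mem ht h1, by rwa [← sub_sub]⟩
  refine eq_top_iff.2 fun s _ => ?_
  obtain ⟨t, ht, ht'⟩ := hall N s
  have : s - t = 0 := by
    have h' := Ideal.pow_le_pow_right (Nat.le_succ N) ht'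
    rwa [hN] at h'
  rwa [sub_eq_zero.1 this]

section Coalgebra

variable {R R' : Type u} [CommRing R] [HopfAlgebra k R] [Coalgebra.IsCocomm k R]
  [CommRing R'] [HopfAlgebra k R'] [Coalgebra.IsCocomm k R']

/-- The subalgebra of the dual of `R'` of the forms that factor through `φ : R' → R`. -/
def dualRange (φ : R' →ₐc[k] R) : Subalgebra k (WithConv (R' →ₗ[k] k)) where
  carrier := {s | ∃ l : R →ₗ[k] k, s = WithConv.toConv (l ∘ₗ (φ : R' →ₗc[k] R).toLinearMap)}
  mul_mem' := by
    rintro _ _ ⟨l, rfl⟩ ⟨l', rfl⟩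
    refine ⟨(WithConv.toConv l * WithConv.toConv l').ofConv, ?_⟩
    rw [LinearMap.convMul_comp_coalgHom_distrib]
  add_mem' := by
    rintro _ _ ⟨l, rfl⟩ ⟨l', rfl⟩
    exact ⟨l + l', rfl⟩
  algebraMap_mem' := fun c => by
    refine ⟨c • Coalgebra.counit, WithConv.ofConv_injective (LinearMap.ext fun x => ?_)⟩
    rw [Algebra.algebraMap_eq_smul_one]
    change c • _ = c • Coalgebra.counit (R := k) (φ x)
    rw [CoalgHomClass.counit_comp_apply]
    simp [LinearMap.convOne_def]

/-- Two tensors over a field agree if all pairs of linear forms agree on them. -/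
theorem tensor_ext {V : Type u} [AddCommGroup V] [Module k V] [Module.Finite k V] {s t : V ⊗[k] V}
    (h : ∀ l l' : V →ₗ[k] k, LinearMap.mul' k k (TensorProduct.map l l' s) =
      LinearMap.mul' k k (TensorProduct.map l l' t)) : s = t := by
  let b := Module.finBasis k V
  refine (b.tensorProduct b).ext_elem fun ⟨i, j⟩ => ?_
  have e : ∀ t : V ⊗[k] V, (b.tensorProduct b).repr t (i, j) =
      LinearMap.mul' k k (TensorProduct.map (b.coord i) (b.coord j) t) := by
    intro t
    induction t using TensorProduct.induction_on with
    | zero => simp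
    | tmul x y => simp [mul_comm]
    | add s t hs ht => simp only [map_add, Finsupp.add_apply, hs, ht]
  rw [e, e, h]

variable [Module.Finite k R']

theorem mem_alphaModule_of_dual {x : R'} (h0 : Coalgebra.counit (R := k) x = 0)
    (h : ∀ l l' : WithConv (R' →ₗ[k] k), l 1 = 0 → l' 1 = 0 → (l * l') x = 0) :
    x ∈ alphaModule k R' := by
  refine tensor_ext fun l l' => ?_
  have hs : ∀ l : R' →ₗ[k] k, ∃ m : WithConv (R' →ₗ[k] k), m 1 = 0 ∧
      WithConv.toConv l = m + algebraMap k _ (l 1) := fun l =>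
    ⟨WithConv.toConv l - algebraMap k _ (l 1), sub_algebraMap_apply_one _,
      (sub_add_cancel _ _).symm⟩
  obtain ⟨m, hm, e⟩ := hs l
  obtain ⟨m', hm', e'⟩ := hs l'
  have h1 : (WithConv.toConv l * WithConv.toConv l') x = l' 1 * l x + l 1 * l' x := by
    have hc : ∀ c : k, ∀ n : WithConv (R' →ₗ[k] k), (algebraMap k _ c * n) x = c * n x := by
      intro c n
      rw [← Algebra.smul_def]
      rfl
    have ha : ∀ c : k, (algebraMap k (WithConv (R' →ₗ[k] k)) c) x = 0 := by
      intro c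
      rw [Algebra.algebraMap_eq_smul_one]
      change c • _ = (0 : k)
      simp [LinearMap.convOne_def, h0]
    have hl : l x = m x := by
      have := congrArg (fun s : WithConv (R' →ₗ[k] k) => s x) e
      exact this.trans ((congrArg (m x + ·) (ha _)).trans (add_zero _))
    have hl' : l' x = m' x := by
      have := congrArg (fun s : WithConv (R' →ₗ[k] k) => s x) e'
      exact this.trans ((congrArg (m' x + ·) (ha _)).trans (add_zero _))
    have e2 : WithConv.toConv l * WithConv.toConv l' = m * m' + algebraMap k _ (l' 1) * m +
        (algebraMap k _ (l 1) * m' + algebraMap k _ (l 1 * l' 1)) := by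
      rw [e, e', map_mul]
      ring
    rw [e2]
    change ((m * m') x + (algebraMap k _ (l' 1) * m) x) + ((algebraMap k _ (l 1) * m') x +
      (algebraMap k (WithConv (R' →ₗ[k] k)) (l 1 * l' 1)) x) = _
    rw [h m m' hm hm', hc, hc, ha, hl, hl', zero_add, add_zero]
  rw [LinearMap.convMul_apply] at h1
  refine Eq.trans h1 ?_
  simp [mul_comm]

end Coalgebra

variable {R R' : Type u} [CommRing R] [HopfAlgebra k R]
  [CommRing R'] [HopfAlgebra k R'] [Coalgebra.IsCocomm k R'] [Module.Finite k R']
  [IsLocalRing (WithConv (R' →ₗ[k] k))]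

/-- When the dual of `R'` is local, a homomorphism from `R'` is injective if it is injective on
primitive elements: these are dual to the cotangent space of the dual algebra. -/
theorem injective_of_injective_on_alphaModule (φ : R' →ₐc[k] R)
    (h : ∀ x ∈ alphaModule k R', φ x = 0 → x = 0) : Function.Injective φ := by
  have : Module.Finite k (WithConv (R' →ₗ[k] k)) :=
    Module.Finite.equiv (WithConv.linearEquiv k (R' →ₗ[k] k)).symm
  obtain ⟨N, hN⟩ := exists_maximalIdeal_pow_eq_bot k (WithConv (R' →ₗ[k] k))
  set M := IsLocalRing.maximalIdeal (WithConv (R' →ₗ[k] k)) with hM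
  have hmem : ∀ l, l ∈ M ↔ l 1 = 0 := fun l => mem_maximalIdeal_iff (dualAugmentation k R')
  have hsum : Subalgebra.toSubmodule (dualRange φ) ⊔ (M ^ 2).restrictScalars k = ⊤ := by
    by_contra hne
    obtain ⟨F, hF, hle⟩ := Submodule.exists_le_ker_of_lt_top _ (lt_top_iff_ne_top.2 hne)
    let F' : Module.Dual k (Module.Dual k R') :=
      F ∘ₗ (WithConv.linearEquiv k (R' →ₗ[k] k)).symm.toLinearMap
    let x : R' := (Module.evalEquiv k R').symm F'
    have hx : ∀ l : R' →ₗ[k] k, F (WithConv.toConv l) = l x := fun l =>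
      (Module.apply_evalEquiv_symm_apply k R' l F').symm
    have hφ : φ x = 0 := (Module.forall_dual_apply_eq_zero_iff k _).1 fun l => by
      have : F _ = 0 := hle (Submodule.mem_sup_left (show WithConv.toConv
        (l ∘ₗ (φ : R' →ₗc[k] R).toLinearMap) ∈ Subalgebra.toSubmodule (dualRange φ) from ⟨l, rfl⟩))
      rwa [hx] at this
    have hε : Coalgebra.counit (R := k) x = 0 := by
      rw [← CoalgHomClass.counit_comp_apply φ x, hφ, map_zero]
    have hx0 : x = 0 := by
      refine h x (mem_alphaModule_of_dual hε fun l l' hl hl' => ?_) hφ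
      have : F (l * l') = 0 := hle (Submodule.mem_sup_right (by
        rw [Submodule.restrictScalars_mem, pow_two]
        exact Ideal.mul_mem_mul ((hmem l).2 hl) ((hmem l').2 hl')))
      exact (hx (l * l').ofConv).symm.trans this
    refine hF (LinearMap.ext fun l => ?_)
    refine (hx l.ofConv).trans ?_
    rw [hx0, map_zero]
    rfl
  have htop : dualRange φ = ⊤ := by
    refine subalgebra_eq_top_of_cotangent _ M (fun s => ⟨s 1, ?_⟩) hN fun s => ?_
    · exact (hmem _).2 (sub_algebraMap_apply_one s)
    · obtain ⟨t, ht, u, hu, rfl⟩ := Submodule.mem_sup.1 (hsum.ge (Submodule.mem_top (x := s)))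
      exact ⟨t, ht, by rwa [add_sub_cancel_left]⟩
  refine (injective_iff_map_eq_zero φ).2 fun x hx => ?_
  refine (Module.forall_dual_apply_eq_zero_iff k x).1 fun l => ?_
  obtain ⟨l', hl'⟩ : WithConv.toConv l ∈ dualRange φ := htop ▸ Algebra.mem_top
  have := congrArg (fun s : WithConv (R' →ₗ[k] k) => s x) hl'
  refine this.trans ?_
  change l' (φ x) = 0
  rw [hx, map_zero]

theorem AbInfInf.injective_pullback_of_epi (p : ℕ) [Fact p.Prime] [CharP k p] [PerfectRing k p]
    {G G' : AbInfInf k} (f : G ⟶ G') [Epi f] : Function.Injective (pullback f) :=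
  injective_of_injective_on_alphaModule _ fun _ hx h0 => eq_zero_of_epi_of_mem_alphaModule p f hx h0

end Epi

/-! ### Kernels and descent along them -/

section Kernel

variable {k : Type u} [Field k] {R R' : Type u} [CommRing R] [HopfAlgebra k R]
  [CommRing R'] [HopfAlgebra k R']

/-- The ideal of the kernel of `φ^* : Spec R → Spec R'`. -/
def kernelIdeal (φ : R' →ₐc[k] R) : Ideal R :=
  Ideal.map (φ : R' →ₐ[k] R) (RingHom.ker (Bialgebra.counitAlgHom k R'))

/-- Modulo the kernel ideal, `φ` becomes the counit. -/
theorem comp_eq_algebraMap_counit {A : Type u} [CommRing A] [Algebra k A] (π : R →ₐ[k] A)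
    (φ : R' →ₐc[k] R) (h : ∀ a ∈ kernelIdeal φ, π a = 0) (a : R') :
    π (φ a) = algebraMap k A (Coalgebra.counit (R := k) a) := by
  have h0 : π (φ (a - algebraMap k R' (Coalgebra.counit (R := k) a))) = 0 := by
    refine h _ (Ideal.mem_map_of_mem (φ : R' →ₐ[k] R) ?_)
    rw [RingHom.mem_ker]
    simp
  rw [map_sub, map_sub, sub_eq_zero] at h0
  rw [h0]
  have : φ (algebraMap k R' (Coalgebra.counit (R := k) a)) =
    algebraMap k R (Coalgebra.counit (R := k) a) := (φ : R' →ₐ[k] R).commutes _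
  rw [this, AlgHom.commutes]

theorem map_comul_eq {A : Type u} [CommRing A] [Algebra k A] (π : R →ₐ[k] A)
    (φ : R' →ₐc[k] R) (h : ∀ a ∈ kernelIdeal φ, π a = 0) (a : R') :
    Algebra.TensorProduct.map (AlgHom.id k R) π (Coalgebra.comul (R := k) (φ a)) =
      φ a ⊗ₜ[k] 1 := by
  rw [← CoalgHomClass.map_comp_comul_apply φ a]
  have e : ∀ t : R' ⊗[k] R', Algebra.TensorProduct.map (AlgHom.id k R) π
      (TensorProduct.map (φ : R' →ₗ[k] R) (φ : R' →ₗ[k] R) t) =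
      TensorProduct.map (φ : R' →ₗ[k] R) (Algebra.linearMap k A)
        (LinearMap.lTensor R' (Coalgebra.counit (R := k)) t) := by
    intro t
    induction t using TensorProduct.induction_on with
    | zero => simp
    | tmul x y =>
      have := comp_eq_algebraMap_counit π φ h y
      simp [this]
    | add s t hs ht => simp only [map_add, hs, ht]
  refine (e _).trans ?_
  rw [Coalgebra.lTensor_counit_comul]
  simp

theorem antipode_apply (φ : R' →ₐc[k] R) (a : R') :
    HopfAlgebra.antipode k (φ a) = φ (HopfAlgebra.antipode k a) := by
  have h1 : WithConv.toConv (HopfAlgebra.antipode k ∘ₗ (φ : R' →ₗc[k] R).toLinearMap) *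
      WithConv.toConv (φ : R' →ₗc[k] R).toLinearMap = (1 : WithConv (R' →ₗ[k] R)) := by
    have := LinearMap.convMul_comp_coalgHom_distrib (WithConv.toConv (HopfAlgebra.antipode k))
      (WithConv.toConv LinearMap.id) (φ : R' →ₗc[k] R)
    rw [LinearMap.antipode_mul_id] at this
    refine WithConv.ofConv_injective (this.symm.trans (LinearMap.ext fun x => ?_))
    simp [LinearMap.convOne_def]
  have h2 : WithConv.toConv (φ : R' →ₗc[k] R).toLinearMap *
      WithConv.toConv ((φ : R' →ₗc[k] R).toLinearMap ∘ₗ HopfAlgebra.antipode k) =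
        (1 : WithConv (R' →ₗ[k] R)) := by
    have := LinearMap.algHom_comp_convMul_distrib (φ : R' →ₐ[k] R) (WithConv.toConv LinearMap.id)
      (WithConv.toConv (HopfAlgebra.antipode k))
    rw [LinearMap.id_mul_antipode, LinearMap.algHom_comp_convOne] at this
    exact (WithConv.ofConv_injective this).symm
  exact LinearMap.congr_fun (WithConv.toConv_injective (left_inv_eq_right_inv h1 h2)) a

instance (φ : R' →ₐc[k] R) : (kernelIdeal φ).IsHopfIdeal k := by
  set π : R →ₐ[k] R ⧸ kernelIdeal φ := Ideal.Quotient.mkₐ k (kernelIdeal φ)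
  have hπ : ∀ a ∈ kernelIdeal φ, π a = 0 := fun a ha => Ideal.Quotient.eq_zero_iff_mem.2 ha
  have hle : ∀ {A : Type u} [CommRing A] [Algebra k A] (g : R →ₐ[k] A),
      (∀ a : R', Coalgebra.counit (R := k) a = 0 → g (φ a) = 0) → ∀ a ∈ kernelIdeal φ, g a = 0 := by
    intro A _ _ g hg
    have : kernelIdeal φ ≤ RingHom.ker g := Ideal.map_le_iff_le_comap.2 hg
    exact this
  have hco : ((kernelIdeal φ).restrictScalars k).IsCoideal := by
    refine ⟨fun x hx => hle (Bialgebra.counitAlgHom k R) (fun a ha => ?_) x hx,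
      fun x hx => hle ((Algebra.TensorProduct.map π π).comp (Bialgebra.comulAlgHom k R))
        (fun a ha => ?_) x hx⟩
    · exact (CoalgHomClass.counit_comp_apply φ a).trans ha
    · have h1 := map_comul_eq π φ hπ a
      have h2 : Algebra.TensorProduct.map π π (Coalgebra.comul (R := k) (φ a)) =
          Algebra.TensorProduct.map π (AlgHom.id k _) (Algebra.TensorProduct.map (AlgHom.id k R) π
            (Coalgebra.comul (R := k) (φ a))) := by
        rw [← AlgHom.comp_apply (Algebra.TensorProduct.map π _), ← Algebra.TensorProduct.map_comp]
        rfl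
      refine h2.trans ?_
      rw [h1, Algebra.TensorProduct.map_tmul, comp_eq_algebraMap_counit π φ hπ, ha]
      simp
  refine { toIsCoideal := hco, antipode_mem := fun x hx => ?_ }
  refine Ideal.Quotient.eq_zero_iff_mem.1
    (hle (π.comp (HopfAlgebra.antipodeAlgHom k R)) (fun a ha => ?_) x hx)
  have h1 := antipode_apply φ a
  change π (HopfAlgebra.antipode k (φ a)) = 0
  rw [h1, comp_eq_algebraMap_counit π φ hπ, HopfAlgebra.counit_antipode, ha, map_zero]

end Kernel

/-- The kernel of a morphism of finite commutative infinitesimal group schemes with infinitesimal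
dual. -/
def AbInfInf.kernel (p : ℕ) [Fact p.Prime] {k : Type u} [Field k] [CharP k p] [PerfectRing k p]
    {G G' : AbInfInf k} (f : G ⟶ G') : AbInfInf k :=
  have : Coalgebra.IsCocomm k (G.R ⧸ kernelIdeal (pullback f)) :=
    isCocomm_of_surjective (Bialgebra.Quotient.mkBialgHom _) Ideal.Quotient.mk_surjective
  { R := G.R ⧸ kernelIdeal (pullback f)
    isLocalRing :=
      have : Nontrivial (G.R ⧸ kernelIdeal (pullback f)) :=
        (Bialgebra.counitAlgHom k (G.R ⧸ kernelIdeal (pullback f))).toRingHom.domain_nontrivial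
      IsLocalRing.of_surjective' _ Ideal.Quotient.mk_surjective
    isLocalRing_dual := by
      obtain ⟨n, hn⟩ := exists_verschiebungPowZero (k := k) (R := G.R) p
      exact isLocalRing_dual_of_verschiebungPowZero
        (hn.of_surjective (Bialgebra.Quotient.mkBialgHom _) Ideal.Quotient.mk_surjective) }

theorem AbInfInf.exists_isKernel (p : ℕ) [Fact p.Prime] {k : Type u} [Field k] [CharP k p]
    [PerfectRing k p] {G G' : AbInfInf k} (f : G ⟶ G') :
    ∃ (H : AbInfInf k) (i : H ⟶ G), IsKernel i f :=
  ⟨kernel p f, (Bialgebra.Quotient.mkBialgHom (kernelIdeal (pullback f)) :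
    G.R →ₐc[k] G.R ⧸ kernelIdeal (pullback f)), Ideal.Quotient.mk_surjective,
    Ideal.mk_ker (I := kernelIdeal (pullback f))⟩

section Descent

variable {k : Type u} [Field k] {R R' H : Type u} [CommRing R] [HopfAlgebra k R]
  [Module.Finite k R]
  [CommRing R'] [HopfAlgebra k R'] [IsLocalRing R'] [CommRing H] [Algebra k H]

/-- Lifts of a `k`-basis of the coordinate ring of the fibre generate `R` over `R'`. -/
theorem exists_sum_eq_of_basis (φ : R' →ₐc[k] R) (π : R →ₐ[k] H)
    (hπ : ∀ a, π a = 0 → a ∈ kernelIdeal φ) {ι : Type*} [Fintype ι] (b : Module.Basis ι k H)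
    {e : ι → R} (he : ∀ i, π (e i) = b i) (x : R) : ∃ a : ι → R', x = ∑ i, φ (a i) * e i := by
  let : Algebra R' R := (φ : R' →+* R).toAlgebra
  have : IsScalarTower k R' R := .of_algebraMap_eq fun c => ((φ : R' →ₐ[k] R).commutes c).symm
  have : Module.Finite R' R := .of_restrictScalars_finite k R' R
  have hm : RingHom.ker (Bialgebra.counitAlgHom k R') ≤ Ideal.jacobson ⊥ := by
    rw [IsLocalRing.jacobson_eq_maximalIdeal _ bot_ne_top]
    exact fun a ha => (mem_maximalIdeal_iff (Bialgebra.counitAlgHom k R')).2 ha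
  have hle : (⊤ : Submodule R' R) ≤ Submodule.span R' (Set.range e) := by
    refine Submodule.le_of_le_smul_of_le_jacobson_bot Module.Finite.fg_top hm fun y _ => ?_
    have h1 : y - ∑ i, b.repr (π y) i • e i ∈ kernelIdeal φ := by
      refine hπ _ ?_
      rw [map_sub, map_sum]
      simp only [map_smul, he, b.sum_repr, sub_self]
    rw [← add_sub_cancel (∑ i, b.repr (π y) i • e i) y]
    refine Submodule.add_mem_sup (Submodule.sum_mem _ fun i _ => ?_) ?_
    · exact Submodule.smul_of_tower_mem _ _ (Submodule.subset_span ⟨i, rfl⟩)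
    · rw [Ideal.smul_top_eq_map]
      exact h1
  obtain ⟨a, ha⟩ := (Submodule.mem_span_range_iff_exists_fun R').1 (hle (Submodule.mem_top (x := x)))
  refine ⟨a, ha.symm.trans (Finset.sum_congr rfl fun i _ => ?_)⟩
  rw [Algebra.smul_def]
  rfl

/-- An element `x` of `R` that is invariant under translation by the kernel of
`φ^* : Spec R → Spec R'` comes from `R'`. Let `e_i` be lifts to `R` of a `k`-basis of the coordinate
ring of the kernel; they generate `R` over `R'`, and their coactions are independent over `R`, as
the coefficient matrix reduces to the identity. Comparing the coactions of `1 = ∑ u_i e_i` and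
`x = ∑ a_i e_i` gives `a_i = x u_i`, and some `u_i` is a unit. -/
theorem mem_range_of_coaction_eq [IsLocalRing R] [Module.Finite k H] (φ : R' →ₐc[k] R)
    (π : R →ₐ[k] H)
    (hsurj : Function.Surjective π) (hker : ∀ a, π a = 0 ↔ a ∈ kernelIdeal φ) {x : R}
    (hx : Algebra.TensorProduct.map (AlgHom.id k R) π (Coalgebra.comul (R := k) x) =
      x ⊗ₜ[k] 1) : ∃ y, φ y = x := by
  classical
  let b := Module.finBasis k H
  choose e he using fun i => hsurj (b i)
  let β : R →ₐ[k] R ⊗[k] H :=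
    (Algebra.TensorProduct.map (AlgHom.id k R) π).comp (Bialgebra.comulAlgHom k R)
  have hβ : ∀ a, β (φ a) = φ a ⊗ₜ[k] 1 := map_comul_eq π φ fun a ha => (hker a).2 ha
  have hβx : β x = x ⊗ₜ[k] 1 := hx
  let B := b.baseChange R
  let C : Matrix (Fin (Module.finrank k H)) (Fin (Module.finrank k H)) R :=
    Matrix.of fun i j => B.repr (β (e i)) j
  have hC : IsUnit C := by
    rw [Matrix.isUnit_iff_isUnit_det, isUnit_iff_augmentation_ne_zero (Bialgebra.counitAlgHom k R),
      AlgHom.map_det]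
    have hε : ∀ t : R ⊗[k] H, ∀ j, Coalgebra.counit (R := k) (B.repr t j) =
        b.repr (TensorProduct.lid k H (LinearMap.rTensor H (Coalgebra.counit (R := k)) t)) j := by
      intro t j
      induction t using TensorProduct.induction_on with
      | zero => simp
      | tmul r h => simp [B, mul_comm]
      | add s t hs ht => simp only [map_add, Finsupp.add_apply, hs, ht]
    have h1 : (Bialgebra.counitAlgHom k R).mapMatrix C = 1 := by
      ext i j
      change Coalgebra.counit (R := k) (B.repr (β (e i)) j) = _
      rw [hε]
      have h2 : ∀ t : R ⊗[k] R, LinearMap.rTensor H (Coalgebra.counit (R := k))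
          (Algebra.TensorProduct.map (AlgHom.id k R) π t) = LinearMap.lTensor k π.toLinearMap
            (LinearMap.rTensor R (Coalgebra.counit (R := k)) t) := by
        intro t
        induction t using TensorProduct.induction_on with
        | zero => simp
        | tmul r h => simp
        | add s t hs ht => simp only [map_add, hs, ht]
      change b.repr (TensorProduct.lid k H (LinearMap.rTensor H (Coalgebra.counit (R := k))
        (Algebra.TensorProduct.map (AlgHom.id k R) π (Coalgebra.comul (R := k) (e i))))) j = _
      rw [h2, Coalgebra.rTensor_counit_comul]
      simp [he, Matrix.one_apply, Finsupp.single_apply]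
    rw [h1, Matrix.det_one]
    exact one_ne_zero
  have hcoef : ∀ (v : Fin (Module.finrank k H) → R') (j), B.repr (β (∑ i, φ (v i) * e i)) j =
      Matrix.vecMul (fun i => φ (v i)) C j := by
    intro v j
    rw [map_sum, map_sum, Finsupp.finsetSum_apply]
    refine Finset.sum_congr rfl fun i _ => ?_
    rw [map_mul, hβ]
    have : (φ (v i) ⊗ₜ[k] (1 : H)) * β (e i) = φ (v i) • β (e i) := by
      rw [Algebra.smul_def]
      rfl
    rw [this, map_smul]
    rfl
  obtain ⟨u, hu⟩ := exists_sum_eq_of_basis φ π (fun a => (hker a).1) b he 1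
  obtain ⟨a, ha⟩ := exists_sum_eq_of_basis φ π (fun a => (hker a).1) b he x
  have hvec : Matrix.vecMul (fun i => φ (a i)) C = Matrix.vecMul (fun i => x * φ (u i)) C := by
    funext j
    have h1 : β x = x • β 1 := by
      rw [hβx, map_one, Algebra.smul_def, mul_one]
      rfl
    have h2 : Matrix.vecMul (fun i => x * φ (u i)) C = x • Matrix.vecMul (fun i => φ (u i)) C :=
      Matrix.smul_vecMul x _ C
    rw [h2, Pi.smul_apply, ← hcoef, ← hcoef, ← ha, ← hu, h1, map_smul]
    rfl
  have hau : ∀ i, φ (a i) = x * φ (u i) := fun i =>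
    congrFun (Matrix.vecMul_injective_of_isUnit hC hvec) i
  obtain ⟨i, hi⟩ : ∃ i, IsUnit (u i) := by
    by_contra! hne
    have h0 : ∀ i, Coalgebra.counit (R := k) (φ (u i)) = 0 := fun i => by
      rw [CoalgHomClass.counit_comp_apply φ]
      by_contra h
      exact hne i ((isUnit_iff_augmentation_ne_zero (Bialgebra.counitAlgHom k R')).2 h)
    have h1 := congrArg (Coalgebra.counit (R := k)) hu
    rw [map_sum] at h1
    simp [h0] at h1
  obtain ⟨w, hw⟩ := hi.exists_right_inv
  refine ⟨a i * w, ?_⟩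
  rw [map_mul, hau, mul_assoc, ← map_mul, hw, map_one, mul_one]

end Descent

section Exact

variable {p : ℕ} [Fact p.Prime] {k : Type u} [Field k] [CharP k p] [PerfectRing k p]
variable {R R' H : Type u} [CommRing R] [HopfAlgebra k R] [Coalgebra.IsCocomm k R]
  [Module.Finite k R] [CommRing R'] [HopfAlgebra k R'] [Coalgebra.IsCocomm k R']
  [Module.Finite k R'] [CommRing H] [HopfAlgebra k H] [Coalgebra.IsCocomm k H] [Module.Finite k H]

theorem IsDieudonneElement.of_map {n : ℕ} {φ : R' →ₐc[k] R} (hφ : Function.Injective φ) {y : R'}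
    (h : IsDieudonneElement p k n (φ y)) : IsDieudonneElement p k n y := by
  refine ⟨(CoalgHomClass.counit_comp_apply φ y).symm.trans h.1, ?_⟩
  have hinj : Function.Injective (Algebra.TensorProduct.map (φ : R' →ₐ[k] R) (φ : R' →ₐ[k] R)) :=
    TensorProduct.map_injective_of_flat_flat (φ : R' →ₐ[k] R).toLinearMap
      (φ : R' →ₐ[k] R).toLinearMap hφ hφ
  refine hinj ((CoalgHomClass.map_comp_comul_apply φ y).trans ?_)
  rw [h.2]
  refine Eq.trans ?_ (map_wittPhi (Algebra.TensorProduct.map (φ : R' →ₐ[k] R) (φ : R' →ₐ[k] R))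
    n _ _).symm
  simp [bialgHom_iterate_verschiebung]

theorem IsDieudonneElement.map_comul_eq_of_map_eq_zero {n : ℕ} {x : R}
    (h : IsDieudonneElement p k n x) (π : R →ₐc[k] H) (hx : π x = 0) :
    Algebra.TensorProduct.map (AlgHom.id k R) (π : R →ₐ[k] H) (Coalgebra.comul (R := k) x) =
      x ⊗ₜ[k] 1 := by
  rw [h.2, map_wittPhi]
  have h1 : ∀ j, π ((verschiebung p k)^[j] x) = 0 := fun j => by
    rw [bialgHom_iterate_verschiebung, hx, iterate_verschiebung_zero]
  simp only [Algebra.TensorProduct.map_tmul, AlgHom.id_apply, map_one,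
    BialgHom.coe_toAlgHom, h1, tmul_zero]
  rw [wittPhi_eq_coeff]
  have h0 : WittVector.mk p (fun _ : ℕ => (0 : R ⊗[k] H)) = 0 := by ext; simp
  rw [h0, add_zero, WittVector.coeff_mk, Nat.sub_self, Function.iterate_zero, id]

end Exact

/-! ### The Dieudonné functor -/

namespace AbInfInf

variable (p : ℕ) [Fact p.Prime] {k : Type u} [Field k] [CharP k p] [PerfectRing k p]

/-- A number `n` with `V_{G/k}^{n+1} = 0`. -/
def level (G : AbInfInf k) : ℕ := (exists_verschiebungPowZero (k := k) (R := G.R) p).choose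

theorem verschiebungPowZero_level (G : AbInfInf k) : VerschiebungPowZero p k G.R (level p G + 1) :=
  (exists_verschiebungPowZero (k := k) (R := G.R) p).choose_spec

/-- The Dieudonné module of `G`, with the normalisation of the action of `W(k)` that does not
depend on the level. -/
abbrev DieudonneModule (G : AbInfInf k) : Type u :=
  LevelModule (level p G) (verschiebungPowZero_level p G)

/-- The identification of the Dieudonné module of `G` with `D(G) ⊆ R`. -/
def moduleEquiv (G : AbInfInf k) : DieudonneModule p G ≃ dieudonneElements p k G.R := Equiv.refl _

theorem isDieudonneModule (G : AbInfInf k) {n : ℕ} (hn : VerschiebungPowZero p k G.R (n + 1)) :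
    IsDieudonneModule p k G.R n n (moduleEquiv p G) :=
  (LevelModule.isDieudonneModule (level p G) (verschiebungPowZero_level p G)).level
    (verschiebungPowZero_level p G) hn

theorem moduleEquiv_injective {G : AbInfInf k} {x y : DieudonneModule p G}
    (h : (moduleEquiv p G x : G.R) = moduleEquiv p G y) : x = y :=
  (moduleEquiv p G).injective (Subtype.ext h)

theorem exists_dieudonneMap {G G' : AbInfInf k} (f : G ⟶ G') :
    ∃ φ : DieudonneModule p G' →ₗ[DieudonneRing p k] DieudonneModule p G,
      ∀ x, (moduleEquiv p G (φ x) : G.R) = pullback f (moduleEquiv p G' x : G'.R) := by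
  have h := (verschiebungPowZero_level p G).mono (show _ ≤ max (level p G) (level p G') + 1 by omega)
  have h' := (verschiebungPowZero_level p G').mono
    (show _ ≤ max (level p G) (level p G') + 1 by omega)
  exact exists_linearMap h h' (pullback f) (isDieudonneModule p G h) (isDieudonneModule p G' h')

/-- The map of Dieudonné modules given by `f^*`. -/
def dieudonneMap {G G' : AbInfInf k} (f : G ⟶ G') :
    DieudonneModule p G' →ₗ[DieudonneRing p k] DieudonneModule p G :=
  (exists_dieudonneMap p f).choose

theorem moduleEquiv_dieudonneMap {G G' : AbInfInf k} (f : G ⟶ G') (x : DieudonneModule p G') :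
    (moduleEquiv p G (dieudonneMap p f x) : G.R) = pullback f (moduleEquiv p G' x : G'.R) :=
  (exists_dieudonneMap p f).choose_spec x

variable (k) in
/-- The contravariant Dieudonné functor. -/
def dieudonneFunctor : (AbInfInf k)ᵒᵖ ⥤ ModuleCat.{u} (DieudonneRing p k) where
  obj G := ModuleCat.of _ (DieudonneModule p G.unop)
  map f := ModuleCat.ofHom (dieudonneMap p f.unop)
  map_id G := by
    refine ModuleCat.hom_ext (LinearMap.ext fun x => moduleEquiv_injective p ?_)
    exact moduleEquiv_dieudonneMap p _ x
  map_comp f g := by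
    refine ModuleCat.hom_ext (LinearMap.ext fun x => moduleEquiv_injective p ?_)
    refine (moduleEquiv_dieudonneMap p _ x).trans ?_
    refine Eq.trans ?_ (moduleEquiv_dieudonneMap p g.unop _).symm
    exact congrArg (pullback g.unop) (moduleEquiv_dieudonneMap p f.unop x).symm

theorem dieudonneMap_injective {G G' : AbInfInf k} (f : G ⟶ G') [Epi f] :
    Function.Injective (dieudonneMap p f) := by
  intro x y h
  refine moduleEquiv_injective p (injective_pullback_of_epi p f ?_)
  rw [← moduleEquiv_dieudonneMap, h, moduleEquiv_dieudonneMap]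

theorem dieudonneMap_exact {H G G' : AbInfInf k} {i : H ⟶ G} {f : G ⟶ G'} [Epi f]
    (h : IsKernel i f) : Function.Exact (dieudonneMap p f) (dieudonneMap p i) := by
  have hker : ∀ a, pullback i a = 0 ↔ a ∈ kernelIdeal (pullback f) := fun a => by
    rw [kernelIdeal, ← h.2]
    rfl
  intro x
  have h0 : (moduleEquiv p H 0 : H.R) = 0 :=
    (isDieudonneModule p H (verschiebungPowZero_level p H)).zero
  constructor
  · intro hx
    have hx0 : pullback i (moduleEquiv p G x : G.R) = 0 := by
      rw [← moduleEquiv_dieudonneMap, hx, h0]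
    obtain ⟨n, hn, hD⟩ := (moduleEquiv p G x).2
    have hn' := hn.mono (show _ ≤ max n (level p G') + 1 by omega)
    have hD' := (mem_dieudonneElements_iff hn').1 (moduleEquiv p G x).2
    obtain ⟨y, hy⟩ := mem_range_of_coaction_eq (pullback f) (pullback i : G.R →ₐ[k] H.R) h.1 hker
      (hD'.map_comul_eq_of_map_eq_zero (pullback i) hx0)
    have hyD : y ∈ dieudonneElements p k G'.R :=
      (mem_dieudonneElements_iff ((verschiebungPowZero_level p G').mono
        (show _ ≤ max n (level p G') + 1 by omega))).2
        (.of_map (injective_pullback_of_epi p f) (hy ▸ hD'))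
    refine ⟨(moduleEquiv p G').symm ⟨y, hyD⟩, moduleEquiv_injective p ?_⟩
    rw [moduleEquiv_dieudonneMap, Equiv.apply_symm_apply, hy]
  · rintro ⟨y, rfl⟩
    refine moduleEquiv_injective p ?_
    obtain ⟨n, hn, hD⟩ := (moduleEquiv p G' y).2
    rw [h0, moduleEquiv_dieudonneMap, moduleEquiv_dieudonneMap, hker]
    exact Ideal.mem_map_of_mem (pullback f : G'.R →ₐ[k] G.R) hD.1

end AbInfInf

/-! ### Invariant derivations and primitive elements of α-groups -/

section Derivation

variable {k : Type u} [Field k] {r : ℕ}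

/-- The invariant derivation `∂/∂t_i` of the coordinate ring of `G_a^r`. -/
def AddHopf.deriv (i : Fin r) : AddHopf r k →ₗ[k] AddHopf r k :=
  ((MvPolynomial.pderiv i : Derivation k (MvPolynomial (Fin r) k) (MvPolynomial (Fin r) k)) :
    MvPolynomial (Fin r) k →ₗ[k] MvPolynomial (Fin r) k)

theorem AddHopf.deriv_mul (i : Fin r) (a b : AddHopf r k) :
    deriv i (a * b) = a * deriv i b + b * deriv i a :=
  (MvPolynomial.pderiv i).leibniz (a : MvPolynomial (Fin r) k) b

theorem AddHopf.deriv_pow (i : Fin r) (a : AddHopf r k) (n : ℕ) :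
    deriv i (a ^ n) = n * a ^ (n - 1) * deriv i a :=
  (MvPolynomial.pderiv_pow (f := (a : MvPolynomial (Fin r) k)) (i := i) (n := n))

theorem AddHopf.deriv_t (i j : Fin r) :
    deriv i (t r k j) = if j = i then 1 else 0 := by
  refine (MvPolynomial.pderiv_X (R := k) i j).trans ?_
  rw [Pi.single_apply]
  split_ifs <;> rfl

theorem AddHopf.induction {P : AddHopf r k → Prop} (hC : ∀ c, P (algebraMap k _ c))
    (hadd : ∀ a b, P a → P b → P (a + b)) (hmul : ∀ a i, P a → P (a * t r k i)) (a : AddHopf r k) :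
    P a :=
  MvPolynomial.induction_on (motive := P) a hC hadd hmul

theorem AddHopf.deriv_algebraMap (i : Fin r) (c : k) :
    deriv i (algebraMap k (AddHopf r k) c) = 0 :=
  MvPolynomial.pderiv_C (i := i)

theorem AddHopf.lTensor_deriv_comul (i : Fin r) (a : AddHopf r k) :
    LinearMap.lTensor _ (deriv i) (Coalgebra.comul (R := k) a) = Coalgebra.comul (deriv i a) := by
  induction a using AddHopf.induction with
  | hC c =>
    rw [deriv_algebraMap, map_zero, Bialgebra.comul_algebraMap,
      Algebra.TensorProduct.algebraMap_apply, LinearMap.lTensor_tmul]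
    have := deriv_algebraMap (k := k) i 1
    rw [map_one] at this
    rw [this, tmul_zero]
  | hadd a b ha hb => simp only [map_add, ha, hb]
  | hmul a j ha =>
    have h : ∀ s : AddHopf r k ⊗[k] AddHopf r k, LinearMap.lTensor _ (deriv i)
        (s * (t r k j ⊗ₜ[k] 1 + 1 ⊗ₜ[k] t r k j)) = LinearMap.lTensor _ (deriv i) s *
          (t r k j ⊗ₜ[k] 1 + 1 ⊗ₜ[k] t r k j) + s * (1 ⊗ₜ[k] deriv i (t r k j)) := by
      intro s
      induction s using TensorProduct.induction_on with
      | zero => simp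
      | tmul x y =>
        simp only [mul_add, Algebra.TensorProduct.tmul_mul_tmul, map_add, LinearMap.lTensor_tmul,
          mul_one, deriv_mul, tmul_add]
        rw [mul_comm (t r k j) (deriv i y)]
        abel
      | add s u hs hu => simp only [add_mul, map_add, hs, hu]; abel
    have ht : Coalgebra.comul (R := k) (t r k j) = _ := AddHopf.t_mem_alphaModule k j
    have hd : Coalgebra.comul (R := k) (deriv i (t r k j)) = 1 ⊗ₜ[k] deriv i (t r k j) := by
      rw [deriv_t]
      split_ifs
      · rw [Bialgebra.comul_one, Algebra.TensorProduct.one_def]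
      · rw [map_zero, tmul_zero]
    rw [Bialgebra.comul_mul, ht, h, ha, deriv_mul, map_add, Bialgebra.comul_mul, hd,
      Bialgebra.comul_mul, ht]
    ring

variable {p : ℕ} [CharP k p]

theorem AddHopf.deriv_mem (i : Fin r) {a : AddHopf r k} (ha : a ∈ frobKernelIdeal p k _ 1) :
    deriv i a ∈ frobKernelIdeal p k (AddHopf r k) 1 := by
  induction ha using Submodule.span_induction with
  | mem x hx =>
    obtain ⟨y, -, rfl⟩ := hx
    have h0 : ((p : ℕ) : AddHopf r k) = 0 := by
      rw [← map_natCast (algebraMap k _), CharP.cast_eq_zero, map_zero]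
    rw [pow_one, deriv_pow, h0, zero_mul, zero_mul]
    exact zero_mem _
  | zero => rw [map_zero]; exact zero_mem _
  | add x y _ _ hx hy => rw [map_add]; exact add_mem hx hy
  | smul a x hx h =>
    rw [smul_eq_mul, deriv_mul]
    exact add_mem (Ideal.mul_mem_left _ _ h) (Ideal.mul_mem_right _ _ hx)

/-- A polynomial without constant term whose partial derivatives lie in the ideal of the `p`-th
powers of the variables lies in that ideal: the ideal is spanned by monomials, and no other
monomial than `1` with exponents less than `p` is killed by all the derivatives. -/
theorem mem_of_pderiv_mem {P : MvPolynomial (Fin r) k} (h0 : MvPolynomial.constantCoeff P = 0)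
    (h : ∀ i, MvPolynomial.pderiv i P ∈ Ideal.span
      ((fun s => MvPolynomial.monomial s (1 : k)) '' Set.range fun i => Finsupp.single i p)) :
    P ∈ Ideal.span
      ((fun s => MvPolynomial.monomial s (1 : k)) '' Set.range fun i => Finsupp.single i p) := by
  classical
  refine MvPolynomial.mem_ideal_span_monomial_image.2 fun m hm => ?_
  have hm0 : m ≠ 0 := by
    rintro rfl
    exact MvPolynomial.mem_support_iff.1 hm h0
  by_contra! hlt
  have hlt' : ∀ i, m i < p := fun i => by
    have := hlt _ ⟨i, rfl⟩
    rwa [Finsupp.single_le_iff, not_le] at this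
  obtain ⟨i, hi⟩ := Finsupp.ne_iff.1 hm0
  have hi : m i ≠ 0 := hi
  have hsub : m - Finsupp.single i 1 + Finsupp.single i 1 = m :=
    tsub_add_cancel_of_le (Finsupp.single_le_iff.2 (Nat.one_le_iff_ne_zero.2 hi))
  have hcoeff : MvPolynomial.coeff (m - Finsupp.single i 1) (MvPolynomial.pderiv i P) ≠ 0 := by
    rw [MvPolynomial.coeff_pderiv, hsub]
    refine mul_ne_zero (MvPolynomial.mem_support_iff.1 hm) ?_
    have e : (m - Finsupp.single i 1 : Fin r →₀ ℕ) i + 1 = m i := by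
      have := DFunLike.congr_fun hsub i
      rwa [Finsupp.add_apply, Finsupp.single_eq_same] at this
    rw [← Nat.cast_succ, Nat.succ_eq_add_one, e, Ne, CharP.cast_eq_zero_iff k p]
    exact Nat.not_dvd_of_pos_of_lt (Nat.pos_of_ne_zero hi) (hlt' i)
  obtain ⟨_, ⟨j, rfl⟩, hj⟩ := MvPolynomial.mem_ideal_span_monomial_image.1 (h i) _
    (MvPolynomial.mem_support_iff.2 hcoeff)
  rw [Finsupp.single_le_iff] at hj
  exact absurd (hlt' j) (not_lt.2 (hj.trans (Finsupp.le_def.1 tsub_le_self j)))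

theorem AddHopf.frobKernelIdeal_eq [Fact p.Prime] : frobKernelIdeal p k (AddHopf r k) 1 =
    (Ideal.span ((fun s => MvPolynomial.monomial s (1 : k)) '' Set.range fun i =>
      Finsupp.single i p) : Ideal (MvPolynomial (Fin r) k)) := by
  set J : Ideal (MvPolynomial (Fin r) k) := Ideal.span ((fun s => MvPolynomial.monomial s (1 : k)) ''
    Set.range fun i => Finsupp.single i p) with hJ
  refine le_antisymm (Ideal.span_le.2 ?_) (Ideal.span_le.2 ?_)
  · rintro _ ⟨y, hy, rfl⟩
    have h1 : ∀ P : MvPolynomial (Fin r) k, MvPolynomial.aeval (fun _ => (0 : k)) P = 0 →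
        P ^ p ^ 1 ∈ J := fun P hP => by
      have h2 := map_pow_eq_of_X_pow_eq_zero (p := p) (N := 1) (Ideal.Quotient.mkₐ k J)
        (fun i => by
          rw [pow_one, ← map_pow]
          exact Ideal.Quotient.eq_zero_iff_mem.2 (Ideal.subset_span
            ⟨Finsupp.single i p, ⟨i, rfl⟩, (MvPolynomial.X_pow_eq_monomial).symm⟩)) P
      rw [← map_pow, hP, map_zero, zero_pow (pow_ne_zero _ (Fact.out : p.Prime).ne_zero)] at h2
      exact Ideal.Quotient.eq_zero_iff_mem.1 h2
    exact h1 y hy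
  · rintro _ ⟨_, ⟨i, rfl⟩, rfl⟩
    refine Ideal.subset_span ⟨t r k i, AddHopf.lift_t (fun _ => (0 : k)) i, ?_⟩
    rw [pow_one]
    exact (MvPolynomial.X_pow_eq_monomial).symm

theorem AddHopf.mem_of_deriv_mem [Fact p.Prime] {a : AddHopf r k}
    (h0 : Coalgebra.counit (R := k) a = 0)
    (h : ∀ i, deriv i a ∈ frobKernelIdeal p k (AddHopf r k) 1) :
    a ∈ frobKernelIdeal p k (AddHopf r k) 1 := by
  rw [frobKernelIdeal_eq] at h ⊢
  exact mem_of_pderiv_mem ((MvPolynomial.aeval_zero _).symm.trans h0) h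

namespace AlphaHopf

/-- The invariant derivation `∂/∂t_i` of the coordinate ring of `α_p^r`. -/
def deriv (i : Fin r) : AlphaHopf p k r →ₗ[k] AlphaHopf p k r :=
  Submodule.mapQ ((frobKernelIdeal p k (AddHopf r k) 1).restrictScalars k)
    ((frobKernelIdeal p k (AddHopf r k) 1).restrictScalars k) (AddHopf.deriv i)
    fun _ ha => AddHopf.deriv_mem i ha

theorem deriv_mk (i : Fin r) (a : AddHopf r k) : deriv i
    (Ideal.Quotient.mk (frobKernelIdeal p k (AddHopf r k) 1) a) =
      Ideal.Quotient.mk _ (AddHopf.deriv i a) := rfl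

theorem deriv_mul (i : Fin r) (a b : AlphaHopf p k r) :
    deriv i (a * b) = a * deriv i b + b * deriv i a := by
  obtain ⟨a, rfl⟩ := Ideal.Quotient.mk_surjective a
  obtain ⟨b, rfl⟩ := Ideal.Quotient.mk_surjective b
  rw [← map_mul, deriv_mk, deriv_mk, deriv_mk, AddHopf.deriv_mul]
  rfl

theorem deriv_algebraMap (i : Fin r) (c : k) :
    deriv i (algebraMap k (AlphaHopf p k r) c) = 0 := by
  refine (deriv_mk i (algebraMap k (AddHopf r k) c)).trans ?_
  rw [AddHopf.deriv_algebraMap, map_zero]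

variable [Fact p.Prime]

theorem deriv_t (i j : Fin r) : deriv i (t p k r j) = if j = i then 1 else 0 := by
  rw [t, deriv_mk, AddHopf.deriv_t]
  split_ifs <;> rfl

theorem induction {P : AlphaHopf p k r → Prop} (hC : ∀ c, P (algebraMap k _ c))
    (hadd : ∀ a b, P a → P b → P (a + b)) (hmul : ∀ a i, P a → P (a * t p k r i))
    (a : AlphaHopf p k r) : P a := by
  obtain ⟨a, rfl⟩ := Ideal.Quotient.mk_surjective a
  induction a using AddHopf.induction with
  | hC c => exact hC c
  | hadd a b ha hb => rw [map_add]; exact hadd _ _ ha hb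
  | hmul a i ha => rw [map_mul]; exact hmul _ i ha

theorem lTensor_deriv_comul (i : Fin r) (a : AlphaHopf p k r) :
    LinearMap.lTensor _ (deriv i) (Coalgebra.comul (R := k) a) = Coalgebra.comul (deriv i a) := by
  obtain ⟨a, rfl⟩ := Ideal.Quotient.mk_surjective a
  let π := (Ideal.Quotient.mkₐ k (frobKernelIdeal p k (AddHopf r k) 1)).toLinearMap
  have h : ∀ s : AddHopf r k ⊗[k] AddHopf r k, LinearMap.lTensor _ (deriv i)
      (TensorProduct.map π π s) =
        TensorProduct.map π π (LinearMap.lTensor _ (AddHopf.deriv i) s) := by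
    intro s
    induction s using TensorProduct.induction_on with
    | zero => simp
    | tmul x y => rfl
    | add s u hs hu => simp only [map_add, hs, hu]
  rw [deriv_mk]
  refine (h (Coalgebra.comul a)).trans ?_
  rw [AddHopf.lTensor_deriv_comul]
  rfl

theorem eq_zero_of_deriv_eq_zero {a : AlphaHopf p k r} (h0 : Coalgebra.counit (R := k) a = 0)
    (h : ∀ i, deriv i a = 0) : a = 0 := by
  obtain ⟨a, rfl⟩ := Ideal.Quotient.mk_surjective a
  exact Ideal.Quotient.eq_zero_iff_mem.2
    (AddHopf.mem_of_deriv_mem h0 fun i => Ideal.Quotient.eq_zero_iff_mem.1 (h i))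

/-- An invariant derivation maps primitive elements to constants. -/
theorem deriv_of_mem_alphaModule (i : Fin r) {x : AlphaHopf p k r}
    (hx : x ∈ alphaModule k (AlphaHopf p k r)) :
    deriv i x = algebraMap k _ (Coalgebra.counit (R := k) (deriv i x)) := by
  have h := lTensor_deriv_comul i x
  have h1 : deriv i (1 : AlphaHopf p k r) = 0 := by
    have := deriv_algebraMap (p := p) (k := k) i 1
    rwa [map_one] at this
  rw [show Coalgebra.comul (R := k) x = _ from hx, map_add, LinearMap.lTensor_tmul,
    LinearMap.lTensor_tmul, h1, tmul_zero, zero_add] at h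
  have h2 := Coalgebra.lTensor_counit_comul (R := k) (deriv i x)
  rw [← h, LinearMap.lTensor_tmul] at h2
  have h3 := congrArg (TensorProduct.rid k _) h2
  rw [TensorProduct.rid_tmul, TensorProduct.rid_tmul, one_smul] at h3
  rw [← h3, Algebra.algebraMap_eq_smul_one, map_smul, Bialgebra.counit_one]
  simp

theorem sum_deriv (c : Fin r → k) (i : Fin r) :
    deriv i (∑ j, c j • t p k r j) = algebraMap k _ (c i) := by
  simp [map_sum, deriv_t, Algebra.algebraMap_eq_smul_one]

theorem counit_t (i : Fin r) : Coalgebra.counit (R := k) (t p k r i) = 0 :=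
  counit_eq_zero_of_mem_alphaModule (t_mem_alphaModule r i)

/-- The primitive elements of `k[t₁, …, t_r]/(t_i^p)` are the linear forms. -/
theorem exists_eq_sum_of_mem_alphaModule {x : AlphaHopf p k r}
    (hx : x ∈ alphaModule k (AlphaHopf p k r)) : ∃ c : Fin r → k, x = ∑ i, c i • t p k r i := by
  refine ⟨fun i => Coalgebra.counit (R := k) (deriv i x), sub_eq_zero.1
    (eq_zero_of_deriv_eq_zero ?_ fun i => ?_)⟩
  · rw [map_sub, counit_eq_zero_of_mem_alphaModule hx, map_sum]
    simp [counit_t]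
  · rw [map_sub, sum_deriv, ← deriv_of_mem_alphaModule i hx, sub_self]

theorem sum_smul_t_injective {c d : Fin r → k}
    (h : ∑ i, c i • t p k r i = ∑ i, d i • t p k r i) : c = d := by
  funext i
  have := congrArg (deriv i) h
  rw [sum_deriv, sum_deriv] at this
  exact FaithfulSMul.algebraMap_injective k (AlphaHopf p k r) this

end AlphaHopf
end Derivation

/-! ### The a-number and the Dieudonné module of an α-group -/

section ANumber

variable {p : ℕ} [Fact p.Prime] {k : Type u} [Field k] [CharP k p]

namespace AlphaHopf

/-- The coefficient of `t_i` of an element of `k[t₁, …, t_r]/(t_i^p)`. -/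
def linearCoeff {r : ℕ} (i : Fin r) : AlphaHopf p k r →ₗ[k] k :=
  Coalgebra.counit ∘ₗ deriv i

theorem linearCoeff_mul {r : ℕ} (i : Fin r) (a b : AlphaHopf p k r) :
    linearCoeff i (a * b) = Coalgebra.counit (R := k) a * linearCoeff i b +
      Coalgebra.counit (R := k) b * linearCoeff i a := by
  simp only [linearCoeff, LinearMap.comp_apply, deriv_mul, map_add, Bialgebra.counit_mul]

theorem linearCoeff_algebraMap {r : ℕ} (i : Fin r) (c : k) :
    linearCoeff i (algebraMap k (AlphaHopf p k r) c) = 0 := by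
  rw [linearCoeff, LinearMap.comp_apply, deriv_algebraMap, map_zero]

theorem linearCoeff_alphaCoord : linearCoeff 0 (alphaCoord p k) = 1 := by
  have : deriv 0 (alphaCoord p k) = 1 := (deriv_t 0 0).trans (if_pos rfl)
  rw [linearCoeff, LinearMap.comp_apply, this, Bialgebra.counit_one]

theorem counit_alphaCoord : Coalgebra.counit (R := k) (alphaCoord p k) = 0 := counit_t 0

theorem linearCoeff_eq_zero_of_mem {z : AlphaHopf p k 1}
    (hz : z ∈ Ideal.span {alphaCoord p k ^ 2}) : linearCoeff 0 z = 0 := by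
  obtain ⟨w, rfl⟩ := Ideal.mem_span_singleton'.1 hz
  have h2 : linearCoeff 0 (alphaCoord p k ^ 2) = 0 := by
    rw [pow_two, linearCoeff_mul, counit_alphaCoord, zero_mul, add_zero]
  rw [linearCoeff_mul, h2, mul_zero, zero_add, Bialgebra.counit_pow, counit_alphaCoord,
    zero_pow two_ne_zero, zero_mul]

/-- An element of `k[t]/(t^p)` is, modulo `t²`, the sum of its constant and its linear term. -/
theorem sub_mem_span (y : AlphaHopf p k 1) :
    y - (algebraMap k _ (Coalgebra.counit (R := k) y) + linearCoeff 0 y • alphaCoord p k) ∈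
      Ideal.span {alphaCoord p k ^ 2} := by
  induction y using AlphaHopf.induction with
  | hC c =>
    rw [linearCoeff_algebraMap, Bialgebra.counit_algebraMap, zero_smul, add_zero]
    simp
  | hadd a b ha hb =>
    have := add_mem ha hb
    simp only [map_add, add_smul]
    convert this using 1
    abel
  | hmul a i ha =>
    obtain rfl : i = 0 := Subsingleton.elim _ _
    change a * alphaCoord p k - (algebraMap k _ (Coalgebra.counit (R := k) (a * alphaCoord p k)) +
      linearCoeff 0 (a * alphaCoord p k) • alphaCoord p k) ∈ _
    rw [Bialgebra.counit_mul, linearCoeff_mul, counit_alphaCoord, linearCoeff_alphaCoord, mul_zero,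
      map_zero, zero_mul, add_zero, mul_one, zero_add]
    have h1 := Ideal.mul_mem_right (alphaCoord p k) _ ha
    have h2 : linearCoeff 0 a • alphaCoord p k ^ 2 ∈ Ideal.span {alphaCoord p k ^ 2} :=
      Submodule.smul_of_tower_mem _ _ (Ideal.subset_span rfl)
    convert add_mem h1 h2 using 1
    simp only [Algebra.smul_def]
    ring

end AlphaHopf

variable {R : Type u} [CommRing R] [HopfAlgebra k R]

/-- Elements of `alphaHom` are derivations along the counit. -/
theorem alphaHom_isDerivation {δ : R →ₗ[k] k} (hδ : δ ∈ alphaHom p k R) :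
    δ 1 = 0 ∧ ∀ a b, δ (a * b) =
      Coalgebra.counit (R := k) a * δ b + Coalgebra.counit (R := k) b * δ a := by
  induction hδ using Submodule.span_induction with
  | mem δ h =>
    obtain ⟨f, hf⟩ := h
    have e : ∀ x, δ x = AlphaHopf.linearCoeff 0 (f x) := fun x => by
      have := AlphaHopf.linearCoeff_eq_zero_of_mem (hf x)
      rw [map_sub, map_add, map_smul, AlphaHopf.linearCoeff_algebraMap,
        AlphaHopf.linearCoeff_alphaCoord, zero_add, smul_eq_mul, mul_one, sub_eq_zero] at this
      exact this.symm
    refine ⟨?_, fun a b => ?_⟩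
    · have := AlphaHopf.linearCoeff_algebraMap (p := p) (0 : Fin 1) (1 : k)
      rwa [map_one, ← map_one f, ← e] at this
    · rw [e, e, e, map_mul, AlphaHopf.linearCoeff_mul, CoalgHomClass.counit_comp_apply,
        CoalgHomClass.counit_comp_apply]
  | zero => simp
  | add δ δ' _ _ h h' =>
    refine ⟨by simp [h.1, h'.1], fun a b => ?_⟩
    simp only [LinearMap.add_apply, h.2, h'.2]
    ring
  | smul c δ _ h =>
    refine ⟨by simp [h.1], fun a b => ?_⟩
    simp only [LinearMap.smul_apply, h.2, smul_eq_mul]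
    ring

/-- The a-number of `α_p^r` is `r`. -/
theorem aNumber_eq {r : ℕ} (E : R ≃ₐc[k] AlphaHopf p k r) : aNumber p k R = r := by
  let Θ : alphaHom p k R →ₗ[k] (Fin r → k) :=
    { toFun := fun δ i => δ.1 (E.symm (AlphaHopf.t p k r i))
      map_add' := fun _ _ => rfl
      map_smul' := fun _ _ => rfl }
  have hinj : Function.Injective Θ := by
    rintro ⟨δ₁, h₁⟩ ⟨δ₂, h₂⟩ h
    obtain ⟨δ, hδ, rfl⟩ : ∃ δ ∈ alphaHom p k R, δ₁ = δ + δ₂ :=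
      ⟨_, sub_mem h₁ h₂, (sub_add_cancel _ _).symm⟩
    have h0 : ∀ i, δ (E.symm (AlphaHopf.t p k r i)) = 0 := fun i =>
      add_eq_right.1 (congrFun h i)
    refine Subtype.ext (add_eq_right.2 (LinearMap.ext fun x => ?_))
    obtain ⟨h1, h2⟩ := alphaHom_isDerivation hδ
    obtain ⟨y, rfl⟩ : ∃ y, E.symm y = x := ⟨E x, E.symm_apply_apply x⟩
    change δ (E.symm y) = 0
    induction y using AlphaHopf.induction with
    | hC c =>
      have : E.symm (algebraMap k _ c) = c • 1 := by
        rw [Algebra.algebraMap_eq_smul_one, map_smul, map_one]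
      rw [this, map_smul, h1, smul_zero]
    | hadd a b ha hb =>
      rw [map_add, map_add, ha, hb, add_zero]
    | hmul a i ha =>
      have ht : Coalgebra.counit (R := k) (E.symm (AlphaHopf.t p k r i)) = 0 :=
        (CoalgHomClass.counit_comp_apply E.symm _).trans (AlphaHopf.counit_t i)
      have hi := h0 i
      rw [map_mul, h2, hi, ht, mul_zero, zero_mul, add_zero]
  have hsurj : Function.Surjective Θ := by
    intro c
    have hx : ∀ i, c i • alphaCoord p k ∈ alphaModule k (AlphaHopf p k 1) := fun i => by
      have := AlphaHopf.t_mem_alphaModule (p := p) (k := k) 1 0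
      change Coalgebra.comul (R := k) (alphaCoord p k) = _ at this
      change Coalgebra.comul (R := k) (c i • alphaCoord p k) = _
      rw [map_smul, this, smul_add, smul_tmul', tmul_smul]
      rfl
    have hxp : ∀ i, (c i • alphaCoord p k) ^ p = 0 := fun i =>
      AlphaHopf.pow_eq_zero 1 (counit_eq_zero_of_mem_alphaModule (hx i))
    let f : AlphaHopf p k r →ₐc[k] AlphaHopf p k 1 := alphaLift _ hx hxp
    let g : R →ₐc[k] AlphaHopf p k 1 := f.comp (E : R →ₐc[k] AlphaHopf p k r)
    refine ⟨⟨AlphaHopf.linearCoeff 0 ∘ₗ (g : R →ₗc[k] AlphaHopf p k 1).toLinearMap,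
      Submodule.subset_span ⟨g, fun x => ?_⟩⟩, ?_⟩
    · rw [← CoalgHomClass.counit_comp_apply g]
      exact AlphaHopf.sub_mem_span (g x)
    · funext i
      change AlphaHopf.linearCoeff 0 (f (E (E.symm (AlphaHopf.t p k r i)))) = c i
      rw [E.apply_symm_apply]
      refine (congrArg (AlphaHopf.linearCoeff 0) (alphaLift_mk _ hx hxp i)).trans ?_
      rw [map_smul, AlphaHopf.linearCoeff_alphaCoord, smul_eq_mul, mul_one]
  rw [aNumber, (LinearEquiv.ofBijective Θ ⟨hinj, hsurj⟩).finrank_eq, Module.finrank_fin_fun]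

end ANumber

section AlphaModule

variable {p : ℕ} [Fact p.Prime] {k : Type u} [Field k] [CharP k p] [PerfectRing k p]
variable {R : Type u} [CommRing R] [HopfAlgebra k R] [Coalgebra.IsCocomm k R] [Module.Finite k R]

theorem wittPhi_eq_add_of_forall_lt {B : Type*} [CommRing B] {n : ℕ} {u v : ℕ → B}
    (hu : ∀ i < n, u i = 0) (hv : ∀ i < n, v i = 0) : wittPhi p n u v = u n + v n := by
  rw [wittPhi_eq_coeff]
  exact coeff_add_of_forall_lt hu hv

theorem iterate_verschiebung_eq_zero_of_pos {x : R} (hx : verschiebung p k x = 0) {j : ℕ}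
    (hj : j ≠ 0) : (verschiebung p k)^[j] x = 0 :=
  iterate_verschiebung_eq_zero_of_le (Nat.one_le_iff_ne_zero.2 hj) hx

theorem isDieudonneElement_of_mem_alphaModule (n : ℕ) {x : R} (hx : x ∈ alphaModule k R) :
    IsDieudonneElement p k n x := by
  refine ⟨counit_eq_zero_of_mem_alphaModule hx, ?_⟩
  have h : ∀ i < n, (verschiebung p k)^[n - i] x = 0 := fun i hi =>
    iterate_verschiebung_eq_zero_of_pos (verschiebung_eq_zero_of_mem_alphaModule hx) (by omega)
  rw [wittPhi_eq_add_of_forall_lt (fun i hi => by rw [h i hi, zero_tmul])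
    (fun i hi => by rw [h i hi, tmul_zero]), Nat.sub_self]
  exact hx

theorem dieudonneElements_eq_alphaModule (h : VerschiebungPowZero p k R 1) :
    dieudonneElements p k R = alphaModule k R := by
  ext x
  rw [mem_dieudonneElements_iff (n := 0) h]
  refine ⟨fun hx => hx.2.trans ?_, isDieudonneElement_of_mem_alphaModule 0⟩
  rw [wittPhi_eq_add_of_forall_lt (by simp) (by simp)]
  rfl

theorem dotAdd_of_verschiebung_eq_zero (n : ℕ) {x y : R} (hx : verschiebung p k x = 0)
    (hy : verschiebung p k y = 0) : dotAdd p k n x y = x + y := by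
  rw [dotAdd, wittPhi_eq_add_of_forall_lt
    (fun i hi => iterate_verschiebung_eq_zero_of_pos hx (by omega))
    (fun i hi => iterate_verschiebung_eq_zero_of_pos hy (by omega)), Nat.sub_self]
  rfl

theorem dotSMul_of_verschiebung_eq_zero (n : ℕ) (c : WittVector p k) {x : R}
    (hx : verschiebung p k x = 0) : dotSMul p k n c x = c.coeff 0 ^ p ^ n • x := by
  have hp := (Fact.out : p.Prime).ne_zero
  have hV : ∀ d : k, verschiebung p k (d • x) = 0 := fun d => by
    obtain ⟨e, rfl⟩ := (frobeniusEquiv k p).surjective d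
    exact (verschiebung_smul e x).trans (by rw [hx, smul_zero])
  have h : ∀ i, dotSMulAux p k n c x i = c.coeff 0 ^ p ^ n • x := by
    intro i
    induction i with
    | zero => rfl
    | succ i ih =>
      rw [dotSMulAux, ih, iterate_verschiebung_eq_zero_of_pos hx (Nat.succ_ne_zero i),
        zero_pow (pow_ne_zero _ hp), smul_zero, dotAdd_of_verschiebung_eq_zero n (hV _)
          verschiebung_zero, add_zero]
  exact h n


namespace DieudonneRing

variable (p k) in
/-- The left ideal `A(F, V)`. -/
abbrev leftIdealFV : Submodule (DieudonneRing p k) (DieudonneRing p k) :=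
  Submodule.span (DieudonneRing p k) {F p k, V p k}

theorem F_mem_leftIdealFV : F p k ∈ leftIdealFV p k := Submodule.subset_span (Or.inl rfl)

theorem V_mem_leftIdealFV : V p k ∈ leftIdealFV p k := Submodule.subset_span (Or.inr rfl)

theorem mul_ofWitt_mem_leftIdealFV {a : DieudonneRing p k} (ha : a ∈ leftIdealFV p k)
    (w : WittVector p k) : a * ofWitt p k w ∈ leftIdealFV p k := by
  induction ha using Submodule.span_induction with
  | mem x hx =>
    rcases hx with rfl | rfl
    · rw [F_mul_ofWitt]
      exact Submodule.smul_mem _ _ F_mem_leftIdealFV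
    · rw [V_mul_ofWitt]
      exact Submodule.smul_mem _ _ V_mem_leftIdealFV
  | zero => rw [zero_mul]; exact zero_mem _
  | add x y _ _ hx hy => rw [add_mul]; exact add_mem hx hy
  | smul b x _ hx =>
    rw [smul_eq_mul, mul_assoc]
    exact Submodule.smul_mem _ _ hx

/-- `A = W(k) + A(F, V)`. -/
theorem exists_sub_ofWitt_mem (a : DieudonneRing p k) :
    ∃ w, a - ofWitt p k w ∈ leftIdealFV p k := by
  induction a using DieudonneRing.induction with
  | hF => exact ⟨0, by rw [map_zero, sub_zero]; exact F_mem_leftIdealFV⟩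
  | hV => exact ⟨0, by rw [map_zero, sub_zero]; exact V_mem_leftIdealFV⟩
  | hw w => exact ⟨w, by rw [sub_self]; exact zero_mem _⟩
  | hadd a b ha hb =>
    obtain ⟨w, hw⟩ := ha
    obtain ⟨w', hw'⟩ := hb
    exact ⟨w + w', by rw [map_add, add_sub_add_comm]; exact add_mem hw hw'⟩
  | hmul a b ha hb =>
    obtain ⟨w, hw⟩ := ha
    obtain ⟨w', hw'⟩ := hb
    refine ⟨w * w', ?_⟩
    have e : a * b - ofWitt p k (w * w') =
        a • (b - ofWitt p k w') + (a - ofWitt p k w) * ofWitt p k w' := by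
      rw [map_mul, smul_eq_mul]
      noncomm_ring
    rw [e]
    exact add_mem (Submodule.smul_mem _ _ hw') (mul_ofWitt_mem_leftIdealFV hw w')

theorem ofWitt_mem_leftIdealFV {w : WittVector p k} (hw : w.coeff 0 = 0) :
    ofWitt p k w ∈ leftIdealFV p k := by
  obtain ⟨u, rfl⟩ := Ideal.mem_span_singleton'.1
    ((WittVector.mem_span_p_iff_coeff_zero_eq_zero w).2 hw)
  rw [map_mul, map_natCast, ← FV_eq, ← mul_assoc]
  exact Submodule.smul_mem _ _ V_mem_leftIdealFV

end DieudonneRing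

/-- The Dieudonné module of `α_p^r` is `(A/A(F, V))^r`: it is killed by `F` and `V`, and `W(k)`
acts on it through a Frobenius twist of its residue field `k`. -/
theorem nonempty_linearEquiv_of_isAlphaGroup (hα : IsAlphaGroup p k R) {j n : ℕ} {M : Type u}
    [AddCommGroup M] [Module (DieudonneRing p k) M] {e : M ≃ dieudonneElements p k R}
    (he : IsDieudonneModule p k R j n e) :
    Nonempty (M ≃ₗ[DieudonneRing p k] (Fin (aNumber p k R) → DieudonneRing.ModFV p k)) := by
  obtain ⟨r, ⟨E⟩⟩ := hα
  rw [aNumber_eq E]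
  have hV1 : VerschiebungPowZero p k R 1 := (AlphaHopf.verschiebungPowZero r).of_surjective
    (E.symm : AlphaHopf p k r →ₐc[k] R) fun x => ⟨E x, E.symm_apply_apply x⟩
  have hD := dieudonneElements_eq_alphaModule hV1
  have hmem : ∀ x : M, (e x : R) ∈ alphaModule k R := fun x => hD ▸ (e x).2
  have hV : ∀ x : M, verschiebung p k (e x : R) = 0 := fun x =>
    verschiebung_eq_zero_of_mem_alphaModule (hmem x)
  have hext : ∀ {x y : M}, (e x : R) = e y → x = y := fun h => e.injective (Subtype.ext h)
  let eHom : M →+ R :=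
    { toFun := fun x => e x
      map_zero' := he.zero
      map_add' := fun x y => (he.add x y).trans (dotAdd_of_verschiebung_eq_zero n (hV x) (hV y)) }
  have hFM : ∀ x : M, DieudonneRing.F p k • x = 0 := fun x => hext (by
    rw [he.F_smul, he.zero]
    refine EquivLike.injective E ?_
    rw [map_pow, map_zero]
    exact AlphaHopf.pow_eq_zero r ((CoalgHomClass.counit_comp_apply E _).trans
      (counit_eq_zero_of_mem_alphaModule (hmem x))))
  have hVM : ∀ x : M, DieudonneRing.V p k • x = 0 := fun x => hext (by
    rw [he.V_smul, he.zero, hV])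
  let τ : Fin r → R := fun i => E.symm (AlphaHopf.t p k r i)
  have hτ : ∀ i, τ i ∈ dieudonneElements p k R := fun i => by
    rw [hD]
    exact mem_alphaModule_map (E.symm : AlphaHopf p k r →ₐc[k] R) (AlphaHopf.t_mem_alphaModule r i)
  have hsum : ∀ c : Fin r → k, E (∑ i, c i • τ i) = ∑ i, c i • AlphaHopf.t p k r i := fun c => by
    rw [map_sum]
    exact Finset.sum_congr rfl fun i _ => by rw [map_smul, E.apply_symm_apply]
  let m : Fin r → M := fun i => e.symm ⟨τ i, hτ i⟩
  let ψ : Fin r → DieudonneRing.ModFV p k →ₗ[DieudonneRing p k] M := fun i =>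
    Submodule.liftQ _ (LinearMap.toSpanSingleton (DieudonneRing p k) M (m i)) (by
      refine Submodule.span_le.2 ?_
      rintro _ (rfl | rfl)
      · exact hFM _
      · exact hVM _)
  let Φ : (Fin r → DieudonneRing.ModFV p k) →ₗ[DieudonneRing p k] M :=
    ∑ i, (ψ i).comp (LinearMap.proj i)
  have hΦ : ∀ c : Fin r → WittVector p k, eHom (Φ fun i => Submodule.Quotient.mk
      (DieudonneRing.ofWitt p k ((WittVector.frobeniusEquiv p k)^[j] (c i)))) =
        ∑ i, (c i).coeff 0 ^ p ^ n • τ i := by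
    intro c
    rw [LinearMap.sum_apply, map_sum]
    refine Finset.sum_congr rfl fun i _ => ?_
    change (e (DieudonneRing.ofWitt p k ((WittVector.frobeniusEquiv p k)^[j] (c i)) • m i) : R) = _
    rw [he.smul, dotSMul_of_verschiebung_eq_zero n _ (hV _)]
    simp [m]
  have hrep : ∀ v : Fin r → DieudonneRing.ModFV p k, ∃ c : Fin r → WittVector p k,
      v = fun i => Submodule.Quotient.mk
        (DieudonneRing.ofWitt p k ((WittVector.frobeniusEquiv p k)^[j] (c i))) := by
    intro v
    have : ∀ i, ∃ c : WittVector p k, v i = Submodule.Quotient.mk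
        (DieudonneRing.ofWitt p k ((WittVector.frobeniusEquiv p k)^[j] c)) := fun i => by
      obtain ⟨a, ha⟩ := Submodule.Quotient.mk_surjective _ (v i)
      obtain ⟨w, hw⟩ := DieudonneRing.exists_sub_ofWitt_mem a
      obtain ⟨c, rfl⟩ := (WittVector.frobeniusEquiv p k).surjective.iterate j w
      exact ⟨c, ha.symm.trans ((Submodule.Quotient.eq _).2 hw)⟩
    choose c hc using this
    exact ⟨c, funext hc⟩
  refine ⟨(LinearEquiv.ofBijective Φ ⟨?_, fun x => ?_⟩).symm⟩
  · refine (injective_iff_map_eq_zero Φ).2 fun v hv => ?_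
    obtain ⟨c, rfl⟩ := hrep v
    have h0 : (fun i => (c i).coeff 0 ^ p ^ n) = fun _ => 0 := by
      refine AlphaHopf.sum_smul_t_injective (p := p) ?_
      rw [← hsum, ← hΦ, hv, map_zero, map_zero]
      simp
    funext i
    refine (Submodule.Quotient.mk_eq_zero _).2 (DieudonneRing.ofWitt_mem_leftIdealFV ?_)
    rw [iterate_frobeniusEquiv_coeff, eq_zero_of_pow_eq_zero (congrFun h0 i),
      zero_pow (pow_ne_zero _ (Fact.out : p.Prime).ne_zero)]
  · obtain ⟨d, hd⟩ := AlphaHopf.exists_eq_sum_of_mem_alphaModule (p := p)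
      (mem_alphaModule_map (E : R →ₐc[k] AlphaHopf p k r) (hmem x))
    refine ⟨_, hext ((hΦ fun i => WittVector.teichmuller p
      ((iterateFrobeniusEquiv k p n).symm (d i))).trans (EquivLike.injective E ?_))⟩
    rw [hsum]
    refine Eq.trans (Finset.sum_congr rfl fun i _ => ?_) hd.symm
    rw [WittVector.teichmuller_coeff_zero]
    exact congrArg (· • _) ((iterateFrobeniusEquiv k p n).apply_symm_apply (d i))

end AlphaModule

/-! ### Homomorphisms to truncated Witt schemes -/

section TruncatedWitt

variable {p : ℕ} [Fact p.Prime] {k : Type u} [Field k] [CharP k p] [PerfectRing k p]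
variable {R : Type u} [CommRing R] [HopfAlgebra k R] [Coalgebra.IsCocomm k R] [Module.Finite k R]

/-- A homomorphism `Spec R → W_n` lands in `W_{n,m}` if `F^{m+1}` kills its last component, as the
other components are obtained from that one by the Verschiebung. -/
theorem wittHom_eq_zero_of_mem {n m : ℕ} (f : WittHopf p n k →ₐc[k] R)
    (h : f (WittHopf.x p n k n) ^ p ^ (m + 1) = 0) :
    ∀ a ∈ frobKernelIdeal p k (WittHopf p n k) (m + 1), f a = 0 := by
  refine map_eq_zero_of_mem_frobKernelIdeal f fun a => ?_
  refine map_pow_eq_of_X_pow_eq_zero (σ := Fin (n + 1)) (f : WittHopf p n k →ₐ[k] R) (fun i => ?_) a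
  have hx : WittHopf.x p n k i = (MvPolynomial.X i : MvPolynomial (Fin (n + 1)) k) := dif_pos i.2
  have h1 := WittHopf.map_x_eq_iterate_verschiebung f (Nat.lt_succ_iff.1 i.2)
  have h2 : f (WittHopf.x p n k i) ^ p ^ (m + 1) = 0 := by
    rw [h1, ← iterate_verschiebung_pow, h, iterate_verschiebung_zero]
  rw [hx] at h2
  exact h2

theorem existsUnique_truncWittHom {n m : ℕ} {x : R}
    (h : ∃! f : WittHopf p n k →ₐc[k] R, f (WittHopf.x p n k n) = x) (hx : x ^ p ^ (m + 1) = 0) :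
    ∃! f : TruncWittHopf p k n m →ₐc[k] R, f (TruncWittHopf.x p k n m n) = x := by
  obtain ⟨f, hf, huniq⟩ := h
  refine ⟨quotientLift _ f (wittHom_eq_zero_of_mem f (by rw [hf, hx])), hf, fun g hg => ?_⟩
  have h1 := huniq (g.comp (Bialgebra.Quotient.mkBialgHom _)) hg
  refine DFunLike.ext _ _ fun a => ?_
  obtain ⟨a, rfl⟩ := Ideal.Quotient.mk_surjective a
  exact DFunLike.congr_fun h1 a

end TruncatedWitt

end Dieudonne

end

open CategoryTheory Opposite Dieudonne in
theorem proposition3p1 (p : ℕ) [Fact p.Prime] (k : Type u) [Field k] [CharP k p]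
    [PerfectRing k p] :
    -- (i) Dieudonné elements correspond to homomorphisms `G → W_n`
    (∀ (R : Type u) [CommRing R] [HopfAlgebra k R] [Coalgebra.IsCocomm k R] [Module.Finite k R]
        [IsLocalRing R] (n : ℕ), VerschiebungPowZero p k R (n + 1) →
      (∀ x : R, x ∈ dieudonneElements p k R ↔ IsDieudonneElement p k n x) ∧
      (∀ f : WittHopf p n k →ₐc[k] R, f (WittHopf.x p n k n) ∈ dieudonneElements p k R) ∧
      (∀ x ∈ dieudonneElements p k R,
        ∃! f : WittHopf p n k →ₐc[k] R, f (WittHopf.x p n k n) = x) ∧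
      (∀ (f : WittHopf p n k →ₐc[k] R), ∀ i ≤ n,
        f (WittHopf.x p n k i) = (verschiebung p k)^[n - i] (f (WittHopf.x p n k n)))) ∧
    -- (ii) the `A`-module structure at level `n`
    (∀ (R : Type u) [CommRing R] [HopfAlgebra k R] [Coalgebra.IsCocomm k R] [Module.Finite k R]
        [IsLocalRing R] (n : ℕ), VerschiebungPowZero p k R (n + 1) →
      ∃ (_ : AddCommGroup (dieudonneElements p k R))
        (_ : Module (DieudonneRing p k) (dieudonneElements p k R)),
        IsDieudonneModule p k R 0 n (Equiv.refl (dieudonneElements p k R)) ∧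
        (∀ (c : k) (x : dieudonneElements p k R),
          c • (x : R) ∈ dieudonneElements p k R ∧
          c • (x : R) = ((DieudonneRing.ofWitt p k (WittVector.teichmuller p
            ((iterateFrobeniusEquiv k p n).symm c)) • x : dieudonneElements p k R) : R)) ∧
        IsFiniteLengthOverWitt p k (dieudonneElements p k R)) ∧
    -- (iii) at a common level `n`, `f^*` is `A`-linear
    (∀ (G G' : AbInfInf k) (f : G ⟶ G') (n : ℕ), VerschiebungPowZero p k G.R (n + 1) →
      VerschiebungPowZero p k G'.R (n + 1) →
      ∀ (M M' : Type u) [AddCommGroup M] [Module (DieudonneRing p k) M]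
        [AddCommGroup M'] [Module (DieudonneRing p k) M']
        (e : M ≃ dieudonneElements p k G.R) (e' : M' ≃ dieudonneElements p k G'.R),
        IsDieudonneModule p k G.R 0 n e → IsDieudonneModule p k G'.R 0 n e' →
        ∃ g : M' →ₗ[DieudonneRing p k] M,
          ∀ x, (e (g x) : G.R) = AbInfInf.pullback f (e' x : G'.R)) ∧
    -- (iii) the contravariant functor `D` and its left exactness on epimorphisms
    (∃ (D : (AbInfInf k)ᵒᵖ ⥤ ModuleCat.{u} (DieudonneRing p k))
       (e : ∀ G : AbInfInf k, D.obj (op G) ≃ dieudonneElements p k G.R),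
      (∀ (G : AbInfInf k) (n : ℕ), VerschiebungPowZero p k G.R (n + 1) →
        IsDieudonneModule p k G.R n n (e G)) ∧
      (∀ G : AbInfInf k, IsFiniteLengthOverWitt p k (D.obj (op G))) ∧
      (∀ G : AbInfInf k, ∃ n, VerschiebungPowZero p k G.R (n + 1)) ∧
      (∀ (G G' : AbInfInf k) (f : G ⟶ G') (x : D.obj (op G')),
        (e G (D.map f.op x) : G.R) = AbInfInf.pullback f (e G' x : G'.R)) ∧
      (∀ (G G' : AbInfInf k) (f : G ⟶ G') [Epi f],
        Function.Injective (D.map f.op) ∧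
        (∃ (H : AbInfInf k) (i : H ⟶ G), AbInfInf.IsKernel i f) ∧
        (∀ (H : AbInfInf k) (i : H ⟶ G), AbInfInf.IsKernel i f →
          Function.Exact (D.map f.op) (D.map i.op))) ∧
      (∀ G : AbInfInf k, IsAlphaGroup p k G.R →
        Nonempty (D.obj (op G) ≃ₗ[DieudonneRing p k]
          (Fin (aNumber p k G.R) → DieudonneRing.ModFV p k)))) ∧
    -- (iv) the `α`-module
    (∀ (R : Type u) [CommRing R] [HopfAlgebra k R] [Coalgebra.IsCocomm k R] [Module.Finite k R]
        [IsLocalRing R] (n : ℕ), VerschiebungPowZero p k R (n + 1) →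
      alphaModule k R ⊆ dieudonneElements p k R ∧
      (VerschiebungPowZero p k R 1 → dieudonneElements p k R = alphaModule k R) ∧
      (IsAlphaGroup p k R →
        ∀ (M : Type u) [AddCommGroup M] [Module (DieudonneRing p k) M]
          (e : M ≃ dieudonneElements p k R), IsDieudonneModule p k R 0 n e →
          Nonempty (M ≃ₗ[DieudonneRing p k]
            (Fin (aNumber p k R) → DieudonneRing.ModFV p k)))) ∧
    -- (v) the universal properties of `W_n` and `W_{n,m}`
    (∀ (G : AbInfInf k) (n : ℕ), ∀ x ∈ dieudonneElements p k G.R,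
      (verschiebung p k)^[n + 1] x = 0 →
      (∃! f : WittHopf p n k →ₐc[k] G.R, f (WittHopf.x p n k n) = x) ∧
      (∀ m : ℕ, x ^ p ^ (m + 1) = 0 →
        ∃! f : TruncWittHopf p k n m →ₐc[k] G.R, f (TruncWittHopf.x p k n m n) = x)) := by
  refine ⟨?_, ?_, ?_, ?_, ?_, ?_⟩
  · intro R _ _ _ _ _ n hV
    refine ⟨fun x => mem_dieudonneElements_iff hV, fun f => ?_, fun x hx => ?_, fun f i hi =>
      WittHopf.map_x_eq_iterate_verschiebung f hi⟩
    · exact (mem_dieudonneElements_iff hV).2 (isDieudonneElement_of_wittHom f)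
    · have h := (mem_dieudonneElements_iff hV).1 hx
      exact existsUnique_wittHom h (hV x h.1)
  · intro R _ _ _ _ _ n hV
    refine ⟨(inferInstance : AddCommGroup (LevelModule 0 hV)),
      (inferInstance : Module (DieudonneRing p k) (LevelModule 0 hV)),
      LevelModule.isDieudonneModule 0 hV, fun c x => ?_, LevelModule.isFiniteLength 0 hV⟩
    have h := smul_mem_dieudonneElements hV c (x : LevelModule 0 hV)
    refine ⟨?_, h⟩
    have h' : c • (x : R) = _ := h
    rw [h']
    exact Subtype.property _
  · intro G G' f n hn hn' M M' _ _ _ _ e e' he he'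
    exact exists_linearMap hn hn' (AbInfInf.pullback f) he he'
  · refine ⟨AbInfInf.dieudonneFunctor p k, AbInfInf.moduleEquiv p,
      fun G n hn => AbInfInf.isDieudonneModule p G hn,
      fun G => LevelModule.isFiniteLength _ _, fun G => exists_verschiebungPowZero p,
      fun G G' f x => AbInfInf.moduleEquiv_dieudonneMap p f x,
      fun G G' f _ => ⟨AbInfInf.dieudonneMap_injective p f, AbInfInf.exists_isKernel p f,
        fun H i hi => AbInfInf.dieudonneMap_exact p hi⟩,
      fun G hG => nonempty_linearEquiv_of_isAlphaGroup hG
        (AbInfInf.isDieudonneModule p G (AbInfInf.verschiebungPowZero_level p G))⟩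
  · intro R _ _ _ _ _ n hV
    refine ⟨fun x hx => (mem_dieudonneElements_iff hV).2 (isDieudonneElement_of_mem_alphaModule n hx),
      dieudonneElements_eq_alphaModule, fun hα M _ _ e he =>
        nonempty_linearEquiv_of_isAlphaGroup hα he⟩
  · intro G n x hx hVx
    obtain ⟨m, hm, h⟩ := hx
    have h1 := existsUnique_wittHom (h.level (hm x h.1) hVx) hVx
    exact ⟨h1, fun m hm => existsUnique_truncWittHom h1 hm⟩
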